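/- Let $k$ be a field of characteristic $0$, let $n\ge 2$, and let $F_n$ be the free group on $\sigma_1,\dots,\sigma_n$. **The algebra.** Let $\widehat Q$ be the quiver with vertices $1,\dots,n$, with four arrows $x,y:i\to j$ and $x^*,y^*:j\to i$ for all $i<j$, and with a loop $z$ at each vertex; put $x^{**}=x$, $y^{**}=y$. Let $\widehat A$ be the quotient of the path algebra of $\widehat Q$ over $k$ (paths are composed from left to right) by the two-sided ideal generated by all paths of length two with distinct end points and by the elements $e_i a^* b\, e_i-\delta_{a,b}\,e_i z e_i$ for $a,b\in\{x,y,x^*,y^*\}$ (where $a^*b$ is a path from $i$ to $i$ through another vertex). The algebra $\widehat A$ is graded by path length: $\deg e_i=0$, $\deg x=\deg y=\deg x^*=\deg y^*=1$, $\deg z=2$. Put $P_i=\widehat A e_i$, and for a graded module $M$ let $M\langle r\rangle_d=M_{d+r}$. **The category and the action.** Let $\mathcal D$ be the homotopy category of bounded cochain complexes of finitely generated projective graded left $\widehat A$-modules, with morphisms of degree $0$ and $Y[m]^p=Y^{m+p}$. For each $i$ let $\Sigma_i$ and $\Sigma_i^{-1}$ be the endofunctors of $\mathcal D$ given by the tensor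 product over $\widehat A$ with the complexes of graded bimodules $$\widehat A\xrightarrow{\,g_i\,}(\widehat A e_i\otimes_k e_i\widehat A)\langle 2\rangle\quad\text{and}\quad \widehat A e_i\otimes_k e_i\widehat A\xrightarrow{\,f_i\,}\widehat A ,$$ with $\widehat A$ in cohomological degree $0$, where $f_i(a\otimes b)=ab$ and $g_i(1)=z e_i\otimes e_i+e_i\otimes e_i z+\sum_a a^*\otimes a$, the sum being over all arrows $a$ other than loops with source $i$. For $\beta\in F_n$ with reduced word $\sigma_{i_1}^{\epsilon_1}\cdots\sigma_{i_r}^{\epsilon_r}$ let $\Psi_\beta=\Sigma_{i_1}^{\epsilon_1}\circ\cdots\circ\Sigma_{i_r}^{\epsilon_r}$. **The t-structure.** Let $\mathcal D^0\subset\mathcal D$ be the full subcategory of the objects isomorphic to a linear complex, i.e. to a complex $Y$ such that each term $Y^m$ is a finite direct sum of modules $P_j\langle m\rangle$. Put $\mathcal D^m=\mathcal D^0[m]$. For integers $a\le b$ let $\mathcal D^{[a,b]}$ be the full subcategory of the objects all of whose non-zero t-slices lie in subcategories $\mathcal D^m$ with $a\le m\le b$, i.e. the objects having a finite filtration by distinguished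 triangles whose successive subquotients lie in $\mathcal D^m$ for strictly decreasing integers $m\in[a,b]$. **Proposition.** For every $\beta\in F_n$ there is a smallest interval $[\phi_-(\beta),\phi_+(\beta)]\subset\mathbb Z$ (with finite ends) such that $\Psi_\beta(\mathcal D^0)\subset\mathcal D^{[\phi_-(\beta),\phi_+(\beta)]}$, and $$d(\alpha,\beta)=\phi_+(\beta^{-1}\alpha)-\phi_-(\beta^{-1}\alpha)$$ is a left-invariant metric on $F_n$ with values in $\mathbb Z_{\ge0}$: for all $\alpha,\beta,\gamma\in F_n$ one has $d(\alpha,\beta)\ge0$, $d(\alpha,\beta)=0$ if and only if $\alpha=\beta$, $d(\alpha,\beta)=d(\beta,\alpha)$, $d(\alpha,\gamma)\le d(\alpha,\beta)+d(\beta,\gamma)$ and $d(\gamma\alpha,\gamma\beta)=d(\alpha,\beta)$. Moreover, $\Psi_\beta(\mathcal D^0)\subset\mathcal D^0$ if and only if $\beta=1$. -/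

import Mathlib

open CategoryTheory CategoryTheory.Limits
open scoped TensorProduct

universe u

noncomputable section

namespace ExoticMetric

/-! ### Gradings by submodules -/

section Gradings

variable {k : Type u} [Field k] {M N : Type u} [AddCommGroup M] [Module k M]
  [AddCommGroup N] [Module k N]

lemma internal_of_components {gr : ℤ → Submodule k M} (π : M →ₗ[k] (ℤ →₀ M))
    (h : ∀ d, ∀ x ∈ gr d, π x = Finsupp.single d x) (h' : ⨆ d, gr d = ⊤) :
    DirectSum.IsInternal gr := by
  rw [DirectSum.isInternal_submodule_iff_iSupIndep_and_iSup_eq_top]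
  refine ⟨fun d => ?_, h'⟩
  rw [Submodule.disjoint_def]
  intro x hx hx'
  have h1 : π x d = x := by rw [h d x hx, Finsupp.single_eq_same]
  have h2 : (⨆ j, ⨆ (_ : j ≠ d), gr j) ≤
      LinearMap.ker ((Finsupp.lapply (R := k) d) ∘ₗ π) := by
    refine iSup₂_le fun j hj y hy => ?_
    simp [h j y hy, hj.symm]
  rw [← h1]
  exact h2 hx'

lemma exists_components {gr : ℤ → Submodule k M} (h : DirectSum.IsInternal gr) :
    ∃ π : M →ₗ[k] (ℤ →₀ M), ∀ d, ∀ x ∈ gr d, π x = Finsupp.single d x := by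
  let E : (DirectSum ℤ fun d => gr d) ≃ₗ[k] M :=
    LinearEquiv.ofBijective (DirectSum.coeLinearMap gr) h
  refine ⟨(DirectSum.toModule k ℤ (ℤ →₀ M)
    (fun d => Finsupp.lsingle d ∘ₗ (gr d).subtype)) ∘ₗ E.symm.toLinearMap, fun d x hx => ?_⟩
  have : E.symm x = DirectSum.lof k ℤ (fun d => gr d) d ⟨x, hx⟩ := by
    rw [LinearEquiv.symm_apply_eq]
    exact (DirectSum.coeLinearMap_lof gr d ⟨x, hx⟩).symm
  simp [this]

lemma iSup_eq_top_of_internal {gr : ℤ → Submodule k M} (h : DirectSum.IsInternal gr) :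
    ⨆ d, gr d = ⊤ := h.submodule_iSup_eq_top

/-- A grading restricts to a retract, if the retraction preserves degrees. -/
lemma internal_comap {gr : ℤ → Submodule k M} (h : DirectSum.IsInternal gr)
    (inc : N →ₗ[k] M) (ret : M →ₗ[k] N) (hret : ∀ x, ret (inc x) = x)
    (hdeg : ∀ d, ∀ x ∈ gr d, inc (ret x) ∈ gr d) :
    DirectSum.IsInternal fun d => (gr d).comap inc := by
  obtain ⟨π, hπ⟩ := exists_components h
  refine internal_of_components (Finsupp.mapRange.linearMap ret ∘ₗ π ∘ₗ inc) ?_ ?_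
  · intro d x hx
    simp [hπ d _ hx, hret]
  · rw [eq_top_iff]
    rintro x -
    have hx : inc x ∈ ⨆ d, gr d := by rw [iSup_eq_top_of_internal h]; trivial
    have := Submodule.mem_map_of_mem (f := ret) hx
    rw [hret, Submodule.map_iSup] at this
    refine SetLike.le_def.1 (iSup_mono fun d => ?_) this
    rintro _ ⟨y, hy, rfl⟩
    exact hdeg d y hy

lemma internal_shift {gr : ℤ → Submodule k M} (h : DirectSum.IsInternal gr) (r : ℤ) :
    DirectSum.IsInternal fun d => gr (d + r) := by
  obtain ⟨π, hπ⟩ := exists_components h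
  refine internal_of_components (Finsupp.lmapDomain M k (fun d => d - r) ∘ₗ π) ?_ ?_
  · intro d x hx
    simp [hπ _ x hx]
  · rw [← iSup_eq_top_of_internal h]
    exact (Equiv.addRight r).surjective.iSup_comp gr

lemma internal_prod {gr : ℤ → Submodule k M} {gr' : ℤ → Submodule k N}
    (h : DirectSum.IsInternal gr) (h' : DirectSum.IsInternal gr') :
    DirectSum.IsInternal fun d => (gr d).prod (gr' d) := by
  obtain ⟨π, hπ⟩ := exists_components h
  obtain ⟨π', hπ'⟩ := exists_components h'
  refine internal_of_components
    ((Finsupp.mapRange.linearMap (LinearMap.inl k M N)) ∘ₗ π ∘ₗ LinearMap.fst k M N +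
      (Finsupp.mapRange.linearMap (LinearMap.inr k M N)) ∘ₗ π' ∘ₗ LinearMap.snd k M N) ?_ ?_
  · rintro d ⟨x, y⟩ ⟨hx, hy⟩
    simp [hπ d x hx, hπ' d y hy, ← Finsupp.single_add]
  · rw [eq_top_iff]
    rintro ⟨x, y⟩ -
    have hx : x ∈ ⨆ d, gr d := by rw [iSup_eq_top_of_internal h]; trivial
    have hy : y ∈ ⨆ d, gr' d := by rw [iSup_eq_top_of_internal h']; trivial
    have hx' := Submodule.mem_map_of_mem (f := LinearMap.inl k M N) hx
    have hy' := Submodule.mem_map_of_mem (f := LinearMap.inr k M N) hy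
    rw [Submodule.map_iSup] at hx' hy'
    have : (x, y) = LinearMap.inl k M N x + LinearMap.inr k M N y := by simp
    rw [this]
    refine add_mem (SetLike.le_def.1 (iSup_mono fun d => ?_) hx')
      (SetLike.le_def.1 (iSup_mono fun d => ?_) hy')
    · rintro _ ⟨z, hz, rfl⟩; exact ⟨hz, zero_mem _⟩
    · rintro _ ⟨z, hz, rfl⟩; exact ⟨zero_mem _, hz⟩

/-- The total grading of a tensor product, shifted by `r`: the part of degree `d` is spanned by the
`x ⊗ y` with `x` of degree `p`, `y` of degree `q`, and `p + q = d + r`. -/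
def tensorGrade (gr : ℤ → Submodule k M) (gr' : ℤ → Submodule k N) (r d : ℤ) :
    Submodule k (M ⊗[k] N) :=
  Submodule.span k {t | ∃ p q : ℤ, p + q = d + r ∧ ∃ x ∈ gr p, ∃ y ∈ gr' q, x ⊗ₜ[k] y = t}

lemma tmul_mem_tensorGrade {gr : ℤ → Submodule k M} {gr' : ℤ → Submodule k N} {r d p q : ℤ}
    {x : M} {y : N} (hx : x ∈ gr p) (hy : y ∈ gr' q) (h : p + q = d + r) :
    x ⊗ₜ[k] y ∈ tensorGrade gr gr' r d :=
  Submodule.subset_span ⟨p, q, h, x, hx, y, hy, rfl⟩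

lemma tensorGrade_le {gr : ℤ → Submodule k M} {gr' : ℤ → Submodule k N} {r d : ℤ}
    {S : Submodule k (M ⊗[k] N)}
    (h : ∀ p q, p + q = d + r → ∀ x ∈ gr p, ∀ y ∈ gr' q, x ⊗ₜ[k] y ∈ S) :
    tensorGrade gr gr' r d ≤ S :=
  Submodule.span_le.2 (by rintro _ ⟨p, q, hpq, x, hx, y, hy, rfl⟩; exact h p q hpq x hx y hy)

lemma internal_tensorGrade {gr : ℤ → Submodule k M} {gr' : ℤ → Submodule k N}
    (h : DirectSum.IsInternal gr) (h' : DirectSum.IsInternal gr') (r : ℤ) :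
    DirectSum.IsInternal (tensorGrade gr gr' r) := by
  obtain ⟨π, hπ⟩ := exists_components h
  obtain ⟨π', hπ'⟩ := exists_components h'
  refine internal_of_components (Finsupp.lmapDomain (M ⊗[k] N) k (fun x : ℤ × ℤ => x.1 + x.2 - r) ∘ₗ
    (finsuppTensorFinsupp k k M N ℤ ℤ).toLinearMap ∘ₗ TensorProduct.map π π') ?_ ?_
  · intro d t ht
    induction ht using Submodule.span_induction with
    | mem t ht =>
      obtain ⟨p, q, hpq, x, hx, y, hy, rfl⟩ := ht
      have : p + q - r = d := by omega
      simp [hπ p x hx, hπ' q y hy, this]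
    | zero => simp
    | add x y _ _ hx hy => rw [map_add, hx, hy, Finsupp.single_add]
    | smul c x _ hx => rw [map_smul, hx, Finsupp.smul_single]
  · rw [eq_top_iff, ← TensorProduct.span_tmul_eq_top, Submodule.span_le]
    rintro _ ⟨x, y, rfl⟩
    have hx : x ∈ ⨆ d, gr d := by rw [iSup_eq_top_of_internal h]; trivial
    have hy : y ∈ ⨆ d, gr' d := by rw [iSup_eq_top_of_internal h']; trivial
    induction hx using Submodule.iSup_induction' with
    | mem p x hx =>
      induction hy using Submodule.iSup_induction' with
      | mem q y hy =>
        exact Submodule.mem_iSup_of_mem (p + q - r) (tmul_mem_tensorGrade hx hy (by omega))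
      | zero => simp
      | add y y' _ _ h1 h2 => rw [TensorProduct.tmul_add]; exact add_mem h1 h2
    | zero => simp
    | add y y' _ _ h1 h2 => rw [TensorProduct.add_tmul]; exact add_mem h1 h2

end Gradings


/-! ### The quiver and the zigzag algebra -/

/-- The arrows of the quiver obtained from the doubled complete graph on `Fin n` by replacing each
of its edges by a pair of opposite arrows and adding a loop at each vertex. For `i ≠ j`,
`edge i j h false : i ⟶ j` lies over the `x`-edge between `i` and `j` (it is `x` if `i < j` and
`x*` if `j < i`), and `edge i j h true` lies over the `y`-edge (it is `y`, respectively `y*`). The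
arrow dual to `edge i j _ c` is `edge j i _ c`. -/
inductive Arrow (n : ℕ) : Type
  | edge (i j : Fin n) (h : i ≠ j) (c : Bool) : Arrow n
  | loop (i : Fin n) : Arrow n

namespace Arrow

variable {n : ℕ}

/-- The source of an arrow. -/
def src : Arrow n → Fin n
  | edge i _ _ _ => i
  | loop i => i

/-- The target of an arrow. -/
def tgt : Arrow n → Fin n
  | edge _ j _ _ => j
  | loop i => i

/-- The path-length degree: the edges have degree one, the loops have degree two. -/
def deg : Arrow n → ℤ
  | edge _ _ _ _ => 1
  | loop _ => 2

end Arrow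

/-- The generators of the path algebra: the paths `e i` of length zero and the arrows. -/
inductive Gen (n : ℕ) : Type
  | e (i : Fin n) : Gen n
  | arr (a : Arrow n) : Gen n

/-- The path-length degree of a generator. -/
def Gen.deg {n : ℕ} : Gen n → ℤ
  | e _ => 0
  | arr a => a.deg

/-- The relations of the zigzag algebra. The first five families present the path algebra of the
quiver (paths are composed from left to right). The others generate the ideal `I`: a path of length
two with distinct end points vanishes; for edges `a`, `b` such that `a* b` is a path from `i` to
`i`, one has `a* b = δ_{a,b} z`. The relation `z ^ 2 = 0` follows from the others if `2 ≤ n`, and is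
the usual convention if `n = 1`. -/
inductive Rel (k : Type u) [Field k] (n : ℕ) : FreeAlgebra k (Gen n) → FreeAlgebra k (Gen n) → Prop
  | idem (i : Fin n) : Rel k n (.ι k (.e i) * .ι k (.e i)) (.ι k (.e i))
  | orth (i j : Fin n) (h : i ≠ j) : Rel k n (.ι k (.e i) * .ι k (.e j)) 0
  | unit : Rel k n (∑ i, .ι k (.e i)) 1
  | src (a : Arrow n) : Rel k n (.ι k (.e a.src) * .ι k (.arr a)) (.ι k (.arr a))
  | tgt (a : Arrow n) : Rel k n (.ι k (.arr a) * .ι k (.e a.tgt)) (.ι k (.arr a))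
  | distinct (a b : Arrow n) (h : a.tgt = b.src) (h' : a.src ≠ b.tgt) :
      Rel k n (.ι k (.arr a) * .ι k (.arr b)) 0
  | dual (i j : Fin n) (h : i ≠ j) (c : Bool) :
      Rel k n (.ι k (.arr (.edge i j h c)) * .ι k (.arr (.edge j i h.symm c)))
        (.ι k (.arr (.loop i)))
  | nondual (i j : Fin n) (h : i ≠ j) (c c' : Bool) (hc : c ≠ c') :
      Rel k n (.ι k (.arr (.edge i j h c)) * .ι k (.arr (.edge j i h.symm c'))) 0
  | loop_sq (i : Fin n) : Rel k n (.ι k (.arr (.loop i)) * .ι k (.arr (.loop i))) 0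

/-- The zigzag algebra of the doubled complete graph on `n` vertices. -/
def Zigzag (k : Type u) [Field k] (n : ℕ) : Type u := RingQuot (Rel k n)

instance (k : Type u) [Field k] (n : ℕ) : Ring (Zigzag k n) :=
  inferInstanceAs (Ring (RingQuot (Rel k n)))

instance (k : Type u) [Field k] (n : ℕ) : Algebra k (Zigzag k n) :=
  inferInstanceAs (Algebra k (RingQuot (Rel k n)))

namespace Zigzag

variable (k : Type u) [Field k] {n : ℕ}

/-- The quotient map from the free algebra. -/
def mk : FreeAlgebra k (Gen n) →ₐ[k] Zigzag k n := RingQuot.mkAlgHom k (Rel k n)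

/-- The class of a generator in the zigzag algebra. -/
def gen (g : Gen n) : Zigzag k n := mk k (FreeAlgebra.ι k g)

/-- The idempotent at the vertex `i`. -/
def e (i : Fin n) : Zigzag k n := gen k (.e i)

/-- The class of an arrow. -/
def arr (a : Arrow n) : Zigzag k n := gen k (.arr a)

/-- The path-length grading: `grade k n d` is spanned by the vertices (for `d = 0`), the edges
(for `d = 1`) and the loops (for `d = 2`). -/
def grade (n : ℕ) (d : ℤ) : Submodule k (Zigzag k n) :=
  Submodule.span k {x | ∃ g : Gen n, g.deg = d ∧ gen k g = x}

lemma rel {x y : FreeAlgebra k (Gen n)} (h : Rel k n x y) :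
    mk k x = mk k y :=
  RingQuot.mkAlgHom_rel k h

lemma e_mul_self (i : Fin n) : e k i * e k i = e k i := by
  simpa only [map_mul, e, arr, gen] using rel k (Rel.idem i)

lemma e_mul_e_of_ne {i j : Fin n} (h : i ≠ j) : e k i * e k j = 0 := by
  simpa only [map_mul, map_zero, e, arr, gen] using rel k (Rel.orth i j h)

lemma sum_e : ∑ i : Fin n, e k i = 1 := by
  simpa only [map_sum, map_one, e, gen] using rel k (Rel.unit (k := k) (n := n))

lemma e_src_mul (a : Arrow n) : e k a.src * arr k a = arr k a := by
  simpa only [map_mul, e, arr, gen] using rel k (Rel.src a)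

lemma arr_mul_e_tgt (a : Arrow n) : arr k a * e k a.tgt = arr k a := by
  simpa only [map_mul, e, arr, gen] using rel k (Rel.tgt a)

lemma e_mul_arr_of_ne {i : Fin n} {a : Arrow n} (h : i ≠ a.src) : e k i * arr k a = 0 := by
  rw [← e_src_mul, ← mul_assoc, e_mul_e_of_ne k h, zero_mul]

lemma arr_mul_e_of_ne {i : Fin n} {a : Arrow n} (h : a.tgt ≠ i) : arr k a * e k i = 0 := by
  rw [← arr_mul_e_tgt, mul_assoc, e_mul_e_of_ne k h, mul_zero]

lemma arr_mul_arr_of_ne {a b : Arrow n} (h : a.tgt ≠ b.src) : arr k a * arr k b = 0 := by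
  rw [← e_src_mul k b, ← mul_assoc, arr_mul_e_of_ne k h, zero_mul]

lemma arr_mul_arr_of_src_ne_tgt {a b : Arrow n} (h : a.src ≠ b.tgt) : arr k a * arr k b = 0 := by
  by_cases h' : a.tgt = b.src
  · simpa only [map_mul, map_zero, e, arr, gen] using rel k (Rel.distinct a b h' h)
  · exact arr_mul_arr_of_ne k h'

lemma edge_mul_edge {i j : Fin n} (h : i ≠ j) (h' : j ≠ i) (c c' : Bool) :
    arr k (.edge i j h c) * arr k (.edge j i h' c') = if c = c' then arr k (.loop i) else 0 := by
  split_ifs with hc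
  · subst hc
    simpa only [map_mul, e, arr, gen] using rel k (Rel.dual i j h c)
  · simpa only [map_mul, map_zero, e, arr, gen] using rel k (Rel.nondual i j h c c' hc)

lemma loop_mul_edge (l : Fin n) {i j : Fin n} (h : i ≠ j) (c : Bool) :
    arr k (.loop l) * arr k (.edge i j h c) = 0 := by
  by_cases hl : l = i
  · subst hl; exact arr_mul_arr_of_src_ne_tgt k h
  · exact arr_mul_arr_of_ne k hl

lemma edge_mul_loop (l : Fin n) {i j : Fin n} (h : i ≠ j) (c : Bool) :
    arr k (.edge i j h c) * arr k (.loop l) = 0 := by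
  by_cases hl : j = l
  · subst hl; exact arr_mul_arr_of_src_ne_tgt k h
  · exact arr_mul_arr_of_ne k hl

lemma loop_mul_loop (i j : Fin n) : arr k (.loop i) * arr k (.loop j) = 0 := by
  by_cases h : i = j
  · subst h
    simpa only [map_mul, map_zero, e, arr, gen] using rel k (Rel.loop_sq i)
  · exact arr_mul_arr_of_ne k h

/-- The edge from `i` to `j` over the edge of the graph labelled by `c`, and zero if `i = j`. -/
def edge (i j : Fin n) (c : Bool) : Zigzag k n := if h : i = j then 0 else arr k (.edge i j h c)

lemma e_mul_e (i j : Fin n) : e k i * e k j = if i = j then e k i else 0 := by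
  split_ifs with h
  · rw [← h, e_mul_self]
  · exact e_mul_e_of_ne k h

lemma e_mul_loop (l i : Fin n) :
    e k l * arr k (.loop i) = if l = i then arr k (.loop i) else 0 := by
  split_ifs with h
  · rw [h]; exact e_src_mul k (.loop i)
  · exact e_mul_arr_of_ne k h

lemma loop_mul_e (l i : Fin n) :
    arr k (.loop i) * e k l = if i = l then arr k (.loop i) else 0 := by
  split_ifs with h
  · rw [← h]; exact arr_mul_e_tgt k (.loop i)
  · exact arr_mul_e_of_ne k h

lemma e_mul_edge (l i j : Fin n) (c : Bool) :
    e k l * edge k i j c = if l = i then edge k i j c else 0 := by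
  unfold edge
  split_ifs with h h' h'
  · exact mul_zero _
  · exact mul_zero _
  · rw [h']; exact e_src_mul k (.edge i j h c)
  · exact e_mul_arr_of_ne k h'

lemma edge_mul_e (l i j : Fin n) (c : Bool) :
    edge k i j c * e k l = if j = l then edge k i j c else 0 := by
  unfold edge
  split_ifs with h h' h'
  · exact zero_mul _
  · exact zero_mul _
  · rw [← h']; exact arr_mul_e_tgt k (.edge i j h c)
  · exact arr_mul_e_of_ne k h'

lemma edge_mul_edge' (i j p q : Fin n) (c c' : Bool) (h : p ≠ q) :
    edge k i j c * edge k p q c' =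
      if j = p then if i = q then if c = c' then arr k (.loop i) else 0 else 0 else 0 := by
  rw [edge, edge, dif_neg h]
  split_ifs with h1 h2 h3 h4 h2 h3 h4 <;> try exact zero_mul _
  · exact absurd (h3.symm.trans (h1.trans h2)) h.symm
  · subst h2 h3
    rw [edge_mul_edge, if_pos h4]
  · subst h2 h3
    rw [edge_mul_edge, if_neg h4]
  · exact arr_mul_arr_of_src_ne_tgt k h3
  · exact arr_mul_arr_of_ne k h2

lemma edge_mul_edge'' (i j p q : Fin n) (c c' : Bool) (h : i ≠ j) :
    edge k i j c * edge k p q c' =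
      if j = p then if i = q then if c = c' then arr k (.loop i) else 0 else 0 else 0 := by
  by_cases hpq : p = q
  · subst hpq
    rw [show edge k p p c' = 0 from dif_pos rfl, mul_zero]
    split_ifs with h1 h2
    · exact absurd (h2.trans h1.symm) h
    all_goals rfl
  · exact edge_mul_edge' k i j p q c c' hpq

lemma loop_mul_edge' (l i j : Fin n) (c : Bool) : arr k (.loop l) * edge k i j c = 0 := by
  unfold edge
  split_ifs with h
  · exact mul_zero _
  · exact loop_mul_edge k l h c

lemma edge_mul_loop' (l i j : Fin n) (c : Bool) : edge k i j c * arr k (.loop l) = 0 := by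
  unfold edge
  split_ifs with h
  · exact zero_mul _
  · exact edge_mul_loop k l h c

lemma edge_mem_grade (i j : Fin n) (c : Bool) : edge k i j c ∈ grade k n 1 := by
  unfold edge
  split_ifs with h
  · exact zero_mem _
  · exact Submodule.subset_span ⟨.arr (.edge i j h c), rfl, rfl⟩

lemma gen_mem_grade (g : Gen n) : gen k g ∈ grade k n g.deg :=
  Submodule.subset_span ⟨g, rfl, rfl⟩

lemma gen_mul_gen_mem (g g' : Gen n) : gen k g * gen k g' ∈ grade k n (g.deg + g'.deg) := by
  rcases g with i | a <;> rcases g' with j | b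
  · by_cases h : i = j
    · subst h
      have := gen_mem_grade k (.e i)
      simpa [Gen.deg] using (e_mul_self k i).symm ▸ this
    · exact (e_mul_e_of_ne k h).symm ▸ zero_mem _
  · by_cases h : i = b.src
    · subst h
      have := gen_mem_grade k (.arr b)
      simpa [Gen.deg] using (e_src_mul k b).symm ▸ this
    · exact (e_mul_arr_of_ne k h).symm ▸ zero_mem _
  · by_cases h : a.tgt = j
    · subst h
      have := gen_mem_grade k (.arr a)
      simpa [Gen.deg] using (arr_mul_e_tgt k a).symm ▸ this
    · exact (arr_mul_e_of_ne k h).symm ▸ zero_mem _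
  · change arr k a * arr k b ∈ _
    rcases a with ⟨i, j, h, c⟩ | i <;> rcases b with ⟨i', j', h', c'⟩ | i'
    · by_cases h1 : j = i'
      · by_cases h2 : i = j'
        · subst h1 h2
          rw [edge_mul_edge]
          split_ifs
          · exact gen_mem_grade k (.arr (.loop i))
          · exact zero_mem _
        · rw [arr_mul_arr_of_src_ne_tgt k (by exact h2)]; exact zero_mem _
      · rw [arr_mul_arr_of_ne k (by exact h1)]; exact zero_mem _
    · rw [edge_mul_loop]; exact zero_mem _
    · rw [loop_mul_edge]; exact zero_mem _
    · rw [loop_mul_loop]; exact zero_mem _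

lemma mul_mem_grade {p q : ℤ} {x y : Zigzag k n} (hx : x ∈ grade k n p) (hy : y ∈ grade k n q) :
    x * y ∈ grade k n (p + q) := by
  refine Submodule.span_induction₂ (p := fun x y _ _ => x * y ∈ grade k n (p + q))
    ?_ ?_ ?_ ?_ ?_ ?_ ?_ hx hy
  · rintro _ _ ⟨g, rfl, rfl⟩ ⟨g', rfl, rfl⟩
    exact gen_mul_gen_mem k g g'
  · intro y _; rw [zero_mul]; exact zero_mem _
  · intro x _; rw [mul_zero]; exact zero_mem _
  · intro x y z _ _ _ h h'; rw [add_mul]; exact add_mem h h'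
  · intro x y z _ _ _ h h'; rw [mul_add]; exact add_mem h h'
  · intro r x y _ _ h; rw [smul_mul_assoc]; exact Submodule.smul_mem _ _ h
  · intro r x y _ _ h; rw [mul_smul_comm]; exact Submodule.smul_mem _ _ h

lemma grade_le_span (d : ℤ) : grade k n d ≤ Submodule.span k (Set.range (gen k (n := n))) :=
  Submodule.span_mono (by rintro _ ⟨g, -, rfl⟩; exact ⟨g, rfl⟩)

lemma induction {P : Zigzag k n → Prop} (h0 : ∀ r : k, P (algebraMap k _ r))
    (hg : ∀ g, P (gen k g)) (hadd : ∀ x y, P x → P y → P (x + y))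
    (hmul : ∀ x y, P x → P y → P (x * y)) (x : Zigzag k n) : P x := by
  obtain ⟨x, rfl⟩ : ∃ y, mk k y = x := RingQuot.mkAlgHom_surjective k (Rel k n) x
  induction x using FreeAlgebra.induction with
  | grade0 r => rw [AlgHom.commutes]; exact h0 r
  | grade1 g => exact hg g
  | mul x y hx hy => rw [map_mul]; exact hmul _ _ hx hy
  | add x y hx hy => rw [map_add]; exact hadd _ _ hx hy

lemma span_gen : Submodule.span k (Set.range (gen k (n := n))) = ⊤ := by
  rw [eq_top_iff]
  rintro x -
  refine induction k (P := fun x => x ∈ Submodule.span k (Set.range (gen k (n := n))))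
    ?_ (fun g => Submodule.subset_span ⟨g, rfl⟩) (fun _ _ => add_mem) ?_ x
  · intro r
    rw [Algebra.algebraMap_eq_smul_one, ← sum_e]
    exact Submodule.smul_mem _ _
      (Submodule.sum_mem _ fun i _ => Submodule.subset_span ⟨.e i, rfl⟩)
  · intro x y hx hy
    have h := Submodule.mul_mem_mul hx hy
    rw [Submodule.span_mul_span] at h
    refine Submodule.span_le.2 ?_ h
    rintro _ ⟨_, ⟨g, rfl⟩, _, ⟨g', rfl⟩, rfl⟩
    exact grade_le_span k _ (gen_mul_gen_mem k g g')

lemma iSup_grade : ⨆ d, grade k n d = ⊤ := by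
  rw [eq_top_iff, ← span_gen, Submodule.span_le]
  rintro _ ⟨g, rfl⟩
  exact Submodule.mem_iSup_of_mem g.deg (gen_mem_grade k g)

instance : Finite (Gen n) :=
  Finite.of_injective (β := Fin n ⊕ (Fin n × Fin n × Bool) ⊕ Fin n)
    (fun g => match g with
      | .e i => .inl i
      | .arr (.edge i j _ c) => .inr (.inl (i, j, c))
      | .arr (.loop i) => .inr (.inr i))
    (by
      rintro (i | ⟨i, j, h, c⟩ | i) (i' | ⟨i', j', h', c'⟩ | i') hh <;> simp at hh <;>
        grind)

instance : Module.Finite k (Zigzag k n) :=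
  ⟨⟨(Set.finite_range (gen k (n := n))).toFinset, by simpa using span_gen k⟩⟩

/-- The algebra map `a ↦ a T ^ d` for `a` of degree `d`, which separates the degrees. -/
def coaction (n : ℕ) : Zigzag k n →ₐ[k] AddMonoidAlgebra (Zigzag k n) ℤ :=
  RingQuot.liftAlgHom k ⟨FreeAlgebra.lift k fun g => AddMonoidAlgebra.single g.deg (gen k g), by
    intro x y h
    induction h with
    | idem i =>
      simp only [map_mul, FreeAlgebra.lift_ι_apply, AddMonoidAlgebra.single_mul_single]
      exact congrArg₂ _ rfl (e_mul_self k i)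
    | orth i j h =>
      simp only [map_mul, map_zero, FreeAlgebra.lift_ι_apply, AddMonoidAlgebra.single_mul_single]
      rw [show gen k (.e i) * gen k (.e j) = 0 from e_mul_e_of_ne k h, AddMonoidAlgebra.single_zero]
    | unit =>
      simp only [map_sum, map_one, FreeAlgebra.lift_ι_apply, Gen.deg]
      rw [AddMonoidAlgebra.one_def, ← sum_e]
      exact (map_sum (AddMonoidAlgebra.singleAddHom (0 : ℤ)) (e k) Finset.univ).symm
    | src a =>
      simp only [map_mul, FreeAlgebra.lift_ι_apply, AddMonoidAlgebra.single_mul_single]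
      exact congrArg₂ _ (zero_add _) (e_src_mul k a)
    | tgt a =>
      simp only [map_mul, FreeAlgebra.lift_ι_apply, AddMonoidAlgebra.single_mul_single]
      exact congrArg₂ _ (add_zero _) (arr_mul_e_tgt k a)
    | distinct a b h h' =>
      simp only [map_mul, map_zero, FreeAlgebra.lift_ι_apply, AddMonoidAlgebra.single_mul_single]
      rw [show gen k (.arr a) * gen k (.arr b) = 0 from arr_mul_arr_of_src_ne_tgt k h',
        AddMonoidAlgebra.single_zero]
    | dual i j h c =>
      simp only [map_mul, FreeAlgebra.lift_ι_apply, AddMonoidAlgebra.single_mul_single]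
      exact congrArg₂ _ rfl ((edge_mul_edge k h h.symm c c).trans (if_pos rfl))
    | nondual i j h c c' hc =>
      simp only [map_mul, map_zero, FreeAlgebra.lift_ι_apply, AddMonoidAlgebra.single_mul_single]
      rw [show gen k (.arr (.edge i j h c)) * gen k (.arr (.edge j i h.symm c')) = 0 from
        (edge_mul_edge k h h.symm c c').trans (if_neg hc), AddMonoidAlgebra.single_zero]
    | loop_sq i =>
      simp only [map_mul, map_zero, FreeAlgebra.lift_ι_apply, AddMonoidAlgebra.single_mul_single]
      rw [show gen k (.arr (.loop i)) * gen k (.arr (.loop i)) = 0 from loop_mul_loop k i i,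
        AddMonoidAlgebra.single_zero]⟩

lemma coaction_gen (g : Gen n) : coaction k n (gen k g) = AddMonoidAlgebra.single g.deg (gen k g) :=
  (RingQuot.liftAlgHom_mkAlgHom_apply k _ _ _).trans (FreeAlgebra.lift_ι_apply _ _)

lemma coaction_of_mem {d : ℤ} {x : Zigzag k n} (hx : x ∈ grade k n d) :
    coaction k n x = AddMonoidAlgebra.single d x := by
  induction hx using Submodule.span_induction with
  | mem x h => obtain ⟨g, rfl, rfl⟩ := h; exact coaction_gen k g
  | zero => simp
  | add x y _ _ hx hy => rw [map_add, hx, hy, AddMonoidAlgebra.single_add]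
  | smul r x _ hx => rw [map_smul, hx, AddMonoidAlgebra.smul_single]

lemma internal_grade : DirectSum.IsInternal (grade k n) := by
  refine internal_of_components
    { toFun := fun x => (coaction k n x).coeff
      map_add' := fun x y => by rw [map_add]; rfl
      map_smul' := fun r x => by rw [map_smul]; rfl } ?_ (iSup_grade k)
  intro d x hx
  change (coaction k n x).coeff = _
  rw [coaction_of_mem k hx]
  rfl

end Zigzag

/-! ### Finitely generated projective graded modules -/

/-- A finitely generated projective graded left module over the zigzag algebra, graded by path
length: a finitely generated projective module together with a decomposition into `k`-subspaces
`gr d`, `d ∈ ℤ`, such that elements of degree `p` of the algebra map `gr q` to `gr (p + q)`. -/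
structure GrProj (k : Type u) [Field k] (n : ℕ) : Type (u + 1) where
  carrier : Type u
  [addCommGroup : AddCommGroup carrier]
  [moduleBase : Module k carrier]
  [module : Module (Zigzag k n) carrier]
  [isScalarTower : IsScalarTower k (Zigzag k n) carrier]
  [finite : Module.Finite (Zigzag k n) carrier]
  [projective : Module.Projective (Zigzag k n) carrier]
  gr : ℤ → Submodule k carrier
  internal : DirectSum.IsInternal gr
  smul_mem : ∀ (p q : ℤ) (a : Zigzag k n) (x : carrier),
    a ∈ Zigzag.grade k n p → x ∈ gr q → a • x ∈ gr (p + q)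

namespace GrProj

attribute [instance] addCommGroup moduleBase module isScalarTower finite projective

variable {k : Type u} [Field k] {n : ℕ}

/-- The group of morphisms of graded modules: the module maps that preserve degrees. -/
def homs (M N : GrProj k n) : AddSubgroup (M.carrier →ₗ[Zigzag k n] N.carrier) where
  carrier := {f | ∀ d, ∀ x ∈ M.gr d, f x ∈ N.gr d}
  add_mem' hf hg d x hx := add_mem (hf d x hx) (hg d x hx)
  zero_mem' d _ _ := zero_mem (N.gr d)
  neg_mem' hf d x hx := neg_mem (hf d x hx)

instance : Category (GrProj k n) where
  Hom M N := homs M N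
  id M := ⟨LinearMap.id, fun _ _ h => h⟩
  comp f g := ⟨g.1 ∘ₗ f.1, fun d x hx => g.2 d _ (f.2 d x hx)⟩

/-- A morphism of graded modules, from its underlying linear map. -/
def ofHom {M N : GrProj k n} (f : M.carrier →ₗ[Zigzag k n] N.carrier)
    (hf : ∀ d, ∀ x ∈ M.gr d, f x ∈ N.gr d) : M ⟶ N := ⟨f, hf⟩

/-- The linear map underlying a morphism of graded modules. -/
def lin {M N : GrProj k n} (f : M ⟶ N) : M.carrier →ₗ[Zigzag k n] N.carrier := f.1

lemma lin_mem {M N : GrProj k n} (f : M ⟶ N) {d : ℤ} {x : M.carrier} (hx : x ∈ M.gr d) :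
    lin f x ∈ N.gr d := f.2 d x hx

lemma hom_ext {M N : GrProj k n} {f g : M ⟶ N} (h : ∀ x, lin f x = lin g x) : f = g :=
  Subtype.ext (LinearMap.ext h)

@[simp] lemma lin_ofHom {M N : GrProj k n} (f : M.carrier →ₗ[Zigzag k n] N.carrier)
    (hf : ∀ d, ∀ x ∈ M.gr d, f x ∈ N.gr d) : lin (ofHom f hf) = f := rfl

@[simp] lemma lin_id (M : GrProj k n) : lin (𝟙 M) = LinearMap.id := rfl

@[simp] lemma lin_comp {M N P : GrProj k n} (f : M ⟶ N) (g : N ⟶ P) :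
    lin (f ≫ g) = lin g ∘ₗ lin f := rfl

instance : Preadditive (GrProj k n) where
  homGroup M N := inferInstanceAs (AddCommGroup (homs M N))
  add_comp _ _ _ f f' g := Subtype.ext (LinearMap.comp_add f.1 f'.1 g.1)
  comp_add _ _ _ f g g' := Subtype.ext (LinearMap.add_comp f.1 g'.1 g.1)

@[simp] lemma lin_add {M N : GrProj k n} (f g : M ⟶ N) : lin (f + g) = lin f + lin g := rfl

@[simp] lemma lin_zero {M N : GrProj k n} : lin (0 : M ⟶ N) = 0 := rfl

instance : HasZeroObject (GrProj k n) := by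
  let Z : GrProj k n :=
    { carrier := PUnit
      gr := fun _ => ⊤
      internal := internal_of_components 0 (fun _ _ _ => Subsingleton.elim _ _)
        (Subsingleton.elim _ _)
      smul_mem := fun _ _ _ _ _ _ => trivial }
  refine ⟨Z, (IsZero.iff_id_eq_zero Z).2 ?_⟩
  exact hom_ext fun _ => rfl

/-- The direct sum of two graded modules. -/
def prod (M N : GrProj k n) : GrProj k n where
  carrier := M.carrier × N.carrier
  gr d := (M.gr d).prod (N.gr d)
  internal := internal_prod M.internal N.internal
  smul_mem p q a x ha hx := ⟨M.smul_mem p q a x.1 ha hx.1, N.smul_mem p q a x.2 ha hx.2⟩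

instance : HasBinaryBiproducts (GrProj k n) where
  has_binary_biproduct M N :=
    HasBinaryBiproduct.mk
      { bicone :=
          { pt := prod M N
            fst := ofHom (LinearMap.fst _ _ _) fun _ _ h => h.1
            snd := ofHom (LinearMap.snd _ _ _) fun _ _ h => h.2
            inl := ofHom (LinearMap.inl _ _ _) fun _ _ h => ⟨h, zero_mem _⟩
            inr := ofHom (LinearMap.inr _ _ _) fun _ _ h => ⟨zero_mem _, h⟩
            inl_fst := hom_ext fun _ => rfl
            inl_snd := hom_ext fun _ => rfl
            inr_fst := hom_ext fun _ => rfl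
            inr_snd := hom_ext fun _ => rfl }
        isBilimit := isBinaryBilimitOfTotal _ (hom_ext fun x => by
          exact LinearMap.congr_fun
            (LinearMap.coprod_inl_inr (R := Zigzag k n) (M := M.carrier) (M₂ := N.carrier)) x) }

instance : HasFiniteProducts (GrProj k n) := hasFiniteProducts_of_has_binary_and_terminal

instance : HasFiniteBiproducts (GrProj k n) := HasFiniteBiproducts.of_hasFiniteProducts

/-- The left ideal `A e_i`, consisting of the `x` with `x e_i = x`. -/
def ideal (k : Type u) [Field k] {n : ℕ} (i : Fin n) :
    Submodule (Zigzag k n) (Zigzag k n) where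
  carrier := {x | x * Zigzag.e k i = x}
  add_mem' hx hy := by rw [Set.mem_ofPred_eq, add_mul, hx, hy]
  zero_mem' := zero_mul _
  smul_mem' a x hx := by rw [Set.mem_ofPred_eq, smul_eq_mul, mul_assoc, hx]

lemma mem_ideal {i : Fin n} {x : Zigzag k n} : x ∈ ideal k i ↔ x * Zigzag.e k i = x := Iff.rfl

/-- Right multiplication by `e_i`, as a map onto `A e_i`. -/
def toIdeal (k : Type u) [Field k] {n : ℕ} (i : Fin n) :
    Zigzag k n →ₗ[Zigzag k n] ideal k i where
  toFun x := ⟨x * Zigzag.e k i, by rw [mem_ideal, mul_assoc, Zigzag.e_mul_self]⟩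
  map_add' x y := Subtype.ext (add_mul x y _)
  map_smul' a x := Subtype.ext (mul_assoc a x _)

lemma toIdeal_coe {i : Fin n} (x : ideal k i) : toIdeal k i x = x := Subtype.ext x.2

instance (i : Fin n) : Module.Finite (Zigzag k n) (ideal k i) :=
  Module.Finite.of_surjective (toIdeal k i) fun x => ⟨x, toIdeal_coe x⟩

instance (i : Fin n) : Module.Projective (Zigzag k n) (ideal k i) :=
  Module.Projective.of_split (ideal k i).subtype (toIdeal k i) (LinearMap.ext toIdeal_coe)

/-- The path-length grading of `A e_i`. -/
def idealGrade (k : Type u) [Field k] {n : ℕ} (i : Fin n) (d : ℤ) :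
    Submodule k (ideal k i) :=
  (Zigzag.grade k n d).comap ((ideal k i).subtype.restrictScalars k)

lemma internal_idealGrade (i : Fin n) : DirectSum.IsInternal (idealGrade k i) :=
  internal_comap (Zigzag.internal_grade k) ((ideal k i).subtype.restrictScalars k)
    ((toIdeal k i).restrictScalars k) toIdeal_coe fun d x hx => by
      have := Zigzag.mul_mem_grade k hx (Zigzag.gen_mem_grade k (.e i))
      rwa [show d + (Gen.e i).deg = d from add_zero d] at this

/-- The graded projective module `P_i⟨r⟩`, where `P_i = A e_i` and `M⟨r⟩_d = M_{d + r}`; so the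
generator `e_i` has degree `-r`. -/
def P (k : Type u) [Field k] {n : ℕ} (i : Fin n) (r : ℤ) : GrProj k n where
  carrier := ideal k i
  gr d := idealGrade k i (d + r)
  internal := internal_shift (internal_idealGrade i) r
  smul_mem p q a x ha hx := by
    have : a * x.1 ∈ Zigzag.grade k n (p + (q + r)) := Zigzag.mul_mem_grade k ha hx
    rwa [← add_assoc] at this

/-- The subspace `e_i M`, consisting of the `x` with `e_i x = x`. -/
def corner (i : Fin n) (M : GrProj k n) : Submodule k M.carrier where
  carrier := {x | Zigzag.e k i • x = x}
  add_mem' hx hy := by rw [Set.mem_ofPred_eq, smul_add, hx, hy]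
  zero_mem' := smul_zero _
  smul_mem' a x hx := by rw [Set.mem_ofPred_eq, smul_comm, hx]


lemma mem_corner {i : Fin n} {M : GrProj k n} {x : M.carrier} :
    x ∈ corner i M ↔ Zigzag.e k i • x = x := Iff.rfl

/-- Multiplication by `e_i`, as a map from `M` onto `e_i M`. -/
def toCorner (i : Fin n) (M : GrProj k n) : M.carrier →ₗ[k] corner i M where
  toFun x := ⟨Zigzag.e k i • x, by rw [mem_corner, ← mul_smul, Zigzag.e_mul_self]⟩
  map_add' x y := Subtype.ext (smul_add _ x y)
  map_smul' a x := Subtype.ext (smul_comm _ a x)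

lemma toCorner_coe {i : Fin n} {M : GrProj k n} (x : corner i M) : toCorner i M x = x :=
  Subtype.ext x.2

instance (i : Fin n) (M : GrProj k n) : Module.Finite k (corner i M) := by
  have : Module.Finite k M.carrier := Module.Finite.trans (Zigzag k n) M.carrier
  infer_instance

/-- The grading of `e_i M`. -/
def cornerGrade (i : Fin n) (M : GrProj k n) (d : ℤ) : Submodule k (corner i M) :=
  (M.gr d).comap (corner i M).subtype

lemma toCorner_mem {i : Fin n} {M : GrProj k n} {d : ℤ} {x : M.carrier} (hx : x ∈ M.gr d) :
    toCorner i M x ∈ cornerGrade i M d := by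
  have := M.smul_mem _ d _ x (Zigzag.gen_mem_grade k (.e i)) hx
  rwa [show (Gen.e i).deg + d = d from zero_add d] at this

lemma internal_cornerGrade (i : Fin n) (M : GrProj k n) :
    DirectSum.IsInternal (cornerGrade i M) :=
  internal_comap M.internal (corner i M).subtype (toCorner i M) toCorner_coe
    fun _ _ hx => toCorner_mem hx

lemma toIdeal_mem {i : Fin n} {d : ℤ} {x : Zigzag k n} (hx : x ∈ Zigzag.grade k n d) :
    toIdeal k i x ∈ idealGrade k i d := by
  have := Zigzag.mul_mem_grade k hx (Zigzag.gen_mem_grade k (.e i))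
  rwa [show d + (Gen.e i).deg = d from add_zero d] at this

/-- The map `e_i M ⟶ e_i N` induced by a morphism. -/
def cornerMap (i : Fin n) {M N : GrProj k n} (f : M ⟶ N) : corner i M →ₗ[k] corner i N where
  toFun x := ⟨lin f x.1, by rw [mem_corner, ← map_smul, mem_corner.1 x.2]⟩
  map_add' x y := Subtype.ext (map_add (lin f) x.1 y.1)
  map_smul' a x := Subtype.ext ((lin f).map_smul_of_tower a x.1)

instance (i : Fin n) (M : GrProj k n) : Module.Finite (Zigzag k n) (ideal k i ⊗[k] corner i M) := by
  have : Module.Finite k (ideal k i) := Module.Finite.trans (Zigzag k n) _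
  exact Module.Finite.of_restrictScalars_finite k (Zigzag k n) _

/-- The graded module `(A e_i ⊗ e_i A)⟨r⟩ ⊗_A M`, realised as `(A e_i ⊗ e_i M)⟨r⟩`. -/
def bimodObj (i : Fin n) (r : ℤ) (M : GrProj k n) : GrProj k n where
  carrier := ideal k i ⊗[k] corner i M
  gr := tensorGrade (idealGrade k i) (cornerGrade i M) r
  internal := internal_tensorGrade (internal_idealGrade i) (internal_cornerGrade i M) r
  smul_mem p q a t ha ht := by
    refine tensorGrade_le (S := (tensorGrade (idealGrade k i) (cornerGrade i M) r (p + q)).comap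
      (Module.toModuleEnd k (S := Zigzag k n) (ideal k i ⊗[k] corner i M) a)) ?_ ht
    intro p' q' h x hx y hy
    exact tmul_mem_tensorGrade (p := p + p') (Zigzag.mul_mem_grade k ha hx) hy (by omega)

/-- The map `A e_i ⊗ e_i M ⟶ A e_i ⊗ e_i N` induced by a morphism. -/
def bimodLin (i : Fin n) {M N : GrProj k n} (f : M ⟶ N) :
    ideal k i ⊗[k] corner i M →ₗ[Zigzag k n] ideal k i ⊗[k] corner i N :=
  TensorProduct.AlgebraTensorModule.map LinearMap.id (cornerMap i f)

/-- The functor `(A e_i ⊗ e_i A)⟨r⟩ ⊗_A -` on finitely generated projective graded modules. -/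
def bimod (i : Fin n) (r : ℤ) : GrProj k n ⥤ GrProj k n where
  obj := bimodObj i r
  map f := ofHom (M := bimodObj i r _) (N := bimodObj i r _) (bimodLin i f) fun d _ ht =>
    tensorGrade_le (S := (tensorGrade (idealGrade k i) (cornerGrade i _) r d).comap
      ((bimodLin i f).restrictScalars k))
      (fun _ _ h _ hx _ hy => tmul_mem_tensorGrade hx (lin_mem f hy) h) ht
  map_id M := hom_ext fun x => LinearMap.congr_fun
    (TensorProduct.AlgebraTensorModule.map_id (R := k) (A := Zigzag k n) (M := ideal k i)
      (N := corner i M)) x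
  map_comp f g := hom_ext fun t => LinearMap.congr_fun
    (TensorProduct.AlgebraTensorModule.map_comp (R := k) (A := Zigzag k n)
      (LinearMap.id (M := ideal k i)) (LinearMap.id (M := ideal k i))
      (cornerMap i g) (cornerMap i f)) t

instance (i : Fin n) (r : ℤ) : (bimod (k := k) i r).Additive where
  map_add {_ _ f g} := hom_ext fun t => LinearMap.congr_fun
    (TensorProduct.AlgebraTensorModule.map_add_right (R := k) (A := Zigzag k n)
      (LinearMap.id (M := ideal k i)) (cornerMap i f) (cornerMap i g)) t

/-- The map `f_i : A e_i ⊗ e_i M ⟶ M`, `x ⊗ m ↦ x m`. -/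
def evalLin (i : Fin n) (M : GrProj k n) :
    ideal k i ⊗[k] corner i M →ₗ[Zigzag k n] M.carrier :=
  TensorProduct.AlgebraTensorModule.lift
    { toFun := fun x =>
        { toFun := fun m => x.1 • m.1
          map_add' := fun _ _ => smul_add _ _ _
          map_smul' := fun _ _ => smul_comm _ _ _ }
      map_add' := fun _ _ => LinearMap.ext fun _ => add_smul _ _ _
      map_smul' := fun _ _ => LinearMap.ext fun _ => mul_smul _ _ _ }

lemma evalLin_naturality (i : Fin n) {M N : GrProj k n} (f : M ⟶ N) :
    evalLin i N ∘ₗ bimodLin i f = lin f ∘ₗ evalLin i M :=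
  TensorProduct.AlgebraTensorModule.ext fun x m => (map_smul (lin f) x.1 m.1).symm

/-- The natural transformation `f_i : (A e_i ⊗ e_i A) ⊗_A - ⟶ A ⊗_A -`. -/
def evalTrans (k : Type u) [Field k] {n : ℕ} (i : Fin n) :
    bimod (k := k) i 0 ⟶ 𝟭 (GrProj k n) where
  app M := ofHom (M := bimodObj i 0 M) (N := M) (evalLin i M) fun d _ ht =>
    tensorGrade_le (S := (M.gr d).comap ((evalLin i M).restrictScalars k))
      (fun p q h x hx y hy => by
        have := M.smul_mem p q x.1 y.1 hx hy
        rwa [show p + q = d by omega] at this) ht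
  naturality M N f := hom_ext fun t => LinearMap.congr_fun (evalLin_naturality i f) t

/-- The map `g_i : M ⟶ A e_i ⊗ e_i M`, given by
`m ↦ z ⊗ m + e_i ⊗ z m + ∑ a* ⊗ a m`, where the sum runs over all edges `a` with source `i`. -/
def coevalFun (i : Fin n) (M : GrProj k n) : M.carrier →ₗ[k] ideal k i ⊗[k] corner i M :=
  let term (x y : Zigzag k n) : M.carrier →ₗ[k] ideal k i ⊗[k] corner i M :=
    TensorProduct.mk k _ _ (toIdeal k i x) ∘ₗ toCorner i M ∘ₗ Module.toModuleEnd k M.carrier y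
  term (Zigzag.arr k (.loop i)) 1 + term (Zigzag.e k i) (Zigzag.arr k (.loop i)) +
    ∑ j, ∑ c, term (Zigzag.edge k j i c) (Zigzag.edge k i j c)

lemma coevalFun_apply (i : Fin n) (M : GrProj k n) (m : M.carrier) :
    coevalFun i M m = toIdeal k i (Zigzag.arr k (.loop i)) ⊗ₜ toCorner i M m +
      toIdeal k i (Zigzag.e k i) ⊗ₜ toCorner i M (Zigzag.arr k (.loop i) • m) +
      ∑ j, ∑ c, toIdeal k i (Zigzag.edge k j i c) ⊗ₜ toCorner i M (Zigzag.edge k i j c • m) := by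
  simp [coevalFun, LinearMap.sum_apply]

lemma toIdeal_smul (i : Fin n) (M : GrProj k n) (a x : Zigzag k n) (y : corner i M) :
    a • (toIdeal k i x ⊗ₜ[k] y) = toIdeal k i (a * x) ⊗ₜ[k] y := by
  rw [TensorProduct.smul_tmul', ← map_smul, smul_eq_mul]

lemma toCorner_eq (i : Fin n) (M : GrProj k n) (m : M.carrier) :
    toCorner i M m = toCorner i M (Zigzag.e k i • m) :=
  Subtype.ext (by change _ • _ = _ • _ • _; rw [← mul_smul, Zigzag.e_mul_self])

lemma coevalFun_smul (i : Fin n) (M : GrProj k n) (a : Zigzag k n) (m : M.carrier) :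
    coevalFun i M (a • m) = a • coevalFun i M m := by
  revert m
  refine Zigzag.induction k (P := fun a => ∀ m, coevalFun i M (a • m) = a • coevalFun i M m)
    ?_ ?_ ?_ ?_ a
  · intro r m
    rw [algebraMap_smul, algebraMap_smul, map_smul]
  · rintro (l | ⟨p, q, h, c⟩ | p) m
    · change coevalFun i M (Zigzag.e k l • m) = Zigzag.e k l • _
      simp only [coevalFun_apply, smul_add, Finset.smul_sum, toIdeal_smul, ← mul_smul,
        toCorner_eq i M (Zigzag.e k l • m), Zigzag.e_mul_e, Zigzag.loop_mul_e, Zigzag.edge_mul_e,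
        Zigzag.e_mul_loop, Zigzag.e_mul_edge]
      congr 1
      · by_cases hl : l = i
        · subst hl; simp [← toCorner_eq]
        · simp [hl, Ne.symm hl]
      · refine Finset.sum_congr rfl fun j _ => Finset.sum_congr rfl fun c _ => ?_
        by_cases hl : l = j
        · subst hl; simp
        · simp [hl, Ne.symm hl]
    · have hpq : Zigzag.gen k (.arr (.edge p q h c)) = Zigzag.edge k p q c := by
        rw [Zigzag.edge, dif_neg h]; rfl
      rw [hpq]
      simp only [coevalFun_apply, smul_add, Finset.smul_sum, toIdeal_smul, ← mul_smul,
        toCorner_eq i M (Zigzag.edge k p q c • m), Zigzag.loop_mul_edge', Zigzag.edge_mul_loop',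
        Zigzag.edge_mul_e, Zigzag.e_mul_edge, Zigzag.edge_mul_edge' k _ _ _ _ _ _ h,
        Zigzag.edge_mul_edge'' k _ _ _ _ _ _ h]
      by_cases hp : i = p <;> by_cases hq : q = i
      · exact absurd (hq.trans hp).symm h
      · subst hp
        simp [hq, Ne.symm hq, apply_ite (toIdeal k i), TensorProduct.ite_tmul]
      · subst hq
        simp [hp, Ne.symm hp, ite_smul, apply_ite (toCorner q M), TensorProduct.tmul_ite]
      · simp [hp, hq, Ne.symm hp, Ne.symm hq]
    · change coevalFun i M (Zigzag.arr k (.loop p) • m) = Zigzag.arr k (.loop p) • _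
      simp only [coevalFun_apply, smul_add, Finset.smul_sum, toIdeal_smul, ← mul_smul,
        toCorner_eq i M (Zigzag.arr k (.loop p) • m), Zigzag.loop_mul_edge', Zigzag.edge_mul_loop',
        Zigzag.loop_mul_e, Zigzag.e_mul_loop, Zigzag.loop_mul_loop]
      by_cases hl : p = i
      · subst hl; simp
      · simp [hl, Ne.symm hl]
  · intro x y hx hy m
    rw [add_smul, map_add, hx, hy, add_smul]
  · intro x y hx hy m
    rw [mul_smul, hx, hy, mul_smul]

/-- The map `g_i`, as a map of modules over the zigzag algebra. -/
def coevalLin (i : Fin n) (M : GrProj k n) :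
    M.carrier →ₗ[Zigzag k n] ideal k i ⊗[k] corner i M where
  toFun := coevalFun i M
  map_add' := map_add _
  map_smul' := coevalFun_smul i M

lemma cornerMap_toCorner (i : Fin n) {M N : GrProj k n} (f : M ⟶ N) (x : M.carrier) :
    cornerMap i f (toCorner i M x) = toCorner i N (lin f x) :=
  Subtype.ext (map_smul (lin f) _ x)

lemma coevalLin_naturality (i : Fin n) {M N : GrProj k n} (f : M ⟶ N) (m : M.carrier) :
    coevalLin i N (lin f m) = bimodLin i f (coevalLin i M m) := by
  change coevalFun i N (lin f m) = TensorProduct.AlgebraTensorModule.map _ _ (coevalFun i M m)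
  simp only [coevalFun_apply, map_add, map_sum, TensorProduct.AlgebraTensorModule.map_tmul,
    LinearMap.id_apply, cornerMap_toCorner, map_smul]

lemma coevalLin_mem (i : Fin n) (M : GrProj k n) {d : ℤ} {m : M.carrier} (hm : m ∈ M.gr d) :
    coevalLin i M m ∈ tensorGrade (idealGrade k i) (cornerGrade i M) 2 d := by
  have hz : Zigzag.arr k (.loop i) ∈ Zigzag.grade k n 2 := Zigzag.gen_mem_grade k (.arr (.loop i))
  have he : Zigzag.e k i ∈ Zigzag.grade k n 0 := Zigzag.gen_mem_grade k (.e i)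
  change coevalFun i M m ∈ _
  rw [coevalFun_apply]
  refine add_mem (add_mem ?_ ?_) (sum_mem fun j _ => sum_mem fun c _ => ?_)
  · exact tmul_mem_tensorGrade (toIdeal_mem hz) (toCorner_mem hm) (add_comm _ _)
  · exact tmul_mem_tensorGrade (toIdeal_mem he) (toCorner_mem (M.smul_mem _ _ _ _ hz hm)) (by ring)
  · exact tmul_mem_tensorGrade (toIdeal_mem (Zigzag.edge_mem_grade k j i c))
      (toCorner_mem (M.smul_mem _ _ _ _ (Zigzag.edge_mem_grade k i j c) hm)) (by ring)

/-- The natural transformation `g_i : A ⊗_A - ⟶ (A e_i ⊗ e_i A)⟨2⟩ ⊗_A -`. -/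
def coevalTrans (k : Type u) [Field k] {n : ℕ} (i : Fin n) :
    𝟭 (GrProj k n) ⟶ bimod (k := k) i 2 where
  app M := ofHom (M := M) (N := bimodObj i 2 M) (coevalLin i M) fun _ _ hm => coevalLin_mem i M hm
  naturality _ _ f := hom_ext fun m => coevalLin_naturality i f m

end GrProj

/-! ### The bounded homotopy category and cones of natural transformations -/

section Complexes

variable (C : Type*) [Category* C] [Preadditive C]

/-- A cochain complex is bounded if all but finitely many of its terms vanish. -/
def IsBounded {C : Type*} [Category* C] [Preadditive C] (K : CochainComplex C ℤ) : Prop :=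
  ∃ a b : ℤ, ∀ m : ℤ, m < a ∨ b < m → IsZero (K.X m)

/-- The bounded complexes in the homotopy category of cochain complexes. -/
def bounded : ObjectProperty (HomotopyCategory C (.up ℤ)) := fun X => IsBounded X.as

/-- The homotopy category of bounded complexes. -/
abbrev BoundedHomotopyCategory := (bounded C).FullSubcategory

variable {C}

lemma isBounded_mappingCone [HasBinaryBiproducts C] {K L : CochainComplex C ℤ} (f : K ⟶ L)
    (hK : IsBounded K) (hL : IsBounded L) : IsBounded (CochainComplex.mappingCone f) := by
  obtain ⟨a, b, h⟩ := hK
  obtain ⟨a', b', h'⟩ := hL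
  refine ⟨min (a - 1) a', max b b', fun m hm => ?_⟩
  rw [CochainComplex.mappingCone.isZero_X_iff]
  exact ⟨h _ (by omega), h' _ (by omega)⟩

lemma isBounded_map (F : C ⥤ C) [F.Additive] {K : CochainComplex C ℤ} (hK : IsBounded K) :
    IsBounded ((F.mapHomologicalComplex (.up ℤ)).obj K) := by
  obtain ⟨a, b, h⟩ := hK
  exact ⟨a, b, fun m hm => F.map_isZero (h m hm)⟩

open ZeroObject in
instance [HasZeroObject C] : (bounded C).ContainsZero where
  exists_zero := by
    refine ⟨(HomotopyCategory.quotient _ _).obj (0 : CochainComplex C ℤ),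
      Functor.map_isZero _ (isZero_zero _), ?_⟩
    exact ⟨0, 0, fun m _ => (HomologicalComplex.eval C (.up ℤ) m).map_isZero (isZero_zero _)⟩

instance : (bounded C).IsStableUnderShift ℤ where
  isStableUnderShiftBy n :=
    { le_shift := fun X hX => by
        obtain ⟨K, rfl⟩ := HomotopyCategory.quotient_obj_surjective X
        obtain ⟨a, b, h⟩ := hX
        rw [ObjectProperty.prop_shift_iff, HomotopyCategory.shift_quotient_obj]
        exact ⟨a - n, b - n, fun m hm => h (m + n) (by omega)⟩ }

instance [HasZeroObject C] [HasBinaryBiproducts C] : (bounded C).IsTriangulatedClosed₃ where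
  ext₃' T hT h₁ h₂ := by
    obtain ⟨f : T.obj₁.as ⟶ T.obj₂.as, hf⟩ :=
      (HomotopyCategory.quotient _ _).map_surjective T.mor₁
    refine ⟨(HomotopyCategory.quotient _ _).obj (CochainComplex.mappingCone f),
      isBounded_mappingCone f h₁ h₂,
      ⟨Pretriangulated.Triangle.π₃.mapIso (Pretriangulated.isoTriangleOfIso₁₂ T _ hT
        (HomotopyCategory.mappingCone_triangleh_distinguished f)
        (Iso.refl _) (Iso.refl _) ?_)⟩⟩
    refine (Category.comp_id _).trans (Eq.trans ?_ (Category.id_comp _).symm)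
    exact hf.symm

instance [HasZeroObject C] [HasBinaryBiproducts C] : (bounded C).IsTriangulated where
  toIsTriangulatedClosed₂ := .of_isTriangulatedClosed₃

variable [HasBinaryBiproducts C] {F G : C ⥤ C} [F.Additive] [G.Additive] (τ : F ⟶ G)

/-- The functor sending a complex `K` to the cone of `τ : F K ⟶ G K`. -/
def coneComplex : CochainComplex C ℤ ⥤ CochainComplex C ℤ where
  obj K := CochainComplex.mappingCone ((NatTrans.mapHomologicalComplex τ (.up ℤ)).app K)
  map f := CochainComplex.mappingCone.map _ _ ((F.mapHomologicalComplex (.up ℤ)).map f)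
    ((G.mapHomologicalComplex (.up ℤ)).map f)
    ((NatTrans.mapHomologicalComplex τ (.up ℤ)).naturality f).symm
  map_id K := by
    simpa using CochainComplex.mappingCone.map_id
      ((NatTrans.mapHomologicalComplex τ (.up ℤ)).app K)
  map_comp f g := by
    simpa using CochainComplex.mappingCone.map_comp _ _ _
      ((F.mapHomologicalComplex (.up ℤ)).map f) ((G.mapHomologicalComplex (.up ℤ)).map f)
      ((NatTrans.mapHomologicalComplex τ (.up ℤ)).naturality f).symm
      ((F.mapHomologicalComplex (.up ℤ)).map g) ((G.mapHomologicalComplex (.up ℤ)).map g)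
      ((NatTrans.mapHomologicalComplex τ (.up ℤ)).naturality g).symm

lemma coneComplex_inverts [HasZeroObject C] :
    (HomologicalComplex.homotopyEquivalences C (.up ℤ)).IsInvertedBy
      (coneComplex τ ⋙ HomotopyCategory.quotient C (.up ℤ)) := by
  intro K L f hf
  have hF : IsIso ((HomotopyCategory.quotient C (.up ℤ)).map
      ((F.mapHomologicalComplex (.up ℤ)).map f)) := by
    obtain ⟨e, rfl⟩ := hf
    exact (HomotopyCategory.isoOfHomotopyEquiv (F.mapHomotopyEquiv e)).isIso_hom
  have hG : IsIso ((HomotopyCategory.quotient C (.up ℤ)).map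
      ((G.mapHomologicalComplex (.up ℤ)).map f)) := by
    obtain ⟨e, rfl⟩ := hf
    exact (HomotopyCategory.isoOfHomotopyEquiv (G.mapHomotopyEquiv e)).isIso_hom
  have := Pretriangulated.isIso₃_of_isIso₁₂
    (CochainComplex.mappingCone.trianglehMapOfHomotopy (Homotopy.ofEq
      ((NatTrans.mapHomologicalComplex τ (.up ℤ)).naturality f).symm))
    (HomotopyCategory.mappingCone_triangleh_distinguished _)
    (HomotopyCategory.mappingCone_triangleh_distinguished _) hF hG
  dsimp [CochainComplex.mappingCone.trianglehMapOfHomotopy] at this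
  rw [← CochainComplex.mappingCone.map_eq_mapOfHomotopy] at this
  exact this

/-- The functor induced by `coneComplex τ` on the homotopy category. -/
def coneHomotopy [HasZeroObject C] :
    HomotopyCategory C (.up ℤ) ⥤ HomotopyCategory C (.up ℤ) :=
  CategoryTheory.Quotient.lift _ (coneComplex τ ⋙ HomotopyCategory.quotient C (.up ℤ))
    (fun _ _ _ _ ⟨h⟩ => h.map_eq_of_inverts_homotopyEquivalences
      (fun j => ⟨j - 1, by simp⟩) _ (coneComplex_inverts τ))

/-- The functor sending a bounded complex `K` to the cone of `τ : F K ⟶ G K`. -/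
def cone [HasZeroObject C] : BoundedHomotopyCategory C ⥤ BoundedHomotopyCategory C :=
  (bounded C).lift ((bounded C).ι ⋙ coneHomotopy τ) fun X =>
    isBounded_mappingCone _ (isBounded_map F X.property) (isBounded_map G X.property)

end Complexes

/-! ### The action of the free group -/

/-- The homotopy category of bounded complexes of finitely generated projective graded modules over
the zigzag algebra with its path-length grading. -/
abbrev D (k : Type u) [Field k] (n : ℕ) := BoundedHomotopyCategory (GrProj k n)

variable (k : Type u) [Field k] {n : ℕ}

/-- The functor `Σ_i`: the tensor product with the complex of bimodules
`A ⟶ (A e_i ⊗ e_i A)⟨2⟩`, with `A` in degree zero, given by `g_i`. -/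
def twist (i : Fin n) : D k n ⥤ D k n :=
  cone (GrProj.coevalTrans k i) ⋙ shiftFunctor (D k n) (-1 : ℤ)

/-- The functor `Σ_i⁻¹`: the tensor product with the complex of bimodules
`A e_i ⊗ e_i A ⟶ A`, with `A` in degree zero, given by `f_i`. -/
def twistInv (i : Fin n) : D k n ⥤ D k n := cone (GrProj.evalTrans k i)

/-- The functor `Ψ_β`: the composite of the `Σ_i` and `Σ_i⁻¹` along the reduced word of `β`, so
that `Ψ_β = Σ_{i_1}^{ε_1} ∘ ⋯ ∘ Σ_{i_r}^{ε_r}` if `β = σ_{i_1}^{ε_1} ⋯ σ_{i_r}^{ε_r}`. -/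
def Psi (β : FreeGroup (Fin n)) : D k n ⥤ D k n :=
  β.toWord.foldr (fun x F => F ⋙ (if x.2 then twist k x.1 else twistInv k x.1)) (𝟭 _)

/-! ### The t-structure of linear complexes and the exotic metric -/

variable {k}

/-- A complex is linear if, for each `m`, its term of degree `m` is isomorphic to a finite direct
sum of modules `P_j⟨m⟩`. -/
def IsLinear (K : CochainComplex (GrProj k n) ℤ) : Prop :=
  ∀ m : ℤ, ∃ (r : ℕ) (j : Fin r → Fin n), Nonempty (K.X m ≅ ⨁ fun t => GrProj.P k (j t) m)

variable (k n)

/-- The heart `D^0`: the objects isomorphic to a linear complex. -/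
def heart : ObjectProperty (D k n) := fun X => ∃ Y : D k n, IsLinear Y.obj.as ∧ Nonempty (X ≅ Y)

/-- The shifted heart `D^m = D^0[m]`. -/
def slice (m : ℤ) : ObjectProperty (D k n) := (heart k n).shift (-m)

/-- `InSlices k n a b X` states that `X` lies in `D^{[a, b]}`, i.e. that `X` has a finite filtration
by distinguished triangles whose subquotients (the t-slices of `X`) lie in `D^m` for
strictly decreasing integers `m` in `[a, b]`. -/
inductive InSlices : ℤ → ℤ → D k n → Prop
  | zero (a b : ℤ) (X : D k n) (h : IsZero X) : InSlices a b X
  | step (a b m : ℤ) (ha : a ≤ m) (hb : m ≤ b) (T : Pretriangulated.Triangle (D k n))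
      (hT : T ∈ Pretriangulated.distinguishedTriangles)
      (h₁ : InSlices (m + 1) b T.obj₁) (h₃ : slice k n m T.obj₃) : InSlices a b T.obj₂

variable {n}

/-- `Ψ_β(D^0) ⊆ D^{[a, b]}`. -/
def MapsHeartInto (β : FreeGroup (Fin n)) (a b : ℤ) : Prop :=
  ∀ X : D k n, heart k n X → InSlices k n a b ((Psi k β).obj X)

/-- `[a, b]` is the smallest interval such that `Ψ_β(D^0) ⊆ D^{[a, b]}`. -/
def IsSmallestInterval (β : FreeGroup (Fin n)) (a b : ℤ) : Prop :=
  a ≤ b ∧ MapsHeartInto k β a b ∧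
    ∀ a' b' : ℤ, a' ≤ b' → MapsHeartInto k β a' b' → a' ≤ a ∧ b ≤ b'

end ExoticMetric

end

/-! Multiplicities. For a graded projective module M, the space z_j M_d has one dimension for each
summand P_j⟨-d⟩ (`finrank_zSub_P`). So the cohomology in degree m of the complex z_j X_d counts the
copies of P_j⟨-d⟩ in degree m of a minimal complex of X, without any need to construct one. This
number is `mult`; such a constituent lies in the slice -(m+d). The basic tool is the filtration 0 ⊂
z_i M_{d-2} ⊂ ker z_i ⊂ e_i M_d, whose subquotients are z_i M_{d-2}, two copies of z_j M_{d-1} for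
each j ≠ i, and z_i M_d (`seqE_shortExact`, `seqR_shortExact`). Since e_i M_d is the space of maps
P_i⟨-d⟩ → M, multiplicities control morphisms. An object without constituents is zero
(`isZero_of_hdim_T`); every object is built from single projectives, highest slice first
(`devissage`); lying in D^{[a,b]} means having all constituents in slices a, …, b (`inSlices_iff`);
and non-zero morphisms out of the slice s reach only the slices s, s+1, s+2 (`hom_eq_zero`).

The metric. The twists preserve triangles and are mutually inverse on isomorphism classes, so F_n
acts on isomorphism classes of objects (`isoAction`). Intervals add under products
(`MapsHeartInto.mul`), and vanishing of morphisms from higher to lower slices shows that they are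
negated under inverses (`MapsHeartInto.inv`). This gives the triangle inequality, symmetry, and
finiteness by reduction to the generators.

Positivity. On z_i-parts, Σ_i⁻¹ replaces X by a shift of ker z_i (`hdim_T_cone_eq`), and the other
multiplicities do not change. The filtration then yields inequalities between the numbers of
constituents of X and Σ_i X in each slice (`cnt_twist_inequalities`). The two edges between any two
vertices put a factor 2 into them, and this drives a ping-pong on the largest non-empty slice. If
one kind j ≠ i outnumbers all other kinds together there, then after a letter σ_i^{±1} either kind i
does so in the same slice, or the largest slice has risen and contains only kind i. If the same
letter is repeated, σ_i raises the largest slice and σ_i⁻¹ preserves the dominance of i. Therefore a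
reduced word whose last letter is not of kind l keeps the largest slice of P_l at or above 0, and
one ending in σ_l brings it to at least 1. Reversing slices and inverting generators gives the same
for smallest slices. If the last letter is σ_j, then P_j reaches a slice ≥ 1 while some other P_l
has one ≤ 0; for σ_j⁻¹ the slices are ≤ -1 and ≥ 0. So a non-trivial element never maps the heart
into a single slice (`mapsHeartInto_lt`). -/

noncomputable section

namespace ExoticMetric

/-! ### A basis of the zigzag algebra -/

namespace Gen

variable {n : ℕ}

/-- The multiplication table of the generators, with `none` for a vanishing product. -/
def mul : Gen n → Gen n → Option (Gen n)
  | .e i, .e j => if i = j then some (.e i) else none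
  | .e i, .arr b => if i = b.src then some (.arr b) else none
  | .arr a, .e j => if a.tgt = j then some (.arr a) else none
  | .arr (.edge i j _ c), .arr (.edge p q _ c') =>
      if j = p ∧ i = q ∧ c = c' then some (.arr (.loop i)) else none
  | _, _ => none

variable (k : Type u) [Field k]

/-- Left multiplication by a generator on the space with basis the generators. -/
def act (g : Gen n) : Module.End k (Gen n →₀ k) :=
  Finsupp.linearCombination k fun h => (mul g h).elim 0 (Finsupp.single · 1)

variable {k} in
lemma act_single (g h : Gen n) (c : k) :
    act k g (Finsupp.single h c) = (mul g h).elim 0 (Finsupp.single · c) := by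
  rw [act, Finsupp.linearCombination_single]
  cases mul g h <;> simp

end Gen

namespace Zigzag

variable (k : Type u) [Field k] {n : ℕ}

/-- The action of the zigzag algebra on the space with basis the generators. -/
def rep (n : ℕ) : Zigzag k n →ₐ[k] Module.End k (Gen n →₀ k) :=
  RingQuot.liftAlgHom k ⟨FreeAlgebra.lift k (Gen.act k), by
    intro x y h
    induction h with
    | unit =>
      simp only [map_sum, map_one, FreeAlgebra.lift_ι_apply]
      ext g : 2
      simp only [LinearMap.comp_apply, Finsupp.lsingle_apply, LinearMap.sum_apply, Gen.act_single,
        Module.End.one_apply]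
      rcases g with j | b
      · rw [Finset.sum_eq_single j] <;> simp +contextual [Gen.mul]
      · rw [Finset.sum_eq_single b.src] <;> simp +contextual [Gen.mul]
    | idem i =>
      simp only [map_mul, FreeAlgebra.lift_ι_apply]
      ext g : 2
      simp only [LinearMap.comp_apply, Finsupp.lsingle_apply, Gen.act_single, Module.End.mul_apply]
      rcases g with j | b
      · by_cases h : i = j <;> simp [Gen.mul, h, Gen.act_single]
      · by_cases h : i = b.src <;> simp [Gen.mul, h, Gen.act_single]
    | orth i j h =>
      simp only [map_mul, map_zero, FreeAlgebra.lift_ι_apply]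
      ext g : 2
      simp only [LinearMap.comp_apply, Finsupp.lsingle_apply, Gen.act_single, Module.End.mul_apply]
      rcases g with l | b
      · by_cases h : j = l
        · subst h; simp [Gen.mul, Gen.act_single, *]
        · simp [Gen.mul, h]
      · by_cases h : j = b.src
        · subst h; simp [Gen.mul, Gen.act_single, *]
        · simp [Gen.mul, h]
    | src a =>
      simp only [map_mul, FreeAlgebra.lift_ι_apply]
      ext g : 2
      simp only [LinearMap.comp_apply, Finsupp.lsingle_apply, Gen.act_single, Module.End.mul_apply]
      rcases a with ⟨i, j, h, c⟩ | i <;> rcases g with l | ⟨p, q, h', c'⟩ | p <;>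
        simp only [Gen.mul] <;> (try split_ifs) <;>
        simp [Gen.act_single, Gen.mul, Arrow.src]
    | tgt a =>
      simp only [map_mul, FreeAlgebra.lift_ι_apply]
      ext g : 2
      simp only [LinearMap.comp_apply, Finsupp.lsingle_apply, Gen.act_single, Module.End.mul_apply]
      rcases a with ⟨i, j, h, c⟩ | i <;> rcases g with l | ⟨p, q, h', c'⟩ | p <;>
        simp only [Gen.mul] <;> (try split_ifs) <;>
        simp_all [Gen.act_single, Gen.mul, Arrow.src, Arrow.tgt]
      rw [if_neg (by tauto)]
      rfl
    | distinct a b h h' =>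
      simp only [map_mul, map_zero, FreeAlgebra.lift_ι_apply]
      ext g : 2
      simp only [LinearMap.comp_apply, Finsupp.lsingle_apply, Gen.act_single, Module.End.mul_apply]
      rcases b with ⟨i, j, h1, c⟩ | i <;> rcases g with l | ⟨p, q, h2, c'⟩ | p <;>
        simp only [Gen.mul] <;> (try split_ifs) <;>
        rcases a with ⟨i', j', h1', c1'⟩ | i' <;>
        simp_all [Gen.act_single, Gen.mul, Arrow.src, Arrow.tgt]
    | dual i j h c =>
      simp only [map_mul, FreeAlgebra.lift_ι_apply]
      ext g : 2
      simp only [LinearMap.comp_apply, Finsupp.lsingle_apply, Gen.act_single, Module.End.mul_apply]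
      rcases g with l | ⟨p, q, h2, c'⟩ | p <;>
        simp only [Gen.mul] <;> (try split_ifs) <;>
        simp_all [Gen.act_single, Gen.mul, Arrow.tgt]
    | nondual i j h c c' hc =>
      simp only [map_mul, map_zero, FreeAlgebra.lift_ι_apply]
      ext g : 2
      simp only [LinearMap.comp_apply, Finsupp.lsingle_apply, Gen.act_single, Module.End.mul_apply]
      rcases g with l | ⟨p, q, h2, c'⟩ | p <;>
        simp only [Gen.mul] <;> (try split_ifs) <;>
        simp_all [Gen.act_single, Gen.mul, Arrow.tgt]
    | loop_sq i =>
      simp only [map_mul, map_zero, FreeAlgebra.lift_ι_apply]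
      ext g : 2
      simp only [LinearMap.comp_apply, Finsupp.lsingle_apply, Gen.act_single, Module.End.mul_apply]
      rcases g with l | ⟨p, q, h2, c'⟩ | p <;>
        simp only [Gen.mul] <;> (try split_ifs) <;>
        simp_all [Gen.act_single, Gen.mul, Arrow.tgt]⟩

lemma rep_gen (g : Gen n) : rep k n (gen k g) = Gen.act k g :=
  (RingQuot.liftAlgHom_mkAlgHom_apply k _ _ _).trans (FreeAlgebra.lift_ι_apply _ _)

/-- The coordinates of an element of the zigzag algebra with respect to the generators. -/
def coord (n : ℕ) : Zigzag k n →ₗ[k] (Gen n →₀ k) :=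
  LinearMap.applyₗ (∑ i, Finsupp.single (.e i) 1) ∘ₗ (rep k n).toLinearMap

/-- The vector ∑ e_i plays the role of the unit, so letting g act on it recovers g. This makes the
generators linearly independent, which the presentation alone does not show. -/
lemma coord_gen (g : Gen n) : coord k n (gen k g) = Finsupp.single g 1 := by
  change rep k n (gen k g) _ = _
  rw [rep_gen, map_sum]
  simp only [Gen.act_single]
  rcases g with i | a
  · rw [Finset.sum_eq_single i] <;> simp +contextual [Gen.mul, eq_comm]
  · rw [Finset.sum_eq_single a.tgt] <;> simp +contextual [Gen.mul, eq_comm]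

/-- The functional which takes the coefficient of the loop at `i`. -/
def ζ (i : Fin n) : Zigzag k n →ₗ[k] k := Finsupp.lapply (.arr (.loop i)) ∘ₗ coord k n

lemma ζ_loop (i : Fin n) : ζ k i (arr k (.loop i)) = 1 := by
  simp [ζ, arr, coord_gen]

lemma ζ_gen_of_ne {i : Fin n} {g : Gen n} (h : g ≠ .arr (.loop i)) : ζ k i (gen k g) = 0 := by
  simp [ζ, coord_gen, h]

lemma ζ_e (i j : Fin n) : ζ k i (e k j) = 0 := ζ_gen_of_ne k (by simp)

lemma ζ_of_mem (i : Fin n) {d : ℤ} (hd : d ≠ 2) {x : Zigzag k n} (hx : x ∈ grade k n d) :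
    ζ k i x = 0 := by
  induction hx using Submodule.span_induction with
  | mem x h =>
    obtain ⟨g, rfl, rfl⟩ := h
    refine ζ_gen_of_ne k ?_
    rintro rfl
    exact hd rfl
  | zero => exact map_zero _
  | add x y _ _ hx hy => rw [map_add, hx, hy, add_zero]
  | smul c x _ hx => rw [map_smul, hx, smul_zero]

lemma loop_ne_zero (i : Fin n) : arr k (.loop i) ≠ 0 := fun h => by
  simpa [h] using ζ_loop k i

end Zigzag

/-! ### Homogeneous components and the radical -/

namespace Zigzag

variable (k : Type u) [Field k] {n : ℕ}

lemma loop_mem_grade (i : Fin n) : arr k (.loop i) ∈ grade k n 2 := gen_mem_grade k (.arr (.loop i))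

lemma e_mem_grade (i : Fin n) : e k i ∈ grade k n 0 := gen_mem_grade k (.e i)

lemma edge_self (i : Fin n) (c : Bool) : edge k i i c = 0 := dif_pos rfl

lemma gen_edge {i j : Fin n} (h : i ≠ j) (c : Bool) :
    gen k (.arr (.edge i j h c)) = edge k i j c := by
  rw [edge, dif_neg h]; rfl

lemma edge_mul_edge_rev (i j l : Fin n) (c c' : Bool) (h : i ≠ j) :
    edge k j i c * edge k i l c' = if l = j then if c = c' then arr k (.loop j) else 0 else 0 := by
  rw [edge_mul_edge'' k _ _ _ _ _ _ h.symm, if_pos rfl]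
  simp only [eq_comm]

end Zigzag

namespace GrProj

open Zigzag

variable {k : Type u} [Field k] {n : ℕ}

/-- The projection to the homogeneous component of degree `d`. -/
def pr (M : GrProj k n) (d : ℤ) : M.carrier →ₗ[k] M.carrier :=
  Finsupp.lapply d ∘ₗ (exists_components M.internal).choose

lemma pr_of_mem (M : GrProj k n) {d : ℤ} {x : M.carrier} (hx : x ∈ M.gr d) : pr M d x = x := by
  simp [pr, (exists_components M.internal).choose_spec d x hx]

lemma pr_of_mem_ne (M : GrProj k n) {d e : ℤ} (h : d ≠ e) {x : M.carrier} (hx : x ∈ M.gr d) :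
    pr M e x = 0 := by
  simp [pr, (exists_components M.internal).choose_spec d x hx, h]

lemma gr_induction (M : GrProj k n) {p : M.carrier → Prop} (h : ∀ d, ∀ x ∈ M.gr d, p x)
    (h0 : p 0) (hadd : ∀ x y, p x → p y → p (x + y)) (x : M.carrier) : p x := by
  have hx : x ∈ ⨆ d, M.gr d := by rw [iSup_eq_top_of_internal M.internal]; trivial
  exact Submodule.iSup_induction _ (motive := p) hx h h0 hadd

lemma pr_mem (M : GrProj k n) (d : ℤ) (x : M.carrier) : pr M d x ∈ M.gr d := by
  refine gr_induction M (p := fun x => pr M d x ∈ M.gr d) ?_ ?_ ?_ x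
  · intro e x hx
    by_cases h : e = d
    · subst h; rwa [pr_of_mem M hx]
    · rw [pr_of_mem_ne M h hx]; exact zero_mem _
  · rw [map_zero]; exact zero_mem _
  · intro x y hx hy; rw [map_add]; exact add_mem hx hy

lemma pr_smul (M : GrProj k n) {p q d : ℤ} (h : p + q = d) {a : Zigzag k n}
    (ha : a ∈ grade k n p) (x : M.carrier) : pr M d (a • x) = a • pr M q x := by
  subst h
  refine gr_induction M (p := fun x => pr M (p + q) (a • x) = a • pr M q x) ?_ ?_ ?_ x
  · intro e x hx
    by_cases h : e = q
    · subst h; rw [pr_of_mem M hx, pr_of_mem M (M.smul_mem _ _ _ _ ha hx)]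
    · rw [pr_of_mem_ne M h hx, pr_of_mem_ne M (by omega) (M.smul_mem _ _ _ _ ha hx), smul_zero]
  · simp
  · intro x y hx hy; rw [smul_add, map_add, map_add, hx, hy, smul_add]

lemma lin_pr {M N : GrProj k n} (f : M ⟶ N) (d : ℤ) (x : M.carrier) :
    lin f (pr M d x) = pr N d (lin f x) := by
  refine gr_induction M (p := fun x => lin f (pr M d x) = pr N d (lin f x)) ?_ ?_ ?_ x
  · intro e x hx
    by_cases h : e = d
    · subst h; rw [pr_of_mem M hx, pr_of_mem N (lin_mem f hx)]
    · rw [pr_of_mem_ne M h hx, pr_of_mem_ne N h (lin_mem f hx), map_zero]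
  · simp
  · intro x y hx hy; rw [map_add, map_add, hx, hy, map_add, map_add]

/-- The map `((m_{l,c}), y) ↦ ∑ edge(i, l, c) m_{l,c} + z_i y`, with image `e_i rad M`. -/
def radMap (i : Fin n) (M : Type u) [AddCommGroup M] [Module k M] [Module (Zigzag k n) M]
    [IsScalarTower k (Zigzag k n) M] : ((Fin n → Bool → M) × M) →ₗ[k] M where
  toFun v := (∑ l, ∑ c, edge k i l c • v.1 l c) + arr k (.loop i) • v.2
  map_add' v w := by simp only [Prod.fst_add, Prod.snd_add, Pi.add_apply, smul_add,
    Finset.sum_add_distrib]; abel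
  map_smul' r v := by
    simp only [Prod.smul_fst, Prod.smul_snd, Pi.smul_apply, RingHom.id_apply, smul_add,
      Finset.smul_sum, smul_comm r]

/-- Modulo the radical, e_i A is spanned by e_i: every other generator starting at i is an edge or
the loop, both in the range of `radMap`. -/
lemma exists_e_mul (i : Fin n) (a : Zigzag k n) :
    ∃ c : k, e k i * a - c • e k i ∈ LinearMap.range (radMap (k := k) i (Zigzag k n)) := by
  have ha : a ∈ Submodule.span k (Set.range (gen k (n := n))) := by rw [span_gen]; trivial
  induction ha using Submodule.span_induction with
  | mem a h =>
    obtain ⟨j | ⟨p, q, h, c⟩ | j, rfl⟩ := h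
    · refine ⟨if i = j then 1 else 0, ?_⟩
      change e k i * e k j - _ ∈ _
      rw [e_mul_e]
      split_ifs <;> simp
    · refine ⟨0, ?_⟩
      rw [gen_edge, e_mul_edge, zero_smul, sub_zero]
      split_ifs with hip
      · subst hip
        refine ⟨(fun l c' => if l = q ∧ c' = c then e k q else 0, 0), ?_⟩
        change (∑ l, ∑ c', edge k i l c' * _) + arr k (.loop i) * (0 : Zigzag k n) = _
        rw [mul_zero, add_zero, Finset.sum_eq_single q, Finset.sum_eq_single c]
        · simp [edge_mul_e]
        · intro b _ hb; simp [hb]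
        · simp
        · intro b _ hb; simp [hb]
        · simp
      · exact zero_mem _
    · refine ⟨0, ?_⟩
      change e k i * arr k (.loop j) - _ ∈ _
      rw [e_mul_loop, zero_smul, sub_zero]
      split_ifs with hij
      · subst hij
        exact ⟨(0, 1), by simp [radMap]⟩
      · exact zero_mem _
  | zero => exact ⟨0, by simp⟩
  | add x y _ _ hx hy =>
    obtain ⟨c, hc⟩ := hx
    obtain ⟨c', hc'⟩ := hy
    refine ⟨c + c', ?_⟩
    have := add_mem hc hc'
    rwa [show e k i * x - c • e k i + (e k i * y - c' • e k i) =
      e k i * (x + y) - (c + c') • e k i by rw [mul_add, add_smul]; abel] at this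
  | smul r x _ hx =>
    obtain ⟨c, hc⟩ := hx
    refine ⟨r * c, ?_⟩
    have := Submodule.smul_mem _ r hc
    rwa [smul_sub, ← mul_smul_comm, smul_smul] at this

lemma loop_mul_radMap (i : Fin n) (v) :
    arr k (.loop i) * radMap (k := k) i (Zigzag k n) v = 0 := by
  change arr k (.loop i) * ((∑ l, ∑ c, edge k i l c * v.1 l c) + arr k (.loop i) * v.2) = 0
  simp [mul_add, Finset.mul_sum, ← mul_assoc, loop_mul_edge', loop_mul_loop]

/-- Write a = c e_i + r with r in the radical. Since z_i kills r and z_i e_i = z_i ≠ 0, the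
hypothesis z_i a = 0 forces c = 0. -/
lemma mem_range_radMap_algebra {i : Fin n} {a : Zigzag k n} (h : e k i * a = a)
    (h' : arr k (.loop i) * a = 0) : a ∈ LinearMap.range (radMap (k := k) i (Zigzag k n)) := by
  obtain ⟨c, v, hv⟩ := exists_e_mul (k := k) i a
  rw [h] at hv
  have h1 : arr k (.loop i) * (a - c • e k i) = 0 := by rw [← hv, loop_mul_radMap]
  rw [mul_sub, h', zero_sub, neg_eq_zero, mul_smul_comm, loop_mul_e, if_pos rfl] at h1
  rw [(smul_eq_zero.1 h1).resolve_right (loop_ne_zero k i), zero_smul, sub_zero] at hv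
  exact ⟨v, hv⟩

lemma radMap_smul (i : Fin n) (v : (Fin n → Bool → Zigzag k n) × Zigzag k n) (M : GrProj k n)
    (x : M.carrier) : radMap (k := k) i (Zigzag k n) v • x =
      radMap (k := k) i M.carrier (fun l c => v.1 l c • x, v.2 • x) := by
  change ((∑ l, ∑ c, edge k i l c * v.1 l c) + arr k (.loop i) * v.2) • x =
    (∑ l, ∑ c, edge k i l c • v.1 l c • x) + arr k (.loop i) • v.2 • x
  simp [add_smul, Finset.sum_smul, mul_smul]

/-- Projectivity reduces the claim to the algebra: a linear section of the canonical free cover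
writes x as a combination of elements of M whose coefficients satisfy the same two equations as x.
-/
lemma mem_range_radMap {i : Fin n} {M : GrProj k n} {x : M.carrier} (h : e k i • x = x)
    (h' : arr k (.loop i) • x = 0) : x ∈ LinearMap.range (radMap (k := k) i M.carrier) := by
  obtain ⟨s, hs⟩ := (Module.projective_def (R := Zigzag k n) (P := M.carrier)).1 inferInstance
  have hx : x = ∑ m ∈ (s x).support, s x m • m := (hs x).symm
  rw [hx]
  refine Submodule.sum_mem _ fun m _ => ?_
  obtain ⟨v, hv⟩ := mem_range_radMap_algebra (k := k) (i := i) (a := s x m)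
    (by rw [← smul_eq_mul, ← Finsupp.smul_apply, ← map_smul, h])
    (by rw [← smul_eq_mul, ← Finsupp.smul_apply, ← map_smul, h', map_zero, Finsupp.zero_apply])
  rw [← hv, radMap_smul]
  exact ⟨_, rfl⟩

/-- The kernel of `z_i` on `e_i M` is the radical. -/
lemma exists_of_loop_smul_eq_zero {i : Fin n} {M : GrProj k n} {d : ℤ} {x : M.carrier}
    (hd : x ∈ M.gr d) (h : e k i • x = x) (h' : arr k (.loop i) • x = 0) :
    ∃ (m : Fin n → Bool → M.carrier) (y : M.carrier), (∀ l c, m l c ∈ M.gr (d - 1)) ∧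
      y ∈ M.gr (d - 2) ∧ x = (∑ l, ∑ c, edge k i l c • m l c) + arr k (.loop i) • y := by
  obtain ⟨⟨m, y⟩, hx⟩ := mem_range_radMap h h'
  refine ⟨fun l c => pr M (d - 1) (m l c), pr M (d - 2) y, fun _ _ => pr_mem _ _ _, pr_mem _ _ _, ?_⟩
  rw [← pr_of_mem M hd, ← hx]
  change pr M d ((∑ l, ∑ c, edge k i l c • m l c) + arr k (.loop i) • y) = _
  simp only [map_add, map_sum]
  rw [pr_smul M (show (2 : ℤ) + (d - 2) = d by omega) (loop_mem_grade k i)]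
  simp only [pr_smul M (show (1 : ℤ) + (d - 1) = d by omega) (edge_mem_grade k i _ _)]

end GrProj

/-! ### Functors to vector spaces -/

namespace GrProj

open Zigzag

variable {k : Type u} [Field k] {n : ℕ}

/-- The functor to vector spaces given by natural subspaces. -/
def subFunctor (S : ∀ M : GrProj k n, Submodule k M.carrier)
    (hS : ∀ {M N : GrProj k n} (f : M ⟶ N), ∀ x ∈ S M, lin f x ∈ S N) :
    GrProj k n ⥤ ModuleCat.{u} k where
  obj M := ModuleCat.of k (S M)
  map f := ModuleCat.ofHom (((lin f).restrictScalars k).restrict (hS f))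
  map_id _ := rfl
  map_comp _ _ := rfl

instance (S : ∀ M : GrProj k n, Submodule k M.carrier)
    (hS : ∀ {M N : GrProj k n} (f : M ⟶ N), ∀ x ∈ S M, lin f x ∈ S N) :
    (subFunctor S hS).Additive where
  map_add := rfl

instance (M : GrProj k n) : Module.Finite k M.carrier := Module.Finite.trans (Zigzag k n) M.carrier

lemma e_smul_mem {M : GrProj k n} {i : Fin n} {d : ℤ} {x : M.carrier} (hx : x ∈ M.gr d) :
    e k i • x ∈ M.gr d := by
  simpa using M.smul_mem _ _ _ _ (e_mem_grade k i) hx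

lemma loop_smul_mem {M : GrProj k n} {i : Fin n} {d d' : ℤ} (h : d + 2 = d') {x : M.carrier}
    (hx : x ∈ M.gr d) : arr k (.loop i) • x ∈ M.gr d' := by
  subst h
  rw [add_comm d]
  exact M.smul_mem _ _ _ _ (loop_mem_grade k i) hx

lemma edge_smul_mem {M : GrProj k n} {i j : Fin n} {c : Bool} {d d' : ℤ} (h : d + 1 = d')
    {x : M.carrier} (hx : x ∈ M.gr d) : edge k i j c • x ∈ M.gr d' := by
  subst h
  rw [add_comm d]
  exact M.smul_mem _ _ _ _ (edge_mem_grade k i j c) hx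

lemma e_smul_loop_smul {M : GrProj k n} (i : Fin n) (x : M.carrier) :
    e k i • arr k (.loop i) • x = arr k (.loop i) • x := by
  rw [← mul_smul, e_mul_loop, if_pos rfl]

lemma loop_smul_e_smul {M : GrProj k n} (i : Fin n) (x : M.carrier) :
    arr k (.loop i) • e k i • x = arr k (.loop i) • x := by
  rw [← mul_smul, loop_mul_e, if_pos rfl]

lemma loop_smul_loop_smul {M : GrProj k n} (i j : Fin n) (x : M.carrier) :
    arr k (.loop i) • arr k (.loop j) • x = 0 := by
  rw [← mul_smul, loop_mul_loop, zero_smul]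

lemma e_smul_edge_smul {M : GrProj k n} (i j : Fin n) (c : Bool) (x : M.carrier) :
    e k i • edge k i j c • x = edge k i j c • x := by
  rw [← mul_smul, e_mul_edge, if_pos rfl]

lemma edge_smul_e_smul {M : GrProj k n} (i j : Fin n) (c : Bool) (x : M.carrier) :
    edge k i j c • e k j • x = edge k i j c • x := by
  rw [← mul_smul, edge_mul_e, if_pos rfl]

lemma edge_smul_loop_smul {M : GrProj k n} (i j l : Fin n) (c : Bool) (x : M.carrier) :
    edge k i j c • arr k (.loop l) • x = 0 := by
  rw [← mul_smul, edge_mul_loop', zero_smul]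

lemma loop_smul_edge_smul {M : GrProj k n} (i j l : Fin n) (c : Bool) (x : M.carrier) :
    arr k (.loop l) • edge k i j c • x = 0 := by
  rw [← mul_smul, loop_mul_edge', zero_smul]

lemma edge_smul_edge_smul {M : GrProj k n} {i j : Fin n} (h : i ≠ j) (l : Fin n) (c c' : Bool)
    (x : M.carrier) : edge k j i c • edge k i l c' • x =
      if l = j then if c = c' then arr k (.loop j) • x else 0 else 0 := by
  rw [← mul_smul, edge_mul_edge_rev k i j l c c' h]
  split_ifs <;> simp

/-- The paths j → i → l vanish unless l = j and the labels agree, when they give z_j. So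
multiplication by one edge isolates one summand of a radical element. -/
lemma edge_smul_sum {M : GrProj k n} {i j : Fin n} (h : i ≠ j) (c : Bool)
    (m : Fin n → Bool → M.carrier) (y : M.carrier) :
    edge k j i c • ((∑ l, ∑ c, edge k i l c • m l c) + arr k (.loop i) • y) =
      arr k (.loop j) • m j c := by
  rw [smul_add, edge_smul_loop_smul, add_zero, Finset.smul_sum, Finset.sum_eq_single j,
    Finset.smul_sum, Finset.sum_eq_single c]
  · rw [edge_smul_edge_smul h, if_pos rfl, if_pos rfl]
  · intro b _ hb; rw [edge_smul_edge_smul h, if_pos rfl, if_neg hb.symm]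
  · simp
  · intro b _ hb
    rw [Finset.smul_sum]
    exact Finset.sum_eq_zero fun c' _ => by rw [edge_smul_edge_smul h, if_neg hb]
  · simp

/-- The subspace `e_i M_d`. -/
def eSub (i : Fin n) (d : ℤ) (M : GrProj k n) : Submodule k M.carrier := corner i M ⊓ M.gr d

/-- The subspace `z_i M_d`. -/
def zSub (i : Fin n) (d : ℤ) (M : GrProj k n) : Submodule k M.carrier :=
  (eSub i d M).map (Module.toModuleEnd k M.carrier (arr k (.loop i)))

/-- The subspace of the elements of `e_i M_d` killed by `z_i`. -/
def rSub (i : Fin n) (d : ℤ) (M : GrProj k n) : Submodule k M.carrier :=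
  eSub i d M ⊓ LinearMap.ker (Module.toModuleEnd k M.carrier (arr k (.loop i)))

lemma mem_rSub {i : Fin n} {d : ℤ} {M : GrProj k n} {x : M.carrier} :
    x ∈ rSub i d M ↔ x ∈ eSub i d M ∧ arr k (.loop i) • x = 0 := Iff.rfl

lemma lin_mem_eSub {i : Fin n} {d : ℤ} {M N : GrProj k n} (f : M ⟶ N) (x : M.carrier)
    (hx : x ∈ eSub i d M) : lin f x ∈ eSub i d N :=
  ⟨mem_corner.2 (by rw [← map_smul, mem_corner.1 hx.1]), lin_mem f hx.2⟩

lemma lin_mem_zSub {i : Fin n} {d : ℤ} {M N : GrProj k n} (f : M ⟶ N) (x : M.carrier)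
    (hx : x ∈ zSub i d M) : lin f x ∈ zSub i d N := by
  obtain ⟨y, hy, rfl⟩ := hx
  exact ⟨lin f y, lin_mem_eSub f y hy, (map_smul (lin f) _ y).symm⟩

lemma lin_mem_rSub {i : Fin n} {d : ℤ} {M N : GrProj k n} (f : M ⟶ N) (x : M.carrier)
    (hx : x ∈ rSub i d M) : lin f x ∈ rSub i d N := by
  rw [mem_rSub] at hx ⊢
  exact ⟨lin_mem_eSub f x hx.1, by rw [← map_smul, hx.2, map_zero]⟩

variable (k) in
/-- The functor `M ↦ e_i M_d`. -/
def E (i : Fin n) (d : ℤ) : GrProj k n ⥤ ModuleCat.{u} k := subFunctor (eSub i d) lin_mem_eSub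

variable (k) in
/-- The functor `M ↦ z_i M_d`. -/
def T (i : Fin n) (d : ℤ) : GrProj k n ⥤ ModuleCat.{u} k := subFunctor (zSub i d) lin_mem_zSub

variable (k) in
/-- The functor `M ↦ ker (z_i : e_i M_d ⟶ e_i M_{d+2})`. -/
def R (i : Fin n) (d : ℤ) : GrProj k n ⥤ ModuleCat.{u} k := subFunctor (rSub i d) lin_mem_rSub

instance (i : Fin n) (d : ℤ) : (E k i d).Additive := inferInstanceAs (subFunctor _ _).Additive
instance (i : Fin n) (d : ℤ) : (T k i d).Additive := inferInstanceAs (subFunctor _ _).Additive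
instance (i : Fin n) (d : ℤ) : (R k i d).Additive := inferInstanceAs (subFunctor _ _).Additive

lemma loop_smul_mem_zSub {i : Fin n} {d : ℤ} {M : GrProj k n} {x : M.carrier} (hx : x ∈ M.gr d) :
    arr k (.loop i) • x ∈ zSub i d M :=
  ⟨e k i • x, ⟨mem_corner.2 (by rw [← mul_smul, e_mul_self]), e_smul_mem hx⟩, loop_smul_e_smul i x⟩

/-- An element killed by z_i is a radical element ∑ edge · m + z_i y, and the edge extracts z_j
m_{j,c} from it. -/
lemma edge_smul_mem_zSub {i j : Fin n} (h : i ≠ j) (c : Bool) {d : ℤ} {M : GrProj k n}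
    {x : M.carrier} (hx : x ∈ rSub i d M) : edge k j i c • x ∈ zSub j (d - 1) M := by
  rw [mem_rSub] at hx
  obtain ⟨m, y, hm, hy, rfl⟩ := exists_of_loop_smul_eq_zero hx.1.2 hx.1.1 hx.2
  rw [edge_smul_sum h]
  exact loop_smul_mem_zSub (hm _ _)

variable (k) in
/-- The functor `M ↦ ∏_{j ≠ i, c} z_j M_{d-1}`. -/
def W (i : Fin n) (d : ℤ) : GrProj k n ⥤ ModuleCat.{u} k where
  obj M := ModuleCat.of k (∀ t : {j : Fin n // j ≠ i} × Bool, zSub t.1.1 (d - 1) M)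
  map f := ModuleCat.ofHom (LinearMap.pi fun t =>
    ((T k t.1.1 (d - 1)).map f).hom ∘ₗ LinearMap.proj t)

instance (i : Fin n) (d : ℤ) : (W k i d).Additive where
  map_add := rfl

variable (k) in
/-- The inclusion of `R` into `E`. -/
def rToE (i : Fin n) (d : ℤ) : R k i d ⟶ E k i d where
  app M := ModuleCat.ofHom (Submodule.inclusion inf_le_left)

variable (k) in
/-- Multiplication by `z_i`, from `E` to `T`. -/
def eToT (i : Fin n) (d : ℤ) : E k i d ⟶ T k i d where
  app M := ModuleCat.ofHom ((Module.toModuleEnd k M.carrier (arr k (.loop i))).restrict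
    fun x hx => Submodule.mem_map_of_mem hx)
  naturality M N f := by
    ext x
    exact Subtype.ext (map_smul (lin f) _ x.1).symm

lemma zSub_le_rSub (i : Fin n) (d : ℤ) (M : GrProj k n) : zSub i (d - 2) M ≤ rSub i d M := by
  rintro _ ⟨x, hx, rfl⟩
  exact ⟨⟨e_smul_loop_smul i x, loop_smul_mem (by omega) hx.2⟩, loop_smul_loop_smul i i x⟩

variable (k) in
/-- The inclusion of `T` into `R`. -/
def tToR (i : Fin n) (d : ℤ) : T k i (d - 2) ⟶ R k i d where
  app M := ModuleCat.ofHom (Submodule.inclusion (zSub_le_rSub i d M))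

variable (k) in
/-- Multiplication by the edges with target `i`, from `R` to `W`. -/
def rToW (i : Fin n) (d : ℤ) : R k i d ⟶ W k i d where
  app M := ModuleCat.ofHom (LinearMap.pi fun t =>
    (Module.toModuleEnd k M.carrier (edge k t.1.1 i t.2)).restrict
      fun _ hx => edge_smul_mem_zSub t.1.2.symm t.2 hx)
  naturality M N f := by
    ext x
    funext t
    exact Subtype.ext (map_smul (lin f) _ x.1).symm

lemma rToE_eToT (i : Fin n) (d : ℤ) : rToE k i d ≫ eToT k i d = 0 := by
  ext M x
  exact Subtype.ext x.2.2

lemma tToR_rToW (i : Fin n) (d : ℤ) : tToR k i d ≫ rToW k i d = 0 := by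
  ext M x
  obtain ⟨_, y, hy, rfl⟩ := x
  funext t
  exact Subtype.ext (edge_smul_loop_smul _ _ _ _ _)

/-- The sequence `0 ⟶ R ⟶ E ⟶ T ⟶ 0`. -/
def seqE (i : Fin n) (d : ℤ) : ShortComplex (GrProj k n ⥤ ModuleCat.{u} k) :=
  .mk _ _ (rToE_eToT i d)

/-- The sequence `0 ⟶ T ⟶ R ⟶ W ⟶ 0`. -/
def seqR (i : Fin n) (d : ℤ) : ShortComplex (GrProj k n ⥤ ModuleCat.{u} k) :=
  .mk _ _ (tToR_rToW i d)

lemma shortExact_of {M₁ M₂ M₃ : Type u} [AddCommGroup M₁] [Module k M₁] [AddCommGroup M₂]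
    [Module k M₂] [AddCommGroup M₃] [Module k M₃] (f : M₁ →ₗ[k] M₂) (g : M₂ →ₗ[k] M₃)
    (w : ModuleCat.ofHom f ≫ ModuleCat.ofHom g = 0)
    (hf : Function.Injective f) (hg : Function.Surjective g)
    (h : ∀ x, g x = 0 → ∃ y, f y = x) : (ShortComplex.mk _ _ w).ShortExact where
  exact := by
    rw [ShortComplex.moduleCat_exact_iff]
    exact h
  mono_f := (ModuleCat.mono_iff_injective _).2 hf
  epi_g := (ModuleCat.epi_iff_surjective _).2 hg

lemma seqE_shortExact (i : Fin n) (d : ℤ) (M : GrProj k n) :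
    ((seqE i d).map ((evaluation _ _).obj M)).ShortExact := by
  refine shortExact_of (M₁ := rSub i d M) (M₂ := eSub i d M) (M₃ := zSub i d M) _ _ _ ?_ ?_ ?_
  · exact Submodule.inclusion_injective _
  · rintro ⟨_, x, hx, rfl⟩
    exact ⟨⟨x, hx⟩, rfl⟩
  · intro x hx
    exact ⟨⟨x.1, x.2, congrArg Subtype.val hx⟩, rfl⟩

/-- The middle layer of e_i M_d, that is the radical modulo the socle: it is made of the tops at the
neighbours j, once for each of the two edges. Surjectivity and the kernel both come from
`edge_smul_sum`. -/
lemma seqR_shortExact (i : Fin n) (d : ℤ) (M : GrProj k n) :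
    ((seqR i d).map ((evaluation _ _).obj M)).ShortExact := by
  refine shortExact_of (M₁ := zSub i (d - 2) M) (M₂ := rSub i d M)
    (M₃ := ∀ t : {j : Fin n // j ≠ i} × Bool, zSub t.1.1 (d - 1) M) _ _ _ ?_ ?_ ?_
  · exact Submodule.inclusion_injective _
  · intro w
    choose y hy hyw using fun t => (w t).2
    -- The entries at l = i are irrelevant, because the edge from i to i is zero by convention.
    let m : Fin n → Bool → M.carrier := fun l c => if h : l ≠ i then y (⟨l, h⟩, c) else 0
    have hm : ∀ l c, m l c ∈ M.gr (d - 1) := fun l c => by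
      dsimp only [m]
      split_ifs with h
      · exact (hy _).2
      · exact zero_mem _
    refine ⟨⟨(∑ l, ∑ c, edge k i l c • m l c) + arr k (.loop i) • 0, ⟨?_, ?_⟩, ?_⟩, ?_⟩
    · refine mem_corner.2 ?_
      simp only [smul_zero, add_zero, Finset.smul_sum, e_smul_edge_smul]
    · rw [smul_zero, add_zero]
      exact sum_mem fun l _ => sum_mem fun c _ => edge_smul_mem (by omega) (hm l c)
    · refine LinearMap.mem_ker.2 ?_
      change arr k (.loop i) • (_ : M.carrier) = 0
      simp only [smul_zero, add_zero, Finset.smul_sum, loop_smul_edge_smul, Finset.sum_const_zero]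
    · funext t
      refine Subtype.ext ((edge_smul_sum t.1.2.symm t.2 m 0).trans ?_)
      dsimp only [m]
      rw [dif_pos t.1.2]
      exact hyw t
  · intro x hx
    obtain ⟨x, hxR⟩ := x
    have hxR' := hxR
    rw [mem_rSub] at hxR'
    obtain ⟨m, y, hm, hy, rfl⟩ := exists_of_loop_smul_eq_zero hxR'.1.2 hxR'.1.1 hxR'.2
    suffices h : ∀ l c, edge k i l c • m l c ∈ zSub i (d - 2) M by
      exact ⟨⟨_, add_mem (sum_mem fun l _ => sum_mem fun c _ => h l c) (loop_smul_mem_zSub hy)⟩, rfl⟩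
    intro l c
    by_cases hl : l = i
    · subst hl; rw [edge_self, zero_smul]; exact zero_mem _
    -- Vanishing in `W` says that z_l kills m_{l,c}. Hence e_l m_{l,c} is itself radical, and a
    -- second application of `edge_smul_sum` turns edge · m_{l,c} into a multiple of z_i in degree d
    -- - 2.
    have h1 : arr k (.loop l) • m l c = 0 :=
      (edge_smul_sum (Ne.symm hl) c m y).symm.trans
        (congrArg Subtype.val (congrFun hx (⟨l, hl⟩, c)))
    obtain ⟨m', y', hm', hy', h2⟩ := exists_of_loop_smul_eq_zero (i := l) (x := e k l • m l c)
      (e_smul_mem (hm l c)) (by rw [← mul_smul, e_mul_self]) (by rw [loop_smul_e_smul, h1])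
    rw [← edge_smul_e_smul, h2, edge_smul_sum hl]
    have := hm' i c
    rw [show d - 1 - 1 = d - 2 by omega] at this
    exact loop_smul_mem_zSub this

end GrProj

/-! ### The bimodules `A e_i ⊗ e_i A` -/

namespace Zigzag

variable (k : Type u) [Field k] {n : ℕ}

lemma loop_mul_of_mem (i : Fin n) {d : ℤ} (hd : d ≠ 0) {a : Zigzag k n} (ha : a ∈ grade k n d) :
    arr k (.loop i) * a = 0 := by
  induction ha using Submodule.span_induction with
  | mem a h =>
    obtain ⟨j | ⟨p, q, h, c⟩ | j, rfl, rfl⟩ := h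
    · exact absurd rfl hd
    · exact loop_mul_edge k i h c
    · exact loop_mul_loop k i j
  | zero => exact mul_zero _
  | add x y _ _ hx hy => rw [mul_add, hx, hy, add_zero]
  | smul c x _ hx => rw [mul_smul_comm, hx, smul_zero]

lemma exists_loop_mul (i : Fin n) (a : Zigzag k n) :
    ∃ c : k, arr k (.loop i) * a = c • arr k (.loop i) := by
  have ha : a ∈ Submodule.span k (Set.range (gen k (n := n))) := by rw [span_gen]; trivial
  induction ha using Submodule.span_induction with
  | mem a h =>
    obtain ⟨j | ⟨p, q, h, c⟩ | j, rfl⟩ := h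
    · refine ⟨if i = j then 1 else 0, (loop_mul_e k j i).trans ?_⟩
      split_ifs <;> simp
    · exact ⟨0, (loop_mul_edge k i h c).trans (zero_smul _ _).symm⟩
    · exact ⟨0, (loop_mul_loop k i j).trans (zero_smul _ _).symm⟩
  | zero => exact ⟨0, by simp⟩
  | add x y _ _ hx hy =>
    obtain ⟨c, hc⟩ := hx
    obtain ⟨c', hc'⟩ := hy
    exact ⟨c + c', by rw [mul_add, hc, hc', add_smul]⟩
  | smul r x _ hx =>
    obtain ⟨c, hc⟩ := hx
    exact ⟨r * c, by rw [mul_smul_comm, hc, mul_smul]⟩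

lemma exists_e_mul_mul_e (i : Fin n) (a : Zigzag k n) :
    ∃ c c' : k, e k i * a * e k i = c • e k i + c' • arr k (.loop i) := by
  have ha : a ∈ Submodule.span k (Set.range (gen k (n := n))) := by rw [span_gen]; trivial
  induction ha using Submodule.span_induction with
  | mem a h =>
    obtain ⟨j | ⟨p, q, h, c⟩ | j, rfl⟩ := h
    · refine ⟨if i = j then 1 else 0, 0, ?_⟩
      change e k i * e k j * e k i = _
      rw [e_mul_e]
      split_ifs <;> simp [e_mul_self]
    · refine ⟨0, 0, ?_⟩
      rw [gen_edge, e_mul_edge]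
      split_ifs with hip
      · rw [edge_mul_e, if_neg (by rintro rfl; exact h hip.symm)]; simp
      · simp
    · refine ⟨0, if i = j then 1 else 0, ?_⟩
      change e k i * arr k (.loop j) * e k i = _
      rw [e_mul_loop]
      split_ifs with hij
      · subst hij; simp [loop_mul_e]
      · simp
  | zero => exact ⟨0, 0, by simp⟩
  | add x y _ _ hx hy =>
    obtain ⟨c, d, hc⟩ := hx
    obtain ⟨c', d', hc'⟩ := hy
    exact ⟨c + c', d + d', by rw [mul_add, add_mul, hc, hc', add_smul, add_smul]; abel⟩
  | smul r x _ hx =>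
    obtain ⟨c, d, hc⟩ := hx
    exact ⟨r * c, r * d, by rw [mul_smul_comm, smul_mul_assoc, hc, smul_add, smul_smul, smul_smul]⟩

end Zigzag

namespace GrProj

open Zigzag

variable {k : Type u} [Field k] {n : ℕ}

variable (k) in
/-- The idempotent `e_i` as an element of `A e_i`. -/
def idE (i : Fin n) : ideal k i := ⟨e k i, e_mul_self k i⟩

variable (k) in
/-- The loop `z_i` as an element of `A e_i`. -/
def idZ (i : Fin n) : ideal k i := ⟨arr k (.loop i), (loop_mul_e k i i).trans (if_pos rfl)⟩

lemma smul_idE {i : Fin n} (p : ideal k i) : p.1 • idE k i = p := Subtype.ext p.2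

lemma loop_smul_idE (i : Fin n) : arr k (.loop i) • idE k i = idZ k i :=
  Subtype.ext (idZ k i).2

lemma tmul_eq_smul {i : Fin n} {V : Type u} [AddCommGroup V] [Module k V] (p : ideal k i) (v : V) :
    p ⊗ₜ[k] v = p.1 • (idE k i ⊗ₜ[k] v) := by
  rw [TensorProduct.smul_tmul', smul_idE]

lemma ideal_tensor_ext {i : Fin n} {V N : Type u} [AddCommGroup V] [Module k V] [AddCommGroup N]
    [Module (Zigzag k n) N] {f g : ideal k i ⊗[k] V →ₗ[Zigzag k n] N}
    (h : ∀ v, f (idE k i ⊗ₜ v) = g (idE k i ⊗ₜ v)) : f = g := by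
  ext x
  induction x using TensorProduct.induction_on with
  | zero => simp
  | tmul p v => rw [tmul_eq_smul, map_smul, map_smul, h]
  | add x y hx hy => rw [map_add, map_add, hx, hy]

/-- The map `A e_i ⊗ V ⟶ A e_i ⊗ V'` induced by a linear map. -/
def idTensor (i : Fin n) {V V' : Type u} [AddCommGroup V] [Module k V] [AddCommGroup V']
    [Module k V'] (f : V →ₗ[k] V') : ideal k i ⊗[k] V →ₗ[Zigzag k n] ideal k i ⊗[k] V' :=
  TensorProduct.AlgebraTensorModule.map LinearMap.id f

lemma idTensor_tmul (i : Fin n) {V V' : Type u} [AddCommGroup V] [Module k V] [AddCommGroup V']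
    [Module k V'] (f : V →ₗ[k] V') (p : ideal k i) (v : V) :
    idTensor i f (p ⊗ₜ v) = p ⊗ₜ f v := rfl

lemma idTensor_mem (i : Fin n) {V V' : Type u} [AddCommGroup V] [Module k V] [AddCommGroup V']
    [Module k V'] {f : V →ₗ[k] V'} {gr : ℤ → Submodule k V} {gr' : ℤ → Submodule k V'} {r r' : ℤ}
    (hf : ∀ q, ∀ x ∈ gr q, f x ∈ gr' (q + r' - r)) {d : ℤ} {t : ideal k i ⊗[k] V}
    (ht : t ∈ tensorGrade (idealGrade k i) gr r d) :
    idTensor i f t ∈ tensorGrade (idealGrade k i) gr' r' d :=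
  tensorGrade_le (S := (tensorGrade (idealGrade k i) gr' r' d).comap
    ((idTensor i f).restrictScalars k))
    (fun _ _ h _ hx _ hy => tmul_mem_tensorGrade hx (hf _ _ hy) (by omega)) ht

/-- This is the statement that e_i A e_i is spanned by e_i and z_i, tensored with e_i M. -/
lemma exists_of_mem_corner {i : Fin n} {M : GrProj k n} (y : ideal k i ⊗[k] corner i M)
    (hy : e k i • y = y) : ∃ x x' : corner i M, y = idE k i ⊗ₜ x + idZ k i ⊗ₜ x' := by
  rw [← hy]
  clear hy
  induction y using TensorProduct.induction_on with
  | zero => exact ⟨0, 0, by simp⟩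
  | tmul p v =>
    obtain ⟨c, c', h⟩ := exists_e_mul_mul_e k i p.1
    have h' : e k i • p = c • idE k i + c' • idZ k i :=
      Subtype.ext (by rw [mul_assoc, mem_ideal.1 p.2] at h; exact h)
    refine ⟨c • v, c' • v, ?_⟩
    rw [TensorProduct.smul_tmul', h', TensorProduct.add_tmul, TensorProduct.smul_tmul,
      TensorProduct.smul_tmul]
  | add x y hx hy =>
    obtain ⟨a, b, h⟩ := hx
    obtain ⟨a', b', h'⟩ := hy
    exact ⟨a + a', b + b', by
      rw [smul_add, h, h', TensorProduct.tmul_add, TensorProduct.tmul_add]; abel⟩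

/-- The map `A e_i ⊗ V ⟶ V` which takes the coefficient of `z_i`. -/
def ρ (i : Fin n) (V : Type u) [AddCommGroup V] [Module k V] : ideal k i ⊗[k] V →ₗ[k] V :=
  TensorProduct.lid k V ∘ₗ
    TensorProduct.map (ζ k i ∘ₗ (ideal k i).subtype.restrictScalars k) LinearMap.id

lemma ρ_tmul (i : Fin n) (V : Type u) [AddCommGroup V] [Module k V] (p : ideal k i) (v : V) :
    ρ i V (p ⊗ₜ v) = ζ k i p.1 • v := by
  simp [ρ]

lemma ρ_mem (i : Fin n) {V : Type u} [AddCommGroup V] [Module k V] {gr : ℤ → Submodule k V}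
    {r d : ℤ} {t : ideal k i ⊗[k] V} (ht : t ∈ tensorGrade (idealGrade k i) gr r d) :
    ρ i V t ∈ gr (d + r - 2) := by
  refine tensorGrade_le (S := (gr (d + r - 2)).comap (ρ i V)) ?_ ht
  intro p q h x hx y hy
  rw [Submodule.mem_comap, ρ_tmul]
  by_cases hp : p = 2
  · rw [show d + r - 2 = q by omega]
    exact Submodule.smul_mem _ _ hy
  · rw [show ζ k i x.1 = 0 from ζ_of_mem k i hp hx, zero_smul]
    exact zero_mem _

lemma ρ_naturality (i : Fin n) {V V' : Type u} [AddCommGroup V] [Module k V] [AddCommGroup V']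
    [Module k V'] (f : V →ₗ[k] V') (t : ideal k i ⊗[k] V) :
    ρ i V' (idTensor i f t) = f (ρ i V t) := by
  induction t using TensorProduct.induction_on with
  | zero => simp
  | tmul p v => rw [idTensor_tmul, ρ_tmul, ρ_tmul, map_smul]
  | add x y hx hy => simp only [map_add, hx, hy]

/-- The map from `e_i (A e_i ⊗ e_i M)` to `e_i M` given by `ρ`. -/
def cornerRho (i : Fin n) (r : ℤ) (M : GrProj k n) :
    corner i (bimodObj i r M) →ₗ[k] corner i M :=
  ρ i (corner i M) ∘ₗ (corner i (bimodObj i r M)).subtype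

/-- The map `e_i M ⟶ e_i (A e_i ⊗ e_i M)`, `x ↦ e_i ⊗ x`. -/
def cornerIncl (i : Fin n) (r : ℤ) (M : GrProj k n) :
    corner i M →ₗ[k] corner i (bimodObj i r M) where
  toFun x := ⟨idE k i ⊗ₜ[k] x, mem_corner.2 ((TensorProduct.smul_tmul' _ _ _).trans
    (congrArg (· ⊗ₜ[k] x) (smul_idE (idE k i))))⟩
  map_add' x y := Subtype.ext (TensorProduct.tmul_add _ x y)
  map_smul' c x := Subtype.ext (TensorProduct.tmul_smul c _ x)

/-- The map `e_i M ⟶ e_i (A e_i ⊗ e_i M)`, `x ↦ z_i ⊗ x`. -/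
def cornerLoop (i : Fin n) (r : ℤ) (M : GrProj k n) :
    corner i M →ₗ[k] corner i (bimodObj i r M) where
  toFun x := ⟨idZ k i ⊗ₜ[k] x, mem_corner.2 ((TensorProduct.smul_tmul' _ _ _).trans
    (congrArg (· ⊗ₜ[k] x) (Subtype.ext ((e_mul_loop k i i).trans (if_pos rfl)))))⟩
  map_add' x y := Subtype.ext (TensorProduct.tmul_add _ x y)
  map_smul' c x := Subtype.ext (TensorProduct.tmul_smul c _ x)

/-- The natural map `A e_i ⊗ e_i A e_i ⊗ e_i M ⟶ A e_i ⊗ e_i M` given by `ρ`. -/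
def rhoTrans (k : Type u) [Field k] {n : ℕ} (i : Fin n) {a b c : ℤ} (h : a + b = c + 2) :
    bimod (k := k) i a ⋙ bimod i b ⟶ bimod i c where
  app M := ofHom (M := bimodObj i b (bimodObj i a M)) (N := bimodObj i c M)
    (idTensor i (cornerRho i a M)) fun d t ht => idTensor_mem i (fun q x hx => by
      have := ρ_mem i (show x.1 ∈ tensorGrade (idealGrade k i) (cornerGrade i M) a q from hx)
      rwa [show q + a - 2 = q + c - b by omega] at this) ht
  naturality M N f := hom_ext fun t => LinearMap.congr_fun (ideal_tensor_ext
    (f := idTensor i (cornerRho i a N) ∘ₗ idTensor i (cornerMap i ((bimod i a).map f)))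
    (g := idTensor i (cornerMap i f) ∘ₗ idTensor i (cornerRho i a M)) fun v =>
      congrArg (idE k i ⊗ₜ[k] ·) (ρ_naturality i (cornerMap i f) v.1)) t

/-- The natural map `A e_i ⊗ e_i M ⟶ A e_i ⊗ e_i A e_i ⊗ e_i M`, `p ⊗ x ↦ p ⊗ e_i ⊗ x`. -/
def inclTrans (k : Type u) [Field k] {n : ℕ} (i : Fin n) {a b c : ℤ} (h : a + b = c) :
    bimod (k := k) i c ⟶ bimod i a ⋙ bimod i b where
  app M := ofHom (M := bimodObj i c M) (N := bimodObj i b (bimodObj i a M))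
    (idTensor i (cornerIncl i a M)) fun d t ht => idTensor_mem i (fun q x hx =>
      tmul_mem_tensorGrade (r := a) (p := 0) (q := q) (d := q + b - c)
        (show idE k i ∈ idealGrade k i 0 from e_mem_grade k i) hx (by omega)) ht
  naturality M N f := hom_ext fun t => LinearMap.congr_fun (ideal_tensor_ext
    (f := idTensor i (cornerIncl i a N) ∘ₗ idTensor i (cornerMap i f))
    (g := idTensor i (cornerMap i ((bimod i a).map f)) ∘ₗ idTensor i (cornerIncl i a M)) fun v =>
      rfl) t

/-- The edges in the formula for g_i end at a vertex j ≠ i and hence kill e_i M; only the two loop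
terms survive. -/
lemma coevalFun_of_mem_corner (i : Fin n) (M : GrProj k n) (x : corner i M) :
    coevalFun i M x.1 = idZ k i ⊗ₜ x +
      idE k i ⊗ₜ toCorner i M (arr k (.loop i) • x.1) := by
  rw [coevalFun_apply, toCorner_coe]
  have h : ∀ j c, edge k i j c • x.1 = 0 := fun j c => by
    rw [← mem_corner.1 x.2, ← mul_smul, edge_mul_e]
    split_ifs with h
    · subst h; rw [edge_self, zero_smul]
    · exact zero_smul _ _
  simp only [h, map_zero, TensorProduct.tmul_zero, Finset.sum_const_zero, add_zero]
  have h1 : toIdeal k i (arr k (.loop i)) = idZ k i := toIdeal_coe (idZ k i)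
  have h2 : toIdeal k i (e k i) = idE k i := toIdeal_coe (idE k i)
  rw [h1, h2]

lemma bimod_hom_ext {i : Fin n} {r : ℤ} {M N : GrProj k n} {f g : (bimod i r).obj M ⟶ N}
    (h : ∀ v : corner i M, lin f (idE k i ⊗ₜ[k] v) = lin g (idE k i ⊗ₜ[k] v)) : f = g :=
  hom_ext fun x => LinearMap.congr_fun (ideal_tensor_ext (f := lin f) (g := lin g) h) x

lemma cornerRho_coeval (i : Fin n) (M : GrProj k n) (v : corner i M) :
    cornerRho i 2 M (cornerMap i ((coevalTrans k i).app M) v) = v := by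
  change ρ i (corner i M) (coevalFun i M v.1) = v
  rw [coevalFun_of_mem_corner, map_add, ρ_tmul, ρ_tmul]
  change ζ k i (arr k (.loop i)) • v + ζ k i (e k i) • _ = v
  rw [ζ_loop, ζ_e, one_smul, zero_smul, add_zero]

lemma cornerRho_incl (i : Fin n) (r : ℤ) (M : GrProj k n) (v : corner i M) :
    cornerRho i r M (cornerIncl i r M v) = 0 := by
  change ρ i (corner i M) (idE k i ⊗ₜ v) = 0
  rw [ρ_tmul]
  change ζ k i (e k i) • _ = _
  rw [ζ_e, zero_smul]

lemma cornerRho_loop (i : Fin n) (r : ℤ) (M : GrProj k n) (v : corner i M) :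
    cornerRho i r M (cornerLoop i r M v) = v := by
  change ρ i (corner i M) (idZ k i ⊗ₜ v) = v
  rw [ρ_tmul]
  change ζ k i (arr k (.loop i)) • v = v
  rw [ζ_loop, one_smul]

/-- The map `f_i` on a module. -/
def ev (i : Fin n) (M : GrProj k n) : (bimod i 0).obj M ⟶ M := (evalTrans k i).app M

/-- The map `g_i` on a module. -/
def coev (i : Fin n) (M : GrProj k n) : M ⟶ (bimod i 2).obj M := (coevalTrans k i).app M

/-- The component of `rhoTrans` at a module. -/
def rhoHom (i : Fin n) {a b c : ℤ} (h : a + b = c + 2) (M : GrProj k n) :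
    (bimod i b).obj ((bimod i a).obj M) ⟶ (bimod i c).obj M := (rhoTrans k i h).app M

/-- The component of `inclTrans` at a module. -/
def inclHom (i : Fin n) {a b c : ℤ} (h : a + b = c) (M : GrProj k n) :
    (bimod i c).obj M ⟶ (bimod i b).obj ((bimod i a).obj M) := (inclTrans k i h).app M

lemma coev_cornerIncl (i : Fin n) (r : ℤ) (M : GrProj k n) (v : corner i M) :
    coevalFun i (bimodObj i r M) (cornerIncl i r M v).1 =
      idZ k i ⊗ₜ cornerIncl i r M v + idE k i ⊗ₜ cornerLoop i r M v := by
  rw [coevalFun_of_mem_corner]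
  congr 2
  refine Subtype.ext ?_
  change e k i • arr k (.loop i) • (idE k i ⊗ₜ[k] v) = idZ k i ⊗ₜ[k] v
  rw [← mul_smul, e_mul_loop, if_pos rfl, TensorProduct.smul_tmul', loop_smul_idE]

lemma cornerMap_ev_incl (i : Fin n) (M : GrProj k n) (v : corner i M) :
    cornerMap i (ev i M) (cornerIncl i 0 M v) = v := Subtype.ext v.2

lemma exists_eq_add {i : Fin n} {r : ℤ} {M : GrProj k n} (y : corner i (bimodObj i r M)) :
    ∃ x x' : corner i M, y = cornerIncl i r M x + cornerLoop i r M x' := by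
  obtain ⟨x, x', h⟩ := exists_of_mem_corner y.1 y.2
  exact ⟨x, x', Subtype.ext h⟩

/-! The identities that relate evaluation, coevaluation, `rhoTrans` and `inclTrans`. -/

lemma map_coev_rho (i : Fin n) (M : GrProj k n) :
    (bimod i 0).map (coev i M) ≫ rhoHom i (a := 2) (b := 0) (c := 0) rfl M = 𝟙 _ :=
  bimod_hom_ext fun v => congrArg (idE k i ⊗ₜ[k] ·) (cornerRho_coeval i M v)

lemma incl_rho (i : Fin n) {a b c d : ℤ} (h : a + b = c) (h' : a + b = d + 2) (M : GrProj k n) :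
    inclHom i h M ≫ rhoHom i h' M = 0 :=
  bimod_hom_ext fun v => Eq.trans (b := (idE k i ⊗ₜ[k] (0 : corner i M)))
    (congrArg (idE k i ⊗ₜ[k] ·) (cornerRho_incl i a M v)) (TensorProduct.tmul_zero _ _)

lemma incl_ev (i : Fin n) (M : GrProj k n) :
    inclHom i (a := 2) (b := 0) (c := 2) rfl M ≫ ev i ((bimod i 2).obj M) = 𝟙 _ :=
  bimod_hom_ext fun v => mem_corner.1 (cornerIncl i 2 M v).2

lemma incl_map_ev (i : Fin n) (M : GrProj k n) :
    inclHom i (a := 0) (b := 2) (c := 2) rfl M ≫ (bimod i 2).map (ev i M) = 𝟙 _ :=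
  bimod_hom_ext fun v => congrArg (idE k i ⊗ₜ[k] ·) (cornerMap_ev_incl i M v)

/-- Since e_i A e_i has the basis e_i, z_i, the module A e_i ⊗ e_i A e_i ⊗ e_i M is a sum of two
copies of A e_i ⊗ e_i M. The map ρ reads the z_i-coordinate, and `coev` embeds it back up to an
e_i-term; the second summand recovers the e_i-coordinate and cancels that term. -/
lemma rho_add_incl (i : Fin n) (M : GrProj k n) :
    rhoHom i (a := 2) (b := 0) (c := 0) rfl M ≫ (bimod i 0).map (coev i M) +
      (ev i ((bimod i 2).obj M) - rhoHom i (a := 2) (b := 0) (c := 0) rfl M ≫ ev i M ≫ coev i M) ≫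
        inclHom i (a := 2) (b := 0) (c := 2) rfl M = 𝟙 _ := by
  refine bimod_hom_ext (M := (bimod i 2).obj M) fun (y : corner i (bimodObj i 2 M)) => ?_
  let ε : ideal k i ⊗[k] corner i (bimodObj i 2 M) →ₗ[Zigzag k n] ideal k i ⊗[k] corner i M :=
    evalLin i (bimodObj i 2 M)
  let κ : corner i M →ₗ[k] corner i (bimodObj i 2 M) := cornerMap i (coev i M)
  have h1 : ε (idE k i ⊗ₜ[k] y) = y.1 := mem_corner.1 y.2
  have h2 (v : corner i M) : evalLin i M (idE k i ⊗ₜ[k] v) = v.1 := mem_corner.1 v.2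
  have h3 (v : corner i M) : κ v = cornerLoop i 2 M v +
      cornerIncl i 2 M (toCorner i M (arr k (.loop i) • v.1)) :=
    Subtype.ext (coevalFun_of_mem_corner i M v)
  change idE k i ⊗ₜ[k] κ (cornerRho i 2 M y) +
    idTensor i (cornerIncl i 2 M) (ε (idE k i ⊗ₜ[k] y) -
      coevalFun i M (evalLin i M (idE k i ⊗ₜ[k] cornerRho i 2 M y))) = idE k i ⊗ₜ[k] y
  rw [h1, h2, coevalFun_of_mem_corner, h3]
  obtain ⟨x, x', rfl⟩ := exists_eq_add y
  rw [map_add, cornerRho_incl, cornerRho_loop, zero_add]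
  change _ + idTensor i (cornerIncl i 2 M) (idE k i ⊗ₜ[k] x + idZ k i ⊗ₜ[k] x' - _) = _
  simp only [map_sub, map_add, idTensor_tmul, TensorProduct.tmul_add]
  abel

lemma coev_rho (i : Fin n) (M : GrProj k n) :
    coev i ((bimod i 0).obj M) ≫ rhoHom i (a := 0) (b := 2) (c := 0) rfl M = 𝟙 _ := by
  refine bimod_hom_ext fun v => ?_
  change idTensor i (cornerRho i 0 M) (coevalFun i (bimodObj i 0 M) (cornerIncl i 0 M v).1) =
    idE k i ⊗ₜ[k] v
  rw [coev_cornerIncl, map_add, idTensor_tmul, idTensor_tmul, cornerRho_incl, cornerRho_loop,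
    TensorProduct.tmul_zero, zero_add]

/-- The same splitting of A e_i ⊗ e_i A e_i ⊗ e_i M, now with `incl` as a section of the evaluation;
the term subtracted from `coev` makes it land in the kernel of the evaluation. -/
lemma rho_add_incl' (i : Fin n) (M : GrProj k n) :
    rhoHom i (a := 0) (b := 2) (c := 0) rfl M ≫ (coev i ((bimod i 0).obj M) -
        ev i M ≫ coev i M ≫ inclHom i (a := 0) (b := 2) (c := 2) rfl M) +
      (bimod i 2).map (ev i M) ≫ inclHom i (a := 0) (b := 2) (c := 2) rfl M = 𝟙 _ := by
  refine bimod_hom_ext (M := (bimod i 0).obj M) fun (y : corner i (bimodObj i 0 M)) => ?_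
  have h2 (v : corner i M) : evalLin i M (idE k i ⊗ₜ[k] v) = v.1 := mem_corner.1 v.2
  let κ : corner i (bimodObj i 0 M) →ₗ[k] corner i M := cornerMap i (ev i M)
  have h3 (v : corner i M) : κ (cornerIncl i 0 M v) = v := cornerMap_ev_incl i M v
  have h4 (v : corner i M) : κ (cornerLoop i 0 M v) = toCorner i M (arr k (.loop i) • v.1) :=
    Subtype.ext (e_smul_loop_smul i v.1).symm
  change (coevalFun i (bimodObj i 0 M) (cornerIncl i 0 M (cornerRho i 0 M y)).1 -
      idTensor i (cornerIncl i 0 M) (coevalFun i M (evalLin i M (idE k i ⊗ₜ[k] cornerRho i 0 M y)))) +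
    idE k i ⊗ₜ[k] cornerIncl i 0 M (κ y) = idE k i ⊗ₜ[k] y
  rw [h2, coev_cornerIncl, coevalFun_of_mem_corner]
  obtain ⟨x, x', rfl⟩ := exists_eq_add y
  simp only [map_add, cornerRho_incl, cornerRho_loop, zero_add, h3, h4, idTensor_tmul, TensorProduct.tmul_add]
  abel

/-! ### The functors `T` on the images of the bimodules -/

/-- A e_i ⊗ V is a sum of copies of P_i, and z_l A e_i = 0 for l ≠ i because z_l A = k z_l. -/
lemma T_isZero_bimod {i l : Fin n} (h : l ≠ i) (d r : ℤ) (M : GrProj k n) (x)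
    (hx : x ∈ zSub l d ((bimod i r).obj M)) : x = 0 := by
  obtain ⟨y, -, rfl⟩ := hx
  have h' (p : ideal k i) : arr k (.loop l) • p = 0 := by
    refine Subtype.ext ?_
    obtain ⟨c, hc⟩ := exists_loop_mul k l p.1
    change _ * _ = (0 : Zigzag k n)
    rw [← mem_ideal.1 p.2, ← mul_assoc, hc, smul_mul_assoc, loop_mul_e, if_neg h, smul_zero]
  change arr k (.loop l) • (show ideal k i ⊗[k] corner i M from y) = 0
  generalize (show ideal k i ⊗[k] corner i M from y) = y
  induction y using TensorProduct.induction_on with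
  | zero => exact smul_zero _
  | tmul p v => rw [TensorProduct.smul_tmul', h', TensorProduct.zero_tmul]
  | add x y hx hy => rw [smul_add, hx, hy, add_zero]

variable (k) in
/-- The map `e_i M ⟶ z_i (A e_i ⊗ e_i M)`, `x ↦ z_i ⊗ x`. -/
def eToTBimod (i : Fin n) (d : ℤ) : E k i d ⟶ bimod i 0 ⋙ T k i d where
  app M := ModuleCat.ofHom
    { toFun := fun x => (⟨idZ k i ⊗ₜ[k] ⟨x.1, x.2.1⟩, idE k i ⊗ₜ[k] ⟨x.1, x.2.1⟩,
        ⟨(cornerIncl i 0 M ⟨x.1, x.2.1⟩).2,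
          tmul_mem_tensorGrade (p := 0) (q := d) (e_mem_grade k i) x.2.2 (by omega)⟩,
        (TensorProduct.smul_tmul' _ _ _).trans
          (congrArg (· ⊗ₜ[k] _) (loop_smul_idE i))⟩ : zSub i d ((bimod i 0).obj M))
      map_add' := fun x y => Subtype.ext (TensorProduct.tmul_add (idZ k i)
        (⟨x.1, x.2.1⟩ : corner i M) ⟨y.1, y.2.1⟩)
      map_smul' := fun c x => Subtype.ext (TensorProduct.tmul_smul c (idZ k i)
        (⟨x.1, x.2.1⟩ : corner i M)) }
  naturality M N f := rfl

instance (i : Fin n) (d : ℤ) : IsIso (eToTBimod k i d) := by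
  rw [NatTrans.isIso_iff_isIso_app]
  intro M
  rw [ConcreteCategory.isIso_iff_bijective]
  constructor
  · rw [injective_iff_map_eq_zero]
    intro x hx
    have h : idZ k i ⊗ₜ[k] (⟨x.1, x.2.1⟩ : corner i M) = 0 := congrArg Subtype.val hx
    have h' := congrArg (ρ i (corner i M)) h
    rw [ρ_tmul, map_zero] at h'
    change ζ k i (arr k (.loop i)) • _ = _ at h'
    rw [ζ_loop, one_smul] at h'
    exact Subtype.ext (congrArg (fun v : corner i M => v.1) h')
  · rintro ⟨_, y, hy, rfl⟩
    suffices h : ∀ y ∈ tensorGrade (idealGrade k i) (cornerGrade i M) 0 d,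
        ∃ x : corner i M, x.1 ∈ M.gr d ∧ idZ k i ⊗ₜ[k] x = arr k (.loop i) • y by
      obtain ⟨x, hx, h⟩ := h y hy.2
      exact ⟨⟨x.1, x.2, hx⟩, Subtype.ext h⟩
    intro y hy
    induction hy using Submodule.span_induction with
    | mem y h =>
      obtain ⟨p, q, hpq, a, ha, x, hx, rfl⟩ := h
      rw [TensorProduct.smul_tmul']
      -- Multiplication by z_i kills all components of non-zero degree, and in degree zero it sees
      -- only the coefficient of e_i.
      by_cases hp : p = 0
      · obtain ⟨c, hc⟩ := exists_loop_mul k i a.1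
        refine ⟨c • x, Submodule.smul_mem _ c ?_, ?_⟩
        · rw [show d = q by omega]; exact hx
        · rw [show arr k (.loop i) • a = c • idZ k i from Subtype.ext hc, TensorProduct.smul_tmul]
      · refine ⟨0, zero_mem _, ?_⟩
        rw [show arr k (.loop i) • a = 0 from Subtype.ext (loop_mul_of_mem k i hp ha),
          TensorProduct.zero_tmul, TensorProduct.tmul_zero]
    | zero => exact ⟨0, zero_mem _, by simp⟩
    | add x y _ _ hx hy =>
      obtain ⟨a, ha, h⟩ := hx
      obtain ⟨b, hb, h'⟩ := hy
      exact ⟨a + b, add_mem ha hb, by rw [TensorProduct.tmul_add, h, h', smul_add]⟩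
    | smul c x _ hx =>
      obtain ⟨a, ha, h⟩ := hx
      exact ⟨c • a, Submodule.smul_mem _ _ ha, by rw [TensorProduct.tmul_smul, h, smul_comm]⟩

/-- After the identification of z_i (A e_i ⊗ e_i M) with e_i M, the map f_i becomes multiplication
by z_i. This is what makes Σ_i⁻¹ computable on multiplicities. -/
lemma eToTBimod_eval (i : Fin n) (d : ℤ) :
    eToTBimod k i d ≫ Functor.whiskerRight (evalTrans k i) (T k i d) = eToT k i d := by
  ext M x
  rfl

/-- z_i A e_j is spanned by z_i if i = j and vanishes otherwise, so z_i M_d counts the generators of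
M at the vertex i in degree d. -/
lemma finrank_zSub_P (i j : Fin n) (r d : ℤ) :
    Module.finrank k (zSub i d (P k j r)) = if i = j ∧ d + r = 0 then 1 else 0 := by
  split_ifs with h
  · obtain ⟨rfl, h⟩ := h
    have hz : idZ k i ∈ zSub i d (P k i r) := ⟨idE k i, ⟨mem_corner.2 (smul_idE (idE k i)), by
      change e k i ∈ grade k n (d + r)
      rw [h]
      exact e_mem_grade k i⟩, loop_smul_idE i⟩
    refine finrank_eq_one (⟨idZ k i, hz⟩ : zSub i d (P k i r)) ?_ ?_
    · intro h0
      exact loop_ne_zero k i (congrArg (fun x => x.1.1) h0)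
    · rintro ⟨_, y, hy, rfl⟩
      obtain ⟨c, hc⟩ := exists_loop_mul k i (show ideal k i from y).1
      exact ⟨c, Subtype.ext (Subtype.ext hc.symm)⟩
  · have : zSub i d (P k j r) = ⊥ := by
      rw [eq_bot_iff]
      rintro _ ⟨y, hy, rfl⟩
      refine Subtype.ext ?_
      change arr k (.loop i) * (show ideal k j from y).1 = 0
      by_cases hd : d + r = 0
      · obtain ⟨c, hc⟩ := exists_loop_mul k i (show ideal k j from y).1
        rw [← mem_ideal.1 (show ideal k j from y).2, ← mul_assoc, hc, smul_mul_assoc, loop_mul_e,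
          if_neg (by tauto), smul_zero]
      · exact loop_mul_of_mem k i hd hy.2
    rw [this, finrank_bot]

end GrProj

/-! ### Triangles defined by cones of natural transformations -/

section Cones

open Pretriangulated

/-! ### Compatibility of induced transformations with shifts -/

section

variable {C C' : Type*} [Category* C] [Preadditive C] [Category* C'] [Preadditive C']
  {F G : C ⥤ C'} [F.Additive] [G.Additive] (τ : F ⟶ G)

instance : NatTrans.CommShift (NatTrans.mapHomologicalComplex τ (.up ℤ)) ℤ where
  shift_comm a := by
    ext K i
    exact (Category.id_comp _).trans (Category.comp_id _).symm

lemma commShift_whiskerLeft_quotient : NatTrans.CommShift (Functor.whiskerLeft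
    (HomotopyCategory.quotient C (.up ℤ)) (NatTrans.mapHomotopyCategory τ (.up ℤ))) ℤ := by
  have h : Functor.whiskerLeft (HomotopyCategory.quotient C (.up ℤ))
      (NatTrans.mapHomotopyCategory τ (.up ℤ)) =
      (F.mapHomotopyCategoryFactors (.up ℤ)).hom ≫
        Functor.whiskerRight (NatTrans.mapHomologicalComplex τ (.up ℤ))
          (HomotopyCategory.quotient C' (.up ℤ)) ≫ (G.mapHomotopyCategoryFactors (.up ℤ)).inv := by
    ext K
    exact ((Category.id_comp _).trans (Category.comp_id _)).symm
  rw [h]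
  infer_instance

instance : NatTrans.CommShift (NatTrans.mapHomotopyCategory τ (.up ℤ)) ℤ where
  shift_comm a := by
    ext X
    obtain ⟨K, rfl⟩ := HomotopyCategory.quotient_obj_surjective X
    have := commShift_whiskerLeft_quotient τ
    have h := NatTrans.shift_app_comm (Functor.whiskerLeft (HomotopyCategory.quotient C (.up ℤ))
      (NatTrans.mapHomotopyCategory τ (.up ℤ))) a K
    rw [Functor.commShiftIso_comp_hom_app, Functor.commShiftIso_comp_hom_app] at h
    dsimp only [Functor.whiskerLeft_app, Functor.comp_obj, NatTrans.comp_app,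
      Functor.whiskerRight_app] at h ⊢
    rw [← NatTrans.naturality_assoc, Category.assoc] at h
    exact (cancel_epi _).1 h

end

/-! ### Split triangles, signs and shifts in a pretriangulated category -/

section

variable {𝒯 : Type*} [Category* 𝒯] [HasZeroObject 𝒯] [HasShift 𝒯 ℤ] [Preadditive 𝒯]
  [∀ n : ℤ, (shiftFunctor 𝒯 n).Additive] [Pretriangulated 𝒯]

/-- If the first map of a distinguished triangle is a split monomorphism, then the third object is
its complement. -/
lemma isIso_of_split_mono {T : Triangle 𝒯} (hT : T ∈ distTriang 𝒯) {Q : 𝒯} (s : Q ⟶ T.obj₂)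
    (r : T.obj₂ ⟶ T.obj₁) (q : T.obj₂ ⟶ Q) (hr : T.mor₁ ≫ r = 𝟙 _) (hsq : s ≫ q = 𝟙 _)
    (hq : T.mor₁ ≫ q = 0) (h : r ≫ T.mor₁ + q ≫ s = 𝟙 _) :
    IsIso (s ≫ T.mor₂) := by
  obtain ⟨q', hq'⟩ := Triangle.yoneda_exact₂ T hT q hq
  have h3 : T.mor₃ = 0 := by
    have := comp_distTriang_mor_zero₃₁ T hT
    rw [← Category.comp_id T.mor₃, ← CategoryTheory.Functor.map_id, ← hr, Functor.map_comp,
      reassoc_of% this, zero_comp]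
  have h2 : q' ≫ s ≫ T.mor₂ = 𝟙 _ := by
    rw [← sub_eq_zero]
    obtain ⟨t, ht⟩ := Triangle.yoneda_exact₃ T hT (q' ≫ s ≫ T.mor₂ - 𝟙 _) (by
      have h' : q ≫ s = 𝟙 _ - r ≫ T.mor₁ := by rw [← h]; abel
      rw [Preadditive.comp_sub, ← reassoc_of% hq', reassoc_of% h', Category.comp_id,
        Preadditive.sub_comp, Category.id_comp, Category.assoc, comp_distTriang_mor_zero₁₂ T hT]
      simp)
    rw [ht, h3, zero_comp]
  exact ⟨q', by rw [Category.assoc, ← hq', hsq], h2⟩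

/-- If the first map of a distinguished triangle is a split epimorphism, then the third object is
the shift of its kernel. -/
lemma isIso_of_split_epi {T : Triangle 𝒯} (hT : T ∈ distTriang 𝒯) {Q : 𝒯} (j : Q ⟶ T.obj₁)
    (r : T.obj₁ ⟶ Q) (s : T.obj₂ ⟶ T.obj₁) (hr : j ≫ r = 𝟙 _) (hs : s ≫ T.mor₁ = 𝟙 _)
    (hj : j ≫ T.mor₁ = 0) (h : r ≫ j + T.mor₁ ≫ s = 𝟙 _) :
    IsIso (T.mor₃ ≫ r⟦(1 : ℤ)⟧') := by
  have h31 := comp_distTriang_mor_zero₃₁ T hT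
  obtain ⟨t, ht⟩ := Triangle.coyoneda_exact₁ T hT (j⟦(1 : ℤ)⟧') (by
    rw [← Functor.map_comp, hj, Functor.map_zero])
  have h2 : T.mor₂ = 0 := by
    rw [← Category.id_comp T.mor₂, ← hs, Category.assoc, comp_distTriang_mor_zero₁₂ T hT, comp_zero]
  refine ⟨t, ?_, ?_⟩
  · rw [← sub_eq_zero]
    obtain ⟨t', ht'⟩ := Triangle.coyoneda_exact₃ T hT ((T.mor₃ ≫ r⟦(1 : ℤ)⟧') ≫ t - 𝟙 _) (by
      have h' : r ≫ j = 𝟙 _ - T.mor₁ ≫ s := by rw [← h]; abel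
      rw [Preadditive.sub_comp, Category.assoc, Category.assoc, ← ht, ← Functor.map_comp, h',
        Functor.map_sub, CategoryTheory.Functor.map_id, Functor.map_comp, Preadditive.comp_sub, reassoc_of% h31]
      simp)
    rw [ht', h2, comp_zero]
  · rw [← Category.assoc, ← ht, ← Functor.map_comp, hr, CategoryTheory.Functor.map_id]

/-- Here `e` is a retraction of `s` that need not kill `f`; subtracting `r ≫ t` corrects it to a
projection onto the complement. -/
lemma isIso_of_split_mono' {A B C Q : 𝒯} {f : A ⟶ B} {g : B ⟶ C} {h : C ⟶ A⟦(1 : ℤ)⟧}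
    (hT : Triangle.mk f g h ∈ distTriang 𝒯) {s : Q ⟶ B} {r : B ⟶ A} {e : B ⟶ Q} {t : A ⟶ Q}
    (hr : f ≫ r = 𝟙 A) (hse : s ≫ e = 𝟙 Q) (hsr : s ≫ r = 0) (he : f ≫ e = t)
    (hs : r ≫ f + (e - r ≫ t) ≫ s = 𝟙 B) : IsIso (s ≫ g) :=
  isIso_of_split_mono hT s r (e - r ≫ t) hr
    (by
      change s ≫ (e - r ≫ t) = 𝟙 Q
      rw [Preadditive.comp_sub, reassoc_of% hsr, zero_comp, sub_zero, hse])
    (by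
      change f ≫ (e - r ≫ t) = 0
      rw [Preadditive.comp_sub, reassoc_of% hr, he, sub_self]) hs

/-- Dually, `c` need not land in the kernel of `f`, and subtracting `t ≫ s` corrects this. -/
lemma isIso_of_split_epi' {A B C Q : 𝒯} {f : A ⟶ B} {g : B ⟶ C} {h : C ⟶ A⟦(1 : ℤ)⟧}
    (hT : Triangle.mk f g h ∈ distTriang 𝒯) {c : Q ⟶ A} {r : A ⟶ Q} {s : B ⟶ A} {t : Q ⟶ B}
    (hr : c ≫ r = 𝟙 Q) (hsr : s ≫ r = 0) (hs : s ≫ f = 𝟙 B) (hc : c ≫ f = t)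
    (hsum : r ≫ (c - t ≫ s) + f ≫ s = 𝟙 A) : IsIso (h ≫ r⟦(1 : ℤ)⟧') :=
  isIso_of_split_epi hT (c - t ≫ s) r s
    (by
      change (c - t ≫ s) ≫ r = 𝟙 Q
      rw [Preadditive.sub_comp, Category.assoc, hsr, comp_zero, sub_zero, hr]) hs
    (by
      change (c - t ≫ s) ≫ f = 0
      rw [Preadditive.sub_comp, Category.assoc, hs, Category.comp_id, hc, sub_self]) hsum

lemma distinguished_of_neg {A B C : 𝒯} (f : A ⟶ B) (g : B ⟶ C) (h : C ⟶ A⟦(1 : ℤ)⟧)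
    (hT : Triangle.mk (-f) g h ∈ distTriang 𝒯) : Triangle.mk f (-g) h ∈ distTriang 𝒯 :=
  isomorphic_distinguished _ hT _
    (Triangle.isoMk _ _ (Iso.refl A) (-Iso.refl B) (Iso.refl C)
      (by change f ≫ (-𝟙 B) = 𝟙 A ≫ (-f); simp) (by change (-g) ≫ 𝟙 C = (-𝟙 B) ≫ g; simp)
      (by change h ≫ (shiftFunctor 𝒯 (1 : ℤ)).map (𝟙 A) = 𝟙 C ≫ h; simp))

/-- A shift of a distinguished triangle is distinguished, up to signs. -/
lemma exists_shift_distinguished {T : Triangle 𝒯} (hT : T ∈ distTriang 𝒯) (n : ℤ) :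
    ∃ (g : T.obj₂⟦n⟧ ⟶ T.obj₃⟦n⟧) (h : T.obj₃⟦n⟧ ⟶ T.obj₁⟦n⟧⟦(1 : ℤ)⟧),
      Triangle.mk (T.mor₁⟦n⟧') g h ∈ distTriang 𝒯 := by
  obtain ⟨g, h, h1⟩ : ∃ (g : T.obj₂⟦n⟧ ⟶ T.obj₃⟦n⟧) (h : T.obj₃⟦n⟧ ⟶ T.obj₁⟦n⟧⟦(1 : ℤ)⟧),
      Triangle.mk (n.negOnePow • T.mor₁⟦n⟧') g h ∈ distTriang 𝒯 :=
    ⟨_, _, Triangle.shift_distinguished T hT n⟩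
  obtain hn | hn := Int.units_eq_one_or n.negOnePow
  · rw [hn, one_smul] at h1
    exact ⟨_, _, h1⟩
  · rw [hn, Units.neg_smul, one_smul] at h1
    exact ⟨_, _, distinguished_of_neg _ _ _ h1⟩

end

/-! ### Cones of transformations on the homotopy category -/

section

variable {C : Type*} [Category* C] [Preadditive C] [HasZeroObject C] [HasBinaryBiproducts C]
  {F G : C ⥤ C} [F.Additive] [G.Additive] (τ : F ⟶ G)

/-- The functor on the homotopy category induced by an additive functor. -/
abbrev onHo (F : C ⥤ C) [F.Additive] : HomotopyCategory C (.up ℤ) ⥤ HomotopyCategory C (.up ℤ) :=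
  F.mapHomotopyCategory (.up ℤ)

/-- The natural transformation on the homotopy category induced by a natural transformation. -/
abbrev transHo : onHo F ⟶ onHo G := NatTrans.mapHomotopyCategory τ (.up ℤ)

lemma exists_cone_triangle (X : HomotopyCategory C (.up ℤ)) :
    ∃ (i : (onHo G).obj X ⟶ (coneHomotopy τ).obj X)
      (j : (coneHomotopy τ).obj X ⟶ ((onHo F).obj X)⟦(1 : ℤ)⟧),
      Triangle.mk ((transHo τ).app X) i j ∈ distTriang (HomotopyCategory C (.up ℤ)) := by
  obtain ⟨K, rfl⟩ := HomotopyCategory.quotient_obj_surjective X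
  exact ⟨_, _, HomotopyCategory.mappingCone_triangleh_distinguished
    ((NatTrans.mapHomologicalComplex τ (.up ℤ)).app K)⟩

/-- Both objects complete isomorphic first maps to distinguished triangles. An isomorphism for each
object is enough later, so naturality is not pursued. -/
lemma coneHomotopy_shift (X : HomotopyCategory C (.up ℤ)) (n : ℤ) :
    Nonempty ((coneHomotopy τ).obj (X⟦n⟧) ≅ ((coneHomotopy τ).obj X)⟦n⟧) := by
  obtain ⟨i, j, h⟩ := exists_cone_triangle τ X
  obtain ⟨i', j', h'⟩ := exists_cone_triangle τ (X⟦n⟧)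
  obtain ⟨_, _, h''⟩ := exists_shift_distinguished h n
  exact ⟨Triangle.π₃.mapIso (isoTriangleOfIso₁₂ _ _ h' h'' (((onHo F).commShiftIso n).app X)
    (((onHo G).commShiftIso n).app X) (NatTrans.shift_app_comm (transHo τ) n X).symm)⟩

end

end Cones

/-! ### The functors `Σ_i` and `Σ_i⁻¹` are inverse to each other on objects -/

section Inverse

open Pretriangulated GrProj

variable {k : Type u} [Field k] {n : ℕ}

/-- The homotopy category of complexes of graded projective modules. -/
abbrev Ho (k : Type u) [Field k] (n : ℕ) := HomotopyCategory (GrProj k n) (.up ℤ)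

/-- The functor `(A e_i ⊗ e_i A)⟨r⟩ ⊗_A -` on the homotopy category. -/
abbrev bimodHo (i : Fin n) (r : ℤ) : Ho k n ⥤ Ho k n := onHo (bimod i r)

/-- The map `f_i` on the homotopy category. -/
def evHo (i : Fin n) (X : Ho k n) : (bimodHo i 0).obj X ⟶ X := (transHo (evalTrans k i)).app X

/-- The map `g_i` on the homotopy category. -/
def coevHo (i : Fin n) (X : Ho k n) : X ⟶ (bimodHo i 2).obj X := (transHo (coevalTrans k i)).app X

/-- The map `rhoTrans` on the homotopy category. -/
def rhoHo (i : Fin n) {a b c : ℤ} (h : a + b = c + 2) (X : Ho k n) :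
    (bimodHo i b).obj ((bimodHo i a).obj X) ⟶ (bimodHo i c).obj X := (transHo (rhoTrans k i h)).app X

/-- The map `inclTrans` on the homotopy category. -/
def inclHo (i : Fin n) {a b c : ℤ} (h : a + b = c) (X : Ho k n) :
    (bimodHo i c).obj X ⟶ (bimodHo i b).obj ((bimodHo i a).obj X) := (transHo (inclTrans k i h)).app X

lemma evHo_naturality (i : Fin n) {X Y : Ho k n} (f : X ⟶ Y) :
    (bimodHo i 0).map f ≫ evHo i Y = evHo i X ≫ f := by
  obtain ⟨f, rfl⟩ := (HomotopyCategory.quotient _ _).map_surjective f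
  exact (transHo (evalTrans k i)).naturality (X := X) (Y := Y)
    ((HomotopyCategory.quotient _ _).map f)

lemma coevHo_naturality (i : Fin n) {X Y : Ho k n} (f : X ⟶ Y) :
    f ≫ coevHo i Y = coevHo i X ≫ (bimodHo i 2).map f := by
  obtain ⟨f, rfl⟩ := (HomotopyCategory.quotient _ _).map_surjective f
  exact (transHo (coevalTrans k i)).naturality (X := X) (Y := Y)
    ((HomotopyCategory.quotient _ _).map f)

lemma map_coevHo_rho (i : Fin n) (X : Ho k n) :
    (bimodHo i 0).map (coevHo i X) ≫ rhoHo i (a := 2) (b := 0) (c := 0) rfl X = 𝟙 _ := by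
  refine congrArg (HomotopyCategory.quotient _ _).map (a₂ := 𝟙 _) ?_
  ext m : 1
  exact map_coev_rho i (X.as.X m)

lemma incl_evHo (i : Fin n) (X : Ho k n) :
    inclHo i (a := 2) (b := 0) (c := 2) rfl X ≫ evHo i ((bimodHo i 2).obj X) = 𝟙 _ := by
  refine congrArg (HomotopyCategory.quotient _ _).map (a₂ := 𝟙 _) ?_
  ext m : 1
  exact incl_ev i (X.as.X m)

lemma incl_map_evHo (i : Fin n) (X : Ho k n) :
    inclHo i (a := 0) (b := 2) (c := 2) rfl X ≫ (bimodHo i 2).map (evHo i X) = 𝟙 _ := by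
  refine congrArg (HomotopyCategory.quotient _ _).map (a₂ := 𝟙 _) ?_
  ext m : 1
  exact incl_map_ev i (X.as.X m)

lemma incl_rhoHo (i : Fin n) {a b c d : ℤ} (h : a + b = c) (h' : a + b = d + 2) (X : Ho k n) :
    inclHo i h X ≫ rhoHo i h' X = 0 := by
  refine congrArg (HomotopyCategory.quotient _ _).map (a₂ := 0) ?_
  ext m : 1
  exact incl_rho i h h' (X.as.X m)

lemma coevHo_rho (i : Fin n) (X : Ho k n) :
    coevHo i ((bimodHo i 0).obj X) ≫ rhoHo i (a := 0) (b := 2) (c := 0) rfl X = 𝟙 _ := by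
  refine congrArg (HomotopyCategory.quotient _ _).map (a₂ := 𝟙 _) ?_
  ext m : 1
  exact coev_rho i (X.as.X m)

lemma rhoHo_add_incl (i : Fin n) (X : Ho k n) :
    rhoHo i (a := 2) (b := 0) (c := 0) rfl X ≫ (bimodHo i 0).map (coevHo i X) +
      (evHo i ((bimodHo i 2).obj X) -
        rhoHo i (a := 2) (b := 0) (c := 0) rfl X ≫ evHo i X ≫ coevHo i X) ≫
        inclHo i (a := 2) (b := 0) (c := 2) rfl X = 𝟙 _ := by
  refine congrArg (HomotopyCategory.quotient _ _).map (a₂ := 𝟙 _) ?_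
  ext m : 1
  exact rho_add_incl i (X.as.X m)

lemma rhoHo_add_incl' (i : Fin n) (X : Ho k n) :
    rhoHo i (a := 0) (b := 2) (c := 0) rfl X ≫ (coevHo i ((bimodHo i 0).obj X) -
        (evHo i X ≫ coevHo i X) ≫ inclHo i (a := 0) (b := 2) (c := 2) rfl X) +
      (bimodHo i 2).map (evHo i X) ≫ inclHo i (a := 0) (b := 2) (c := 2) rfl X = 𝟙 _ := by
  rw [Category.assoc]
  refine congrArg (HomotopyCategory.quotient _ _).map (a₂ := 𝟙 _) ?_
  ext m : 1
  exact rho_add_incl' i (X.as.X m)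

lemma exists_evHo_triangle (i : Fin n) (X : Ho k n) :
    ∃ (a : X ⟶ (coneHomotopy (evalTrans k i)).obj X)
      (b : (coneHomotopy (evalTrans k i)).obj X ⟶ ((bimodHo i 0).obj X)⟦(1 : ℤ)⟧),
      Triangle.mk (evHo i X) a b ∈ distTriang (Ho k n) := exists_cone_triangle (evalTrans k i) X

lemma exists_coevHo_triangle (i : Fin n) (X : Ho k n) :
    ∃ (a : (bimodHo i 2).obj X ⟶ (coneHomotopy (coevalTrans k i)).obj X)
      (b : (coneHomotopy (coevalTrans k i)).obj X ⟶ X⟦(1 : ℤ)⟧),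
      Triangle.mk (coevHo i X) a b ∈ distTriang (Ho k n) := exists_cone_triangle (coevalTrans k i) X

/-- Applying A e_i ⊗ e_i A ⊗ - to the triangle X → (A e_i ⊗ e_i A)⟨2⟩ ⊗ X → W makes its first map a
split monomorphism with retraction ρ. Its complement, reached by `inclHo`, is therefore the third
object. -/
lemma isIso_incl_map (i : Fin n) {X W : Ho k n} {a : (bimodHo i 2).obj X ⟶ W} {b : W ⟶ X⟦(1 : ℤ)⟧}
    (h : Triangle.mk (coevHo i X) a b ∈ distTriang (Ho k n)) :
    IsIso (inclHo i (a := 2) (b := 0) (c := 2) rfl X ≫ (bimodHo i 0).map a) :=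
  isIso_of_split_mono' ((bimodHo i 0).map_distinguished _ h) (map_coevHo_rho i X) (incl_evHo i X)
    (incl_rhoHo i _ _ X) (evHo_naturality i _) (rhoHo_add_incl i X)

/-- Applying (A e_i ⊗ e_i A)⟨2⟩ ⊗ - to the triangle of f_i makes the first map a split epimorphism,
so the third object is the shift of its kernel, read off by ρ. -/
lemma isIso_map_rho (i : Fin n) {X U : Ho k n} {a : X ⟶ U} {b : U ⟶ ((bimodHo i 0).obj X)⟦(1 : ℤ)⟧}
    (h : Triangle.mk (evHo i X) a b ∈ distTriang (Ho k n)) :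
    IsIso (((bimodHo i 2).map b ≫ ((bimodHo i 2).commShiftIso (1 : ℤ)).hom.app _) ≫
      (rhoHo i (a := 0) (b := 2) (c := 0) rfl X)⟦(1 : ℤ)⟧') :=
  isIso_of_split_epi' ((bimodHo i 2).map_distinguished _ h) (coevHo_rho i X) (incl_rhoHo i _ _ X)
    (incl_map_evHo i X) (coevHo_naturality i _).symm (rhoHo_add_incl' i X)

/-- The comparison of `g_i` on a shift with the shift of `g_i`. -/
lemma exists_coevHo_shift (i : Fin n) (X : Ho k n) : ∃ c : X⟦(1 : ℤ)⟧ ≅ X⟦(1 : ℤ)⟧,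
    coevHo i (X⟦(1 : ℤ)⟧) ≫ ((bimodHo i 2).commShiftIso (1 : ℤ)).hom.app X =
      c.hom ≫ (coevHo i X)⟦(1 : ℤ)⟧' :=
  ⟨((onHo (𝟭 (GrProj k n))).commShiftIso (1 : ℤ)).app X,
    (NatTrans.shift_app_comm (transHo (coevalTrans k i)) (1 : ℤ) X).symm⟩

/-- Let W be the cone of g_i. Under the isomorphism of `isIso_incl_map`, the evaluation at W becomes
the second map of the triangle X → (A e_i ⊗ e_i A)⟨2⟩ ⊗ X → W, whose cone is X[1] by rotation. -/
lemma cone_ev_cone_coev (i : Fin n) (X : Ho k n) :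
    Nonempty ((coneHomotopy (evalTrans k i)).obj ((coneHomotopy (coevalTrans k i)).obj X) ≅
      X⟦(1 : ℤ)⟧) := by
  obtain ⟨a, b, h⟩ := exists_coevHo_triangle i X
  obtain ⟨a', b', h'⟩ := exists_evHo_triangle i ((coneHomotopy (coevalTrans k i)).obj X)
  have := isIso_incl_map i h
  have hs : (inclHo i (a := 2) (b := 0) (c := 2) rfl X ≫ (bimodHo i 0).map a) ≫ evHo i _ = a := by
    rw [Category.assoc, evHo_naturality, ← Category.assoc, incl_evHo, Category.id_comp]
  exact ⟨Triangle.π₃.mapIso (isoTriangleOfIso₁₂ _ _ (rot_of_distTriang _ h) h'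
    (@asIso _ _ _ _ _ this) (Iso.refl _)
    ((Category.comp_id _).trans hs.symm)).symm⟩

/-- Let U be the cone of f_i. Under the isomorphism of `isIso_map_rho`, the coevaluation at U
becomes the connecting map of the triangle of f_i, up to an automorphism; its cone is X[1]. -/
lemma cone_coev_cone_ev (i : Fin n) (X : Ho k n) :
    Nonempty ((coneHomotopy (coevalTrans k i)).obj ((coneHomotopy (evalTrans k i)).obj X) ≅
      X⟦(1 : ℤ)⟧) := by
  obtain ⟨a, b, h⟩ := exists_evHo_triangle i X
  obtain ⟨a', b', h'⟩ := exists_coevHo_triangle i ((coneHomotopy (evalTrans k i)).obj X)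
  have := isIso_map_rho i h
  obtain ⟨c, hc⟩ := exists_coevHo_shift i ((bimodHo i 0).obj X)
  have hb : coevHo i _ ≫ (((bimodHo i 2).map b ≫ ((bimodHo i 2).commShiftIso (1 : ℤ)).hom.app _) ≫
      (rhoHo i (a := 0) (b := 2) (c := 0) rfl X)⟦(1 : ℤ)⟧') = b ≫ c.hom := by
    rw [Category.assoc, ← Category.assoc (coevHo i _), ← coevHo_naturality, Category.assoc,
      reassoc_of% hc, ← Functor.map_comp, coevHo_rho, CategoryTheory.Functor.map_id,
      Category.comp_id]
  refine ⟨Triangle.π₃.mapIso (isoTriangleOfIso₁₂ _ _ h' (rot_of_distTriang _ (rot_of_distTriang _ h))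
    (Iso.refl _) (@asIso _ _ _ _ _ this ≪≫ c.symm) ?_)⟩
  exact ((Category.assoc _ _ _).symm.trans ((Iso.comp_inv_eq c).2 hb)).trans
    (Category.id_comp _).symm

end Inverse

/-! ### The cone functors send distinguished triangles to distinguished triangles -/

section ConeTriangles

open Pretriangulated

/-! ### Diagonal maps between mapping cones -/

section

variable {C : Type*} [Category* C] [Preadditive C] [HasBinaryBiproducts C]

/-- The map between the terms of degree `m` of two mapping cones given by a diagonal matrix. -/
def coneDiag {K L K' L' : CochainComplex C ℤ} (φ : K ⟶ L) (φ' : K' ⟶ L') {m : ℤ}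
    (a : K.X (m + 1) ⟶ K'.X (m + 1)) (b : L.X m ⟶ L'.X m) :
    (CochainComplex.mappingCone φ).X m ⟶ (CochainComplex.mappingCone φ').X m :=
  (CochainComplex.mappingCone.fst φ).1.v m (m + 1) rfl ≫ a ≫ (CochainComplex.mappingCone.inl φ').v (m + 1) m (by omega) +
    (CochainComplex.mappingCone.snd φ).v m m (add_zero m) ≫ b ≫ (CochainComplex.mappingCone.inr φ').f m

variable {K L K' L' K'' L'' : CochainComplex C ℤ} (φ : K ⟶ L) (φ' : K' ⟶ L') (φ'' : K'' ⟶ L'')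
  {m : ℤ}

lemma coneDiag_comp (a : K.X (m + 1) ⟶ K'.X (m + 1)) (b : L.X m ⟶ L'.X m)
    (a' : K'.X (m + 1) ⟶ K''.X (m + 1)) (b' : L'.X m ⟶ L''.X m) :
    coneDiag φ φ' a b ≫ coneDiag φ' φ'' a' b' = coneDiag φ φ'' (a ≫ a') (b ≫ b') := by
  simp [coneDiag]

lemma coneDiag_id : coneDiag φ φ (𝟙 (K.X (m + 1))) (𝟙 (L.X m)) = 𝟙 _ := by
  simp only [coneDiag, Category.id_comp]
  exact CochainComplex.mappingCone.id_X φ m (m + 1) rfl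

lemma coneDiag_add (a a' : K.X (m + 1) ⟶ K'.X (m + 1)) (b b' : L.X m ⟶ L'.X m) :
    coneDiag φ φ' a b + coneDiag φ φ' a' b' = coneDiag φ φ' (a + a') (b + b') := by
  simp only [coneDiag, Preadditive.add_comp, Preadditive.comp_add]
  abel

lemma coneDiag_zero : coneDiag φ φ' (0 : K.X (m + 1) ⟶ _) (0 : L.X m ⟶ _) = 0 := by
  simp [coneDiag]

lemma mappingCone_map_f (a : K ⟶ K') (b : L ⟶ L') (comm : φ ≫ b = a ≫ φ') :
    (CochainComplex.mappingCone.map φ φ' a b comm).f m = coneDiag φ φ' (a.f (m + 1)) (b.f m) := by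
  simp [coneDiag, CochainComplex.mappingCone.map, CochainComplex.mappingCone.desc_f _ _ _ _ m (m + 1) rfl]

end

/-- A functor between pretriangulated categories preserves triangles up to a choice of the second
and third maps. -/
def PreservesTriangles {𝒯 𝒯' : Type*} [Category* 𝒯] [HasZeroObject 𝒯] [HasShift 𝒯 ℤ]
    [Preadditive 𝒯] [∀ n : ℤ, (shiftFunctor 𝒯 n).Additive] [Pretriangulated 𝒯] [Category* 𝒯']
    [HasZeroObject 𝒯'] [HasShift 𝒯' ℤ] [Preadditive 𝒯'] [∀ n : ℤ, (shiftFunctor 𝒯' n).Additive]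
    [Pretriangulated 𝒯'] (Φ : 𝒯 ⥤ 𝒯') : Prop :=
  ∀ (X Y Z : 𝒯) (f : X ⟶ Y) (g : Y ⟶ Z) (h : Z ⟶ X⟦(1 : ℤ)⟧), Triangle.mk f g h ∈ distTriang 𝒯 →
    ∃ (g' : Φ.obj Y ⟶ Φ.obj Z) (h' : Φ.obj Z ⟶ (Φ.obj X)⟦(1 : ℤ)⟧),
      Triangle.mk (Φ.map f) g' h' ∈ distTriang 𝒯'

section

set_option linter.unusedSectionVars false

variable {𝒯 𝒯' 𝒯'' : Type*} [Category* 𝒯] [HasZeroObject 𝒯] [HasShift 𝒯 ℤ]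
  [Preadditive 𝒯] [∀ n : ℤ, (shiftFunctor 𝒯 n).Additive] [Pretriangulated 𝒯] [Category* 𝒯']
  [HasZeroObject 𝒯'] [HasShift 𝒯' ℤ] [Preadditive 𝒯'] [∀ n : ℤ, (shiftFunctor 𝒯' n).Additive]
  [Pretriangulated 𝒯'] [Category* 𝒯'']
  [HasZeroObject 𝒯''] [HasShift 𝒯'' ℤ] [Preadditive 𝒯''] [∀ n : ℤ, (shiftFunctor 𝒯'' n).Additive]
  [Pretriangulated 𝒯'']

lemma PreservesTriangles.id : PreservesTriangles (𝟭 𝒯) := fun _ _ _ _ g h hT => ⟨g, h, hT⟩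

lemma PreservesTriangles.comp {Φ : 𝒯 ⥤ 𝒯'} {Φ' : 𝒯' ⥤ 𝒯''} (h : PreservesTriangles Φ)
    (h' : PreservesTriangles Φ') : PreservesTriangles (Φ ⋙ Φ') := fun X Y Z f _ _ hT => by
  obtain ⟨g, k, hT'⟩ := h X Y Z f _ _ hT
  exact h' _ _ _ _ g k hT'

lemma PreservesTriangles.shift (m : ℤ) : PreservesTriangles (shiftFunctor 𝒯 m) :=
  fun _ _ _ _ _ _ hT => exists_shift_distinguished hT m

lemma exists_distinguished_of_iso {A B C A' B' : 𝒯} {f : A ⟶ B} {g : B ⟶ C} {h : C ⟶ A⟦(1 : ℤ)⟧}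
    (hT : Triangle.mk f g h ∈ distTriang 𝒯) (a : A' ≅ A) (b : B' ≅ B) {C' : 𝒯} (c : C' ≅ C)
    (f' : A' ⟶ B') (hf : f' ≫ b.hom = a.hom ≫ f) :
    ∃ (g' : B' ⟶ C') (h' : C' ⟶ A'⟦(1 : ℤ)⟧), Triangle.mk f' g' h' ∈ distTriang 𝒯 := by
  refine ⟨b.hom ≫ g ≫ c.inv, c.hom ≫ h ≫ a.inv⟦(1 : ℤ)⟧', isomorphic_distinguished _ hT _
    (Triangle.isoMk _ _ a b c hf ?_ ?_)⟩
  · change (b.hom ≫ g ≫ c.inv) ≫ c.hom = b.hom ≫ g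
    simp
  · change (c.hom ≫ h ≫ a.inv⟦(1 : ℤ)⟧') ≫ a.hom⟦(1 : ℤ)⟧' = c.hom ≫ h
    simp [← Functor.map_comp]

lemma PreservesTriangles.of_iso {Φ : 𝒯 ⥤ 𝒯'} {T : Triangle 𝒯} {X Y Z : 𝒯} {f : X ⟶ Y} {g : Y ⟶ Z}
    {h : Z ⟶ X⟦(1 : ℤ)⟧} (e : Triangle.mk f g h ≅ T)
    {g' : Φ.obj T.obj₂ ⟶ Φ.obj T.obj₃} {h' : Φ.obj T.obj₃ ⟶ (Φ.obj T.obj₁)⟦(1 : ℤ)⟧}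
    (hT : Triangle.mk (Φ.map T.mor₁) g' h' ∈ distTriang 𝒯') :
    ∃ (g' : Φ.obj Y ⟶ Φ.obj Z) (h' : Φ.obj Z ⟶ (Φ.obj X)⟦(1 : ℤ)⟧),
      Triangle.mk (Φ.map f) g' h' ∈ distTriang 𝒯' :=
  exists_distinguished_of_iso hT (Φ.mapIso (Triangle.π₁.mapIso e)) (Φ.mapIso (Triangle.π₂.mapIso e))
    (Φ.mapIso (Triangle.π₃.mapIso e)) (Φ.map f)
    ((Φ.map_comp _ _).symm.trans ((congrArg Φ.map e.hom.comm₁).trans (Φ.map_comp _ _)))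

end

/-! ### Cone functors on triangles, zero morphisms and shifts -/

section

set_option linter.unusedSectionVars false

variable {C : Type*} [Category* C] [Preadditive C] [HasZeroObject C] [HasBinaryBiproducts C]
  {F G : C ⥤ C} [F.Additive] [G.Additive] (τ : F ⟶ G)

lemma coneComplex_map_f {K L : CochainComplex C ℤ} (f : K ⟶ L) (m : ℤ) :
    ((coneComplex τ).map f).f m = coneDiag ((NatTrans.mapHomologicalComplex τ (.up ℤ)).app K)
      ((NatTrans.mapHomologicalComplex τ (.up ℤ)).app L) (F.map (f.f (m + 1))) (G.map (f.f m)) :=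
  mappingCone_map_f _ _ _ _ ((NatTrans.mapHomologicalComplex τ (.up ℤ)).naturality f).symm

/-- The diagonal map between cones of `τ` induced by maps of graded objects. -/
def coneGraded {K L : CochainComplex C ℤ} (m : ℤ) (a : K.X (m + 1) ⟶ L.X (m + 1))
    (b : K.X m ⟶ L.X m) : ((coneComplex τ).obj K).X m ⟶ ((coneComplex τ).obj L).X m :=
  coneDiag ((NatTrans.mapHomologicalComplex τ (.up ℤ)).app K)
    ((NatTrans.mapHomologicalComplex τ (.up ℤ)).app L) (F.map a) (G.map b)

lemma coneGraded_comp {K L M : CochainComplex C ℤ} (m : ℤ) (a : K.X (m + 1) ⟶ L.X (m + 1))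
    (b : K.X m ⟶ L.X m) (a' : L.X (m + 1) ⟶ M.X (m + 1)) (b' : L.X m ⟶ M.X m) :
    coneGraded τ m a b ≫ coneGraded τ m a' b' = coneGraded τ m (a ≫ a') (b ≫ b') := by
  exact (coneDiag_comp _ _ _ _ _ _ _).trans
    (congrArg₂ (coneDiag _ _) (F.map_comp _ _).symm (G.map_comp _ _).symm)

lemma coneGraded_id (K : CochainComplex C ℤ) (m : ℤ) :
    coneGraded τ m (𝟙 (K.X (m + 1))) (𝟙 (K.X m)) = 𝟙 _ := by
  exact (congrArg₂ (coneDiag _ _) (F.map_id _) (G.map_id _)).trans (coneDiag_id _)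

lemma coneGraded_add {K L : CochainComplex C ℤ} (m : ℤ) (a a' : K.X (m + 1) ⟶ L.X (m + 1))
    (b b' : K.X m ⟶ L.X m) :
    coneGraded τ m a b + coneGraded τ m a' b' = coneGraded τ m (a + a') (b + b') := by
  exact (coneDiag_add _ _ _ _ _ _).trans
    (congrArg₂ (coneDiag _ _) F.map_add.symm G.map_add.symm)

/-- The cone functors preserve degreewise split short exact sequences. -/
def splittingCone {S : ShortComplex (CochainComplex C ℤ)}
    (σ : ∀ m, (S.map (HomologicalComplex.eval C _ m)).Splitting)
    (w : (coneComplex τ).map S.f ≫ (coneComplex τ).map S.g = 0) (m : ℤ) :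
    ((ShortComplex.mk _ _ w).map (HomologicalComplex.eval C _ m)).Splitting where
  r := coneGraded τ (K := S.X₂) (L := S.X₁) m (σ (m + 1)).r (σ m).r
  s := coneGraded τ (K := S.X₃) (L := S.X₂) m (σ (m + 1)).s (σ m).s
  f_r := by
    refine (congrArg (· ≫ _) (coneComplex_map_f τ S.f m)).trans
      ((coneGraded_comp τ m _ _ _ _).trans (Eq.trans ?_ (coneGraded_id τ S.X₁ m)))
    exact congrArg₂ (coneGraded τ m) (σ (m + 1)).f_r (σ m).f_r
  s_g := by
    refine (congrArg (_ ≫ ·) (coneComplex_map_f τ S.g m)).trans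
      ((coneGraded_comp τ m _ _ _ _).trans (Eq.trans ?_ (coneGraded_id τ S.X₃ m)))
    exact congrArg₂ (coneGraded τ m) (σ (m + 1)).s_g (σ m).s_g
  id := by
    refine Eq.trans (congrArg₂ (· + ·)
      ((congrArg (_ ≫ ·) (coneComplex_map_f τ S.f m)).trans (coneGraded_comp τ m _ _ _ _))
      ((congrArg (· ≫ _) (coneComplex_map_f τ S.g m)).trans (coneGraded_comp τ m _ _ _ _)))
      ((coneGraded_add τ m _ _ _ _).trans (Eq.trans ?_ (coneGraded_id τ S.X₂ m)))
    exact congrArg₂ (coneGraded τ m) (σ (m + 1)).id (σ m).id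

lemma coneComplex_map_zero (K L : CochainComplex C ℤ) :
    (coneComplex τ).map (0 : K ⟶ L) = 0 := by
  ext m
  exact (coneComplex_map_f τ (0 : K ⟶ L) m).trans ((congrArg₂ (coneDiag _ _) (F.map_zero _ _)
    (G.map_zero _ _)).trans (coneDiag_zero _ _))

/-- Every distinguished triangle comes from a degreewise split short exact sequence. In each degree
the cone of τ is F(K^{m+1}) ⊕ G(K^m), so diagonal matrices carry the splittings over. -/
lemma preservesTriangles_coneHomotopy : PreservesTriangles (coneHomotopy τ) := by
  intro X Y Z f g h hT
  obtain ⟨S, σ, ⟨e⟩⟩ :=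
    (HomotopyCategory.distinguished_iff_iso_trianglehOfDegreewiseSplit _).1 hT
  have w : (coneComplex τ).map S.f ≫ (coneComplex τ).map S.g = 0 := by
    rw [← Functor.map_comp, S.zero, coneComplex_map_zero]
  have h1 := (HomotopyCategory.distinguished_iff_iso_trianglehOfDegreewiseSplit _).2
    ⟨_, splittingCone τ σ w, ⟨Iso.refl _⟩⟩
  exact PreservesTriangles.of_iso e h1

lemma coneHomotopy_map_zero (X Y : HomotopyCategory C (.up ℤ)) :
    (coneHomotopy τ).map (0 : X ⟶ Y) = 0 := by
  obtain ⟨K, rfl⟩ := HomotopyCategory.quotient_obj_surjective X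
  obtain ⟨L, rfl⟩ := HomotopyCategory.quotient_obj_surjective Y
  rw [← Functor.map_zero (HomotopyCategory.quotient C (.up ℤ)) K L]
  exact (congrArg (HomotopyCategory.quotient C (.up ℤ)).map (coneComplex_map_zero τ K L)).trans
    (Functor.map_zero _ _ _)

/-- A triangle in the homotopy category whose objects are bounded gives a triangle of bounded
complexes. -/
lemma exists_distinguished_bounded {X Y Z : BoundedHomotopyCategory C} (f : X ⟶ Y)
    (g : Y.obj ⟶ Z.obj) (h : Z.obj ⟶ X.obj⟦(1 : ℤ)⟧)
    (hT : Triangle.mk f.hom g h ∈ distTriang (HomotopyCategory C (.up ℤ))) :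
    ∃ (g' : Y ⟶ Z) (h' : Z ⟶ X⟦(1 : ℤ)⟧),
      g'.hom = g ∧ Triangle.mk f g' h' ∈ distTriang (BoundedHomotopyCategory C) := by
  refine ⟨ObjectProperty.homMk g,
    ObjectProperty.homMk (h ≫ ((bounded C).ι.commShiftIso (1 : ℤ)).inv.app X), rfl, ?_⟩
  refine isomorphic_distinguished _ hT _ (Triangle.isoMk _ _ (Iso.refl _) (Iso.refl _) (Iso.refl _)
    ((Category.comp_id _).trans (Category.id_comp _).symm)
    ((Category.comp_id _).trans (Category.id_comp _).symm) ?_)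
  have key : (h ≫ ((bounded C).ι.commShiftIso (1 : ℤ)).inv.app X) ≫
      ((bounded C).ι.commShiftIso (1 : ℤ)).hom.app X = h := by
    rw [Category.assoc, Iso.inv_hom_id_app]
    exact Category.comp_id _
  change ((h ≫ ((bounded C).ι.commShiftIso (1 : ℤ)).inv.app X) ≫
    ((bounded C).ι.commShiftIso (1 : ℤ)).hom.app X) ≫ (shiftFunctor _ (1 : ℤ)).map (𝟙 _) = 𝟙 _ ≫ h
  rw [CategoryTheory.Functor.map_id, Category.id_comp]
  exact (Category.comp_id _).trans key

lemma preservesTriangles_cone : PreservesTriangles (cone τ) := by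
  intro X Y Z f g h hT
  obtain ⟨g', h', hT'⟩ := preservesTriangles_coneHomotopy τ X.obj Y.obj Z.obj f.hom _ _ hT
  obtain ⟨g'', h'', -, hT''⟩ := exists_distinguished_bounded (X := (cone τ).obj X)
    (Y := (cone τ).obj Y) (Z := (cone τ).obj Z) ((cone τ).map f) g' h' hT'
  exact ⟨g'', h'', hT''⟩

lemma cone_map_zero (X Y : BoundedHomotopyCategory C) : (cone τ).map (0 : X ⟶ Y) = 0 :=
  ObjectProperty.hom_ext _ (coneHomotopy_map_zero τ X.obj Y.obj)

lemma cone_shift (X : BoundedHomotopyCategory C) (m : ℤ) :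
    Nonempty ((cone τ).obj (X⟦m⟧) ≅ ((cone τ).obj X)⟦m⟧) := by
  obtain ⟨e⟩ := coneHomotopy_shift τ X.obj m
  exact ⟨(bounded C).ι.preimageIso ((coneHomotopy τ).mapIso (((bounded C).ι.commShiftIso m).app X)
    ≪≫ e ≪≫ (((bounded C).ι.commShiftIso m).app ((cone τ).obj X)).symm)⟩

end

end ConeTriangles

/-! ### The twists as autoequivalences on isomorphism classes -/

section Twists

open Pretriangulated

variable (k : Type u) [Field k] {n : ℕ}

lemma twist_shift (i : Fin n) (X : D k n) (m : ℤ) :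
    Nonempty ((twist k i).obj (X⟦m⟧) ≅ ((twist k i).obj X)⟦m⟧) := by
  obtain ⟨e⟩ := cone_shift (GrProj.coevalTrans k i) X m
  exact ⟨(shiftFunctor (D k n) (-1 : ℤ)).mapIso e ≪≫ shiftComm _ m (-1)⟩

lemma twistInv_shift (i : Fin n) (X : D k n) (m : ℤ) :
    Nonempty ((twistInv k i).obj (X⟦m⟧) ≅ ((twistInv k i).obj X)⟦m⟧) :=
  cone_shift _ X m

/-- The composite of the two cones is the shift by 1, which the shift by -1 in `twist` cancels. -/
lemma twistInv_twist (i : Fin n) (X : D k n) :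
    Nonempty ((twistInv k i).obj ((twist k i).obj X) ≅ X) := by
  obtain ⟨e⟩ := twistInv_shift k i ((cone (GrProj.coevalTrans k i)).obj X) (-1)
  obtain ⟨e'⟩ := cone_ev_cone_coev (k := k) i X.obj
  have e'' : (cone (GrProj.evalTrans k i)).obj ((cone (GrProj.coevalTrans k i)).obj X) ≅ X⟦(1 : ℤ)⟧ :=
    (bounded _).ι.preimageIso (e' ≪≫ (((bounded _).ι.commShiftIso (1 : ℤ)).app X).symm)
  exact ⟨e ≪≫ (shiftFunctor (D k n) (-1 : ℤ)).mapIso e'' ≪≫ (shiftEquiv (D k n) (1 : ℤ)).unitIso.symm.app X⟩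

lemma twist_twistInv (i : Fin n) (X : D k n) :
    Nonempty ((twist k i).obj ((twistInv k i).obj X) ≅ X) := by
  obtain ⟨e'⟩ := cone_coev_cone_ev (k := k) i X.obj
  have e'' : (cone (GrProj.coevalTrans k i)).obj ((cone (GrProj.evalTrans k i)).obj X) ≅ X⟦(1 : ℤ)⟧ :=
    (bounded _).ι.preimageIso (e' ≪≫ (((bounded _).ι.commShiftIso (1 : ℤ)).app X).symm)
  exact ⟨(shiftFunctor (D k n) (-1 : ℤ)).mapIso e'' ≪≫ (shiftEquiv (D k n) (1 : ℤ)).unitIso.symm.app X⟩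

/-- The composite of twists and inverse twists along a word. -/
def wordFunctor (L : List (Fin n × Bool)) : D k n ⥤ D k n :=
  L.foldr (fun x F => F ⋙ (if x.2 then twist k x.1 else twistInv k x.1)) (𝟭 _)

lemma letter_induction {p : (D k n ⥤ D k n) → Prop} (h₁ : ∀ i, p (twist k i))
    (h₂ : ∀ i, p (twistInv k i)) (x : Fin n × Bool) :
    p (if x.2 then twist k x.1 else twistInv k x.1) := by
  split_ifs
  exacts [h₁ _, h₂ _]

lemma word_induction {p : (D k n ⥤ D k n) → Prop} (h₀ : p (𝟭 _)) (h₁ : ∀ i, p (twist k i))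
    (h₂ : ∀ i, p (twistInv k i)) (hc : ∀ F G, p F → p G → p (F ⋙ G)) (β : FreeGroup (Fin n)) :
    p (Psi k β) := by
  have : ∀ L : List (Fin n × Bool), p (wordFunctor k L) := fun L => by
    induction L with
    | nil => exact h₀
    | cons x L ih => exact hc _ _ ih (letter_induction k h₁ h₂ x)
  exact this _

lemma preservesTriangles_twist (i : Fin n) : PreservesTriangles (twist k i) :=
  (preservesTriangles_cone _).comp (.shift _)

lemma preservesTriangles_twistInv (i : Fin n) : PreservesTriangles (twistInv k i) :=
  preservesTriangles_cone _

lemma preservesTriangles_Psi (β : FreeGroup (Fin n)) : PreservesTriangles (Psi k β) :=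
  word_induction k .id (preservesTriangles_twist k) (preservesTriangles_twistInv k)
    (fun _ _ h h' => h.comp h') β

lemma twist_map_zero (i : Fin n) (X Y : D k n) : (twist k i).map (0 : X ⟶ Y) = 0 :=
  (congrArg (shiftFunctor (D k n) (-1 : ℤ)).map (cone_map_zero _ X Y)).trans (Functor.map_zero _ _ _)

lemma twistInv_map_zero (i : Fin n) (X Y : D k n) : (twistInv k i).map (0 : X ⟶ Y) = 0 :=
  cone_map_zero _ X Y

lemma Psi_map_zero (β : FreeGroup (Fin n)) (X Y : D k n) : (Psi k β).map (0 : X ⟶ Y) = 0 := by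
  revert X Y
  refine word_induction k (p := fun F => ∀ X Y : D k n, F.map (0 : X ⟶ Y) = 0) (fun _ _ => rfl)
    (twist_map_zero k) (twistInv_map_zero k) (fun F G h h' X Y => ?_) β
  exact (congrArg G.map (h X Y)).trans (h' _ _)

lemma Psi_shift (β : FreeGroup (Fin n)) (X : D k n) (m : ℤ) :
    Nonempty ((Psi k β).obj (X⟦m⟧) ≅ ((Psi k β).obj X)⟦m⟧) := by
  revert X
  refine word_induction k
    (p := fun F => ∀ X : D k n, Nonempty (F.obj (X⟦m⟧) ≅ (F.obj X)⟦m⟧)) (fun _ => ⟨Iso.refl _⟩)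
    (fun i X => twist_shift k i X m) (fun i X => twistInv_shift k i X m) (fun F G h h' X => ?_) β
  obtain ⟨e⟩ := h X
  obtain ⟨e'⟩ := h' (F.obj X)
  exact ⟨G.mapIso e ≪≫ e'⟩

variable (n)

/-- The isomorphism classes of objects of the homotopy category. -/
abbrev IsoClass : Type _ := Quotient (isIsomorphicSetoid (D k n))

variable {n k}

/-- The isomorphism class of an object. -/
def cls (X : D k n) : IsoClass k n := Quotient.mk _ X

lemma cls_eq_iff {X Y : D k n} : cls X = cls Y ↔ Nonempty (X ≅ Y) := Quotient.eq

variable (k)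

/-- The permutation of the isomorphism classes induced by a twist. -/
def twistPerm (i : Fin n) : Equiv.Perm (IsoClass k n) where
  toFun := Quotient.map (twist k i).obj fun _ _ ⟨e⟩ => ⟨(twist k i).mapIso e⟩
  invFun := Quotient.map (twistInv k i).obj fun _ _ ⟨e⟩ => ⟨(twistInv k i).mapIso e⟩
  left_inv x := by
    induction x using Quotient.ind with
    | _ X => exact cls_eq_iff.2 (twistInv_twist k i X)
  right_inv x := by
    induction x using Quotient.ind with
    | _ X => exact cls_eq_iff.2 (twist_twistInv k i X)

/-- The action of the free group on the isomorphism classes. -/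
def isoAction : FreeGroup (Fin n) →* Equiv.Perm (IsoClass k n) := FreeGroup.lift (twistPerm k)

lemma twistPerm_cls (i : Fin n) (X : D k n) : twistPerm k i (cls X) = cls ((twist k i).obj X) := rfl

lemma isoAction_cls (β : FreeGroup (Fin n)) (X : D k n) :
    isoAction k β (cls X) = cls ((Psi k β).obj X) := by
  have : ∀ L : List (Fin n × Bool),
      isoAction k (FreeGroup.mk L) (cls X) = cls ((wordFunctor k L).obj X) := fun L => by
    induction L with
    | nil => exact congrArg (fun σ : Equiv.Perm (IsoClass k n) => σ (cls X)) (map_one (isoAction k))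
    | cons x L ih =>
      have h1 : FreeGroup.mk (x :: L) = FreeGroup.mk [x] * FreeGroup.mk L := rfl
      rw [h1, map_mul, Equiv.Perm.mul_apply, ih]
      obtain ⟨i, _ | _⟩ := x
      · have : isoAction k (FreeGroup.mk [(i, false)]) = (twistPerm k i)⁻¹ := by
          simp [isoAction, FreeGroup.lift_mk]
        rw [this]
        rfl
      · have : isoAction k (FreeGroup.mk [(i, true)]) = twistPerm k i := by
          simp [isoAction, FreeGroup.lift_mk]
        rw [this]
        rfl
  conv_lhs => rw [← FreeGroup.mk_toWord (x := β)]
  exact this _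

/-- The reduced word of a product is not the concatenation of the reduced words. Passing to the
homomorphism into permutations of isomorphism classes takes care of the cancellations. -/
lemma Psi_mul (α β : FreeGroup (Fin n)) (X : D k n) :
    Nonempty ((Psi k (α * β)).obj X ≅ (Psi k α).obj ((Psi k β).obj X)) := by
  rw [← cls_eq_iff, ← isoAction_cls, ← isoAction_cls, ← isoAction_cls, map_mul]
  rfl

lemma Psi_one_obj (X : D k n) : (Psi k (1 : FreeGroup (Fin n))).obj X = X := by
  simp [Psi]

lemma Psi_inv_Psi (β : FreeGroup (Fin n)) (X : D k n) :
    Nonempty ((Psi k β⁻¹).obj ((Psi k β).obj X) ≅ X) := by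
  rw [← cls_eq_iff, ← isoAction_cls, ← isoAction_cls, ← Equiv.Perm.mul_apply, ← map_mul,
    inv_mul_cancel, map_one]
  rfl

lemma Psi_Psi_inv (β : FreeGroup (Fin n)) (X : D k n) :
    Nonempty ((Psi k β).obj ((Psi k β⁻¹).obj X) ≅ X) := by
  simpa using Psi_inv_Psi k β⁻¹ X

end Twists

/-! ### Homology of vector space valued functors -/

section LinearAlgebra

variable {k : Type u} [Field k]

/-- The rank of a linear map between objects of `ModuleCat k`. -/
def rk {V V' : ModuleCat.{u} k} (f : V ⟶ V') : ℕ := Module.finrank k (LinearMap.range f.hom)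

lemma rk_le_left {V V' : ModuleCat.{u} k} [Module.Finite k V] (f : V ⟶ V') :
    rk f ≤ Module.finrank k V :=
  LinearMap.finrank_range_le f.hom

lemma rk_le_right {V V' : ModuleCat.{u} k} [Module.Finite k V'] (f : V ⟶ V') :
    rk f ≤ Module.finrank k V' :=
  Submodule.finrank_le _

lemma rk_zero {V V' : ModuleCat.{u} k} : rk (0 : V ⟶ V') = 0 := by
  rw [rk, ModuleCat.hom_zero, LinearMap.range_zero, finrank_bot]

lemma eq_zero_of_rk {V V' : ModuleCat.{u} k} [Module.Finite k V] {f : V ⟶ V'} (h : rk f = 0) :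
    f = 0 := by
  rw [rk, Submodule.finrank_eq_zero, LinearMap.range_eq_bot] at h
  ext x
  rw [h]
  rfl

lemma rk_of_iso {V V' U U' : ModuleCat.{u} k} (e : V ≅ U) (e' : V' ≅ U') (f : V ⟶ V') (g : U ⟶ U')
    (h : e.hom ≫ g = f ≫ e'.hom) : rk f = rk g := by
  have h1 : f = e.hom ≫ g ≫ e'.inv := by rw [reassoc_of% h, e'.hom_inv_id, Category.comp_id]
  have h2 : f.hom = (e'.toLinearEquiv.symm.toLinearMap ∘ₗ g.hom) ∘ₗ e.toLinearEquiv.toLinearMap := by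
    rw [h1]; rfl
  rw [rk, rk, h2, LinearMap.range_comp_of_range_eq_top _ (LinearEquiv.range _), LinearMap.range_comp]
  exact LinearEquiv.finrank_map_eq e'.toLinearEquiv.symm _

lemma finrank_of_iso {V U : ModuleCat.{u} k} (e : V ≅ U) : Module.finrank k V = Module.finrank k U :=
  e.toLinearEquiv.finrank_eq

/-- Rank-nullity for the three maps g, h, l; exactness replaces each kernel by the preceding range,
and the ranks of g and h drop out. -/
lemma finrank_of_exact {V₁ V₂ V₃ V₄ V₅ : ModuleCat.{u} k} {f : V₁ ⟶ V₂} {g : V₂ ⟶ V₃} {h : V₃ ⟶ V₄}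
    {l : V₄ ⟶ V₅} {w₁ : f ≫ g = 0} {w₂ : g ≫ h = 0} {w₃ : h ≫ l = 0}
    (h₁ : (ShortComplex.mk f g w₁).Exact) (h₂ : (ShortComplex.mk g h w₂).Exact)
    (h₃ : (ShortComplex.mk h l w₃).Exact) [Module.Finite k V₂] [Module.Finite k V₃]
    [Module.Finite k V₄] :
    Module.finrank k V₃ + rk f + rk l = Module.finrank k V₂ + Module.finrank k V₄ := by
  have e1 := h₁.moduleCat_range_eq_ker
  have e2 := h₂.moduleCat_range_eq_ker
  have e3 := h₃.moduleCat_range_eq_ker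
  have r1 := LinearMap.finrank_range_add_finrank_ker g.hom
  have r2 := LinearMap.finrank_range_add_finrank_ker h.hom
  have r3 := LinearMap.finrank_range_add_finrank_ker l.hom
  dsimp at e1 e2 e3
  rw [← e1] at r1
  rw [← e2] at r2
  rw [← e3] at r3
  unfold rk
  omega

end LinearAlgebra

/-! ### Cohomology classes represented by cocycles -/

section Classes

variable {k : Type u} [Field k] (L : CochainComplex (ModuleCat.{u} k) ℤ)

/-- The map from the cocycles to the cohomology. -/
def toHomology (m : ℤ) : LinearMap.ker (L.d m (m + 1)).hom →ₗ[k] L.homology m :=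
  (L.liftCycles (ModuleCat.ofHom (LinearMap.ker (L.d m (m + 1)).hom).subtype) (m + 1) (by simp)
    (by ext x; exact x.2) ≫ L.homologyπ m).hom

lemma toHomology_surjective (m : ℤ) : Function.Surjective (toHomology L m) := by
  intro h
  obtain ⟨c, rfl⟩ := (ModuleCat.epi_iff_surjective (L.homologyπ m)).1 inferInstance h
  refine ⟨⟨(L.iCycles m).hom c, ?_⟩, congrArg (L.homologyπ m).hom ?_⟩
  · exact LinearMap.congr_fun (congrArg ModuleCat.Hom.hom (L.iCycles_d m (m + 1))) c
  · apply (ModuleCat.mono_iff_injective (L.iCycles m)).1 inferInstance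
    exact LinearMap.congr_fun (congrArg ModuleCat.Hom.hom (L.liftCycles_i _ (m + 1) (by simp) _)) _

lemma toHomology_eq_zero_iff (m : ℤ) (x : LinearMap.ker (L.d m (m + 1)).hom) :
    toHomology L m x = 0 ↔ ∃ y, (L.d (m - 1) m).hom y = x.1 := by
  have hi := LinearMap.congr_fun (congrArg ModuleCat.Hom.hom (L.liftCycles_i
    (ModuleCat.ofHom (LinearMap.ker (L.d m (m + 1)).hom).subtype) (m + 1) (by simp)
      (by ext x; exact x.2))) x
  have hex : (ShortComplex.mk (L.toCycles (m - 1) m) (L.homologyπ m) (by simp)).Exact :=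
    ShortComplex.exact_of_g_is_cokernel _ (L.homologyIsCokernel (m - 1) m (by simp))
  rw [ShortComplex.moduleCat_exact_iff] at hex
  constructor
  · intro h
    obtain ⟨y, hy⟩ := hex _ h
    refine ⟨y, Eq.trans ?_ hi⟩
    rw [← L.toCycles_i (m - 1) m]
    exact congrArg (L.iCycles m).hom hy
  · rintro ⟨y, hy⟩
    have h : (L.toCycles (m - 1) m).hom y = (L.liftCycles
        (ModuleCat.ofHom (LinearMap.ker (L.d m (m + 1)).hom).subtype) (m + 1) (by simp)
        (by ext x; exact x.2)).hom x := by
      apply (ModuleCat.mono_iff_injective (L.iCycles m)).1 inferInstance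
      refine Eq.trans ?_ (hy.trans hi.symm)
      rw [← L.toCycles_i (m - 1) m]
      rfl
    refine (congrArg (L.homologyπ m).hom h.symm).trans ?_
    exact LinearMap.congr_fun (congrArg ModuleCat.Hom.hom (L.toCycles_comp_homologyπ (m - 1) m)) y

lemma mem_ker_of_map {L L' : CochainComplex (ModuleCat.{u} k) ℤ} (f : L ⟶ L') (m : ℤ)
    (x : LinearMap.ker (L.d m (m + 1)).hom) :
    (f.f m).hom x.1 ∈ LinearMap.ker (L'.d m (m + 1)).hom := by
  have h := LinearMap.congr_fun (congrArg ModuleCat.Hom.hom (f.comm m (m + 1))) x.1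
  refine LinearMap.mem_ker.2 (h.trans ?_)
  exact (congrArg (f.f (m + 1)).hom x.2).trans (map_zero _)

lemma homologyMap_toHomology {L L' : CochainComplex (ModuleCat.{u} k) ℤ} (f : L ⟶ L') (m : ℤ)
    (x : LinearMap.ker (L.d m (m + 1)).hom) :
    (HomologicalComplex.homologyMap f m).hom (toHomology L m x) =
      toHomology L' m ⟨(f.f m).hom x.1, mem_ker_of_map f m x⟩ := by
  have h1 := LinearMap.congr_fun (congrArg ModuleCat.Hom.hom
    (HomologicalComplex.homologyπ_naturality f m)) (L.liftCycles
      (ModuleCat.ofHom (LinearMap.ker (L.d m (m + 1)).hom).subtype) (m + 1) (by simp)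
      (by ext x; exact x.2) x)
  refine h1.trans (congrArg (L'.homologyπ m).hom ?_)
  apply (ModuleCat.mono_iff_injective (L'.iCycles m)).1 inferInstance
  have h2 := LinearMap.congr_fun (congrArg ModuleCat.Hom.hom (HomologicalComplex.cyclesMap_i f m))
    (L.liftCycles (ModuleCat.ofHom (LinearMap.ker (L.d m (m + 1)).hom).subtype) (m + 1) (by simp)
      (by ext x; exact x.2) x)
  have h3 := LinearMap.congr_fun (congrArg ModuleCat.Hom.hom (L.liftCycles_i
    (ModuleCat.ofHom (LinearMap.ker (L.d m (m + 1)).hom).subtype) (m + 1) (by simp)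
      (by ext x; exact x.2))) x
  have h4 := LinearMap.congr_fun (congrArg ModuleCat.Hom.hom (L'.liftCycles_i
    (ModuleCat.ofHom (LinearMap.ker (L'.d m (m + 1)).hom).subtype) (m + 1) (by simp)
      (by ext x; exact x.2))) ⟨(f.f m).hom x.1, mem_ker_of_map f m x⟩
  exact h2.trans ((congrArg (f.f m).hom h3).trans h4.symm)

end Classes

/-! ### Cohomology of a functor to vector spaces, and rank formulas -/

section Homology

open Pretriangulated

variable {k : Type u} [Field k] {C : Type*} [Category* C] [Preadditive C]

/-- The functor sending `X` to the cohomology in degree `m` of the complex `Φ X`. -/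
def H (Φ : C ⥤ ModuleCat.{u} k) [Φ.Additive] (m : ℤ) :
    HomotopyCategory C (.up ℤ) ⥤ ModuleCat.{u} k :=
  Φ.mapHomotopyCategory (.up ℤ) ⋙ HomotopyCategory.homologyFunctor _ _ m

instance (Φ : C ⥤ ModuleCat.{u} k) [Φ.Additive] (m : ℤ) : (H Φ m).Additive :=
  inferInstanceAs (Φ.mapHomotopyCategory (.up ℤ) ⋙ HomotopyCategory.homologyFunctor _ _ m).Additive

/-- The transformation induced by a transformation between additive functors. -/
def HMap {Φ Φ' : C ⥤ ModuleCat.{u} k} [Φ.Additive] [Φ'.Additive] (τ : Φ ⟶ Φ') (m : ℤ) :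
    H Φ m ⟶ H Φ' m :=
  Functor.whiskerRight (NatTrans.mapHomotopyCategory τ (.up ℤ)) _

variable (Φ : C ⥤ ModuleCat.{u} k) [Φ.Additive] (m : ℤ)

/-- The value of `H` on the class of a complex. -/
def HIso (K : CochainComplex C ℤ) : (H Φ m).obj ((HomotopyCategory.quotient C (.up ℤ)).obj K) ≅
    ((Φ.mapHomologicalComplex (.up ℤ)).obj K).homology m :=
  (HomotopyCategory.homologyFunctorFactors _ (.up ℤ) m).app ((Φ.mapHomologicalComplex (.up ℤ)).obj K)

lemma HIso_naturality {K K' : CochainComplex C ℤ} (f : K ⟶ K') :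
    (HIso Φ m K).hom ≫
      HomologicalComplex.homologyMap ((Φ.mapHomologicalComplex (.up ℤ)).map f) m =
    (H Φ m).map ((HomotopyCategory.quotient C (.up ℤ)).map f) ≫ (HIso Φ m K').hom :=
  ((HomotopyCategory.homologyFunctorFactors _ (.up ℤ) m).hom.naturality
    ((Φ.mapHomologicalComplex (.up ℤ)).map f)).symm

lemma HIso_HMap {Φ Φ' : C ⥤ ModuleCat.{u} k} [Φ.Additive] [Φ'.Additive] (τ : Φ ⟶ Φ')
    (K : CochainComplex C ℤ) :
    (HIso Φ m K).hom ≫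
      HomologicalComplex.homologyMap ((NatTrans.mapHomologicalComplex τ (.up ℤ)).app K) m =
    (HMap τ m).app ((HomotopyCategory.quotient C (.up ℤ)).obj K) ≫ (HIso Φ' m K).hom :=
  ((HomotopyCategory.homologyFunctorFactors _ (.up ℤ) m).hom.naturality
    ((NatTrans.mapHomologicalComplex τ (.up ℤ)).app K)).symm

instance [∀ M, Module.Finite k (Φ.obj M)] (X : HomotopyCategory C (.up ℤ)) :
    Module.Finite k ((H Φ m).obj X) := by
  obtain ⟨K, rfl⟩ := HomotopyCategory.quotient_obj_surjective X
  have : Module.Finite k (((Φ.mapHomologicalComplex (.up ℤ)).obj K).X m) :=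
    inferInstanceAs (Module.Finite k (Φ.obj (K.X m)))
  have := Module.Finite.of_surjective _ (toHomology_surjective
    ((Φ.mapHomologicalComplex (.up ℤ)).obj K) m)
  exact Module.Finite.equiv (HIso Φ m K).toLinearEquiv.symm

/-- The dimension of the cohomology in degree `m` of the complex `Φ X`. -/
def hdim (X : HomotopyCategory C (.up ℤ)) : ℕ := Module.finrank k ((H Φ m).obj X)

variable {Φ m} in
lemma hdim_of_iso {X Y : HomotopyCategory C (.up ℤ)} (e : X ≅ Y) : hdim Φ m X = hdim Φ m Y :=
  finrank_of_iso ((H Φ m).mapIso e)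

lemma hdim_shift (X : HomotopyCategory C (.up ℤ)) (a m' : ℤ) (h : a + m = m') :
    hdim Φ m (X⟦a⟧) = hdim Φ m' X := by
  refine finrank_of_iso ?_
  exact (HomotopyCategory.homologyFunctor _ _ m).mapIso
    (((Φ.mapHomotopyCategory (.up ℤ)).commShiftIso a).app X) ≪≫
    ((HomotopyCategory.homologyFunctor (ModuleCat.{u} k) (.up ℤ) 0).shiftIso a m m' h).app _

/-- Dimension count in the exact sequence H^m X → H^m Y → H^m Z → H^{m+1} X → H^{m+1} Y. -/
lemma hdim_triangle [HasZeroObject C] [HasBinaryBiproducts C] [∀ M, Module.Finite k (Φ.obj M)]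
    {X Y Z : HomotopyCategory C (.up ℤ)} {f : X ⟶ Y} {g : Y ⟶ Z} {h : Z ⟶ X⟦(1 : ℤ)⟧}
    (hT : Triangle.mk f g h ∈ distTriang (HomotopyCategory C (.up ℤ))) :
    hdim Φ m Z + rk ((H Φ m).map f) + rk ((H Φ (m + 1)).map f) =
      hdim Φ m Y + hdim Φ (m + 1) X := by
  have hT' := (Φ.mapHomotopyCategory (.up ℤ)).map_distinguished _ hT
  have h₂ := (HomotopyCategory.homologyFunctor (ModuleCat.{u} k) (.up ℤ) 0).homologySequence_exact₂
    _ hT' m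
  have h₃ := (HomotopyCategory.homologyFunctor (ModuleCat.{u} k) (.up ℤ) 0).homologySequence_exact₃
    _ hT' m (m + 1) rfl
  have h₁ := (HomotopyCategory.homologyFunctor (ModuleCat.{u} k) (.up ℤ) 0).homologySequence_exact₁
    _ hT' m (m + 1) rfl
  have i1 : Module.Finite k ((H Φ m).obj Y) := inferInstance
  have i2 : Module.Finite k ((H Φ m).obj Z) := inferInstance
  have i3 : Module.Finite k ((H Φ (m + 1)).obj X) := inferInstance
  exact @finrank_of_exact k _ _ _ _ _ _ _ _ _ _ _ _ _ h₂ h₃ h₁ i1 i2 i3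

lemma hdim_shortExact (S : ShortComplex (C ⥤ ModuleCat.{u} k)) [S.X₁.Additive] [S.X₂.Additive]
    [S.X₃.Additive] [∀ M, Module.Finite k (S.X₁.obj M)] [∀ M, Module.Finite k (S.X₂.obj M)]
    [∀ M, Module.Finite k (S.X₃.obj M)]
    (hS : ∀ M, (S.map ((evaluation _ _).obj M)).ShortExact) (X : HomotopyCategory C (.up ℤ)) :
    hdim S.X₁ (m + 1) X + rk ((HMap S.g m).app X) + rk ((HMap S.g (m + 1)).app X) =
      hdim S.X₃ m X + hdim S.X₂ (m + 1) X := by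
  obtain ⟨K, rfl⟩ := HomotopyCategory.quotient_obj_surjective X
  have w : (NatTrans.mapHomologicalComplex S.f (.up ℤ)).app K ≫
      (NatTrans.mapHomologicalComplex S.g (.up ℤ)).app K = 0 := by
    ext m : 1
    exact congrArg (fun τ => NatTrans.app τ (K.X m)) S.zero
  have hK : (ShortComplex.mk _ _ w).ShortExact :=
    HomologicalComplex.shortExact_of_degreewise_shortExact _ fun m => hS (K.X m)
  have h₂ := hK.homology_exact₂ m
  have h₃ := hK.homology_exact₃ m (m + 1) rfl
  have h₁ := hK.homology_exact₁ m (m + 1) rfl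
  have h₂' := hK.homology_exact₂ (m + 1)
  have i1 : Module.Finite k (((S.X₃.mapHomologicalComplex (.up ℤ)).obj K).homology m) :=
    Module.Finite.equiv (HIso S.X₃ m K).toLinearEquiv
  have i2 : Module.Finite k (((S.X₁.mapHomologicalComplex (.up ℤ)).obj K).homology (m + 1)) :=
    Module.Finite.equiv (HIso S.X₁ (m + 1) K).toLinearEquiv
  have i3 : Module.Finite k (((S.X₂.mapHomologicalComplex (.up ℤ)).obj K).homology (m + 1)) :=
    Module.Finite.equiv (HIso S.X₂ (m + 1) K).toLinearEquiv
  have key := @finrank_of_exact k _ _ _ _ _ _ _ _ _ _ _ _ _ h₃ h₁ h₂' i1 i2 i3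
  have e1 := rk_of_iso (HIso S.X₂ m K) (HIso S.X₃ m K) _ _ (HIso_HMap m S.g K)
  have e2 := rk_of_iso (HIso S.X₂ (m + 1) K) (HIso S.X₃ (m + 1) K) _ _ (HIso_HMap (m + 1) S.g K)
  rw [e1, e2, hdim, hdim, hdim, finrank_of_iso (HIso S.X₁ (m + 1) K),
    finrank_of_iso (HIso S.X₂ (m + 1) K), finrank_of_iso (HIso S.X₃ m K)]
  exact key

end Homology

/-! ### Functoriality in the coefficient functor -/

section Homology

variable {k : Type u} [Field k] {C : Type*} [Category* C] [Preadditive C]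

lemma HMap_comp {Φ Φ' Φ'' : C ⥤ ModuleCat.{u} k} [Φ.Additive] [Φ'.Additive] [Φ''.Additive]
    (τ : Φ ⟶ Φ') (τ' : Φ' ⟶ Φ'') (m : ℤ) : HMap (τ ≫ τ') m = HMap τ m ≫ HMap τ' m := by
  ext X : 2
  exact (HomotopyCategory.homologyFunctor (ModuleCat.{u} k) (.up ℤ) m).map_comp
    ((NatTrans.mapHomotopyCategory τ _).app X) ((NatTrans.mapHomotopyCategory τ' _).app X)

lemma HMap_id (Φ : C ⥤ ModuleCat.{u} k) [Φ.Additive] (m : ℤ) : HMap (𝟙 Φ) m = 𝟙 _ := by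
  ext X : 2
  exact (HomotopyCategory.homologyFunctor _ _ m).map_id _

lemma HMap_add {Φ Φ' : C ⥤ ModuleCat.{u} k} [Φ.Additive] [Φ'.Additive]
    (τ τ' : Φ ⟶ Φ') (m : ℤ) : HMap (τ + τ') m = HMap τ m + HMap τ' m := by
  ext X : 2
  refine Eq.trans ?_ (HomotopyCategory.homologyFunctor _ _ m).map_add
  refine congrArg (HomotopyCategory.homologyFunctor _ _ m).map ?_
  exact ((HomotopyCategory.quotient _ _).map_add (f := (NatTrans.mapHomologicalComplex τ _).app X.as)
    (g := (NatTrans.mapHomologicalComplex τ' _).app X.as))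

/-- A natural isomorphism induces isomorphisms on cohomology. -/
def HMapIso {Φ Φ' : C ⥤ ModuleCat.{u} k} [Φ.Additive] [Φ'.Additive] (τ : Φ ≅ Φ') (m : ℤ) :
    H Φ m ≅ H Φ' m where
  hom := HMap τ.hom m
  inv := HMap τ.inv m
  hom_inv_id := by rw [← HMap_comp, τ.hom_inv_id, HMap_id]
  inv_hom_id := by rw [← HMap_comp, τ.inv_hom_id, HMap_id]

lemma hdim_eq_zero_of_forall (Φ : C ⥤ ModuleCat.{u} k) [Φ.Additive] (m : ℤ)
    (X : HomotopyCategory C (.up ℤ)) (h : ∀ x : Φ.obj (X.as.X m), x = 0) : hdim Φ m X = 0 := by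
  obtain ⟨K, rfl⟩ := HomotopyCategory.quotient_obj_surjective X
  have : Subsingleton (((Φ.mapHomologicalComplex (.up ℤ)).obj K).homology m) := by
    refine ⟨fun a b => ?_⟩
    obtain ⟨x, rfl⟩ := toHomology_surjective _ m a
    obtain ⟨y, rfl⟩ := toHomology_surjective _ m b
    rw [show x = y from Subtype.ext ((h x.1).trans (h y.1).symm)]
  exact (finrank_of_iso (HIso Φ m K)).trans (Module.finrank_zero_of_subsingleton)

end Homology

/-! ### Cohomology of `E`, `T`, `R`, `W` and of the cone of f_i -/

namespace GrProj

open Pretriangulated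

variable {k : Type u} [Field k] {n : ℕ}

instance (i : Fin n) (d : ℤ) (M : GrProj k n) : Module.Finite k ((E k i d).obj M) :=
  inferInstanceAs (Module.Finite k (eSub i d M))
instance (i : Fin n) (d : ℤ) (M : GrProj k n) : Module.Finite k ((T k i d).obj M) :=
  inferInstanceAs (Module.Finite k (zSub i d M))
instance (i : Fin n) (d : ℤ) (M : GrProj k n) : Module.Finite k ((R k i d).obj M) :=
  inferInstanceAs (Module.Finite k (rSub i d M))
instance (i : Fin n) (d : ℤ) (M : GrProj k n) : Module.Finite k ((W k i d).obj M) :=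
  inferInstanceAs (Module.Finite k (∀ t : {j : Fin n // j ≠ i} × Bool, zSub t.1.1 (d - 1) M))

/-- The rank of multiplication by `z_i` on cohomology. -/
def loopRank (i : Fin n) (m d : ℤ) (X : Ho k n) : ℕ := rk ((HMap (eToT k i d) m).app X)

lemma hdim_bimodHo (i : Fin n) (m d : ℤ) (X : Ho k n) :
    hdim (T k i d) m ((bimodHo i 0).obj X) = hdim (E k i d) m X :=
  (finrank_of_iso ((HMapIso (asIso (eToTBimod k i d)) m).app X)).symm

lemma rk_evHo (i : Fin n) (m d : ℤ) (X : Ho k n) :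
    rk ((H (T k i d) m).map (evHo i X)) = loopRank i m d X := by
  refine (rk_of_iso ((HMapIso (asIso (eToTBimod k i d)) m).app X) (Iso.refl _) _ _ ?_).symm
  rw [← eToTBimod_eval, HMap_comp]
  exact (Category.comp_id _).symm

lemma hdim_T_cone (i : Fin n) (m d : ℤ) (X : Ho k n) :
    hdim (T k i d) m ((coneHomotopy (evalTrans k i)).obj X) + loopRank i m d X +
      loopRank i (m + 1) d X = hdim (T k i d) m X + hdim (E k i d) (m + 1) X := by
  obtain ⟨a, b, hT⟩ := exists_evHo_triangle i X
  have := hdim_triangle (T k i d) m hT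
  rwa [rk_evHo, rk_evHo, hdim_bimodHo] at this

lemma loopRank_le (i : Fin n) (m d : ℤ) (X : Ho k n) : loopRank i m d X ≤ hdim (E k i d) m X :=
  rk_le_left _

lemma hdim_R (i : Fin n) (m d : ℤ) (X : Ho k n) :
    hdim (R k i d) (m + 1) X + loopRank i m d X + loopRank i (m + 1) d X =
      hdim (T k i d) m X + hdim (E k i d) (m + 1) X := by
  have i1 : (seqE (k := k) i d).X₁.Additive := inferInstanceAs (R k i d).Additive
  have i2 : (seqE (k := k) i d).X₂.Additive := inferInstanceAs (E k i d).Additive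
  have i3 : (seqE (k := k) i d).X₃.Additive := inferInstanceAs (T k i d).Additive
  have j1 : ∀ M, Module.Finite k ((seqE (k := k) i d).X₁.obj M) :=
    inferInstanceAs (∀ M, Module.Finite k ((R k i d).obj M))
  have j2 : ∀ M, Module.Finite k ((seqE (k := k) i d).X₂.obj M) :=
    inferInstanceAs (∀ M, Module.Finite k ((E k i d).obj M))
  have j3 : ∀ M, Module.Finite k ((seqE (k := k) i d).X₃.obj M) :=
    inferInstanceAs (∀ M, Module.Finite k ((T k i d).obj M))
  exact hdim_shortExact m (seqE i d) (seqE_shortExact i d) X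

/-- On z_i-parts the cone of f_i is the cone of multiplication by z_i from `E` onto `T`, hence the
shift of its kernel `R`. Numerically, both dimensions satisfy the same rank formula. -/
lemma hdim_T_cone_eq (i : Fin n) (m d : ℤ) (X : Ho k n) :
    hdim (T k i d) m ((coneHomotopy (evalTrans k i)).obj X) = hdim (R k i d) (m + 1) X := by
  have h1 := hdim_T_cone i m d X
  have h2 := hdim_R i m d X
  omega

/-- The bimodule term contributes nothing at a vertex l ≠ i, so the cone keeps the cohomology of X
there. -/
lemma hdim_T_cone_of_ne {i l : Fin n} (h : l ≠ i) (m d : ℤ) (X : Ho k n) :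
    hdim (T k l d) m ((coneHomotopy (evalTrans k i)).obj X) = hdim (T k l d) m X := by
  have h0 : ∀ m, hdim (T k l d) m ((bimodHo i 0).obj X) = 0 := fun m =>
    hdim_eq_zero_of_forall _ _ _ fun x =>
      Subtype.ext (T_isZero_bimod h d 0 (X.as.X m) x.1 x.2)
  obtain ⟨a, b, hT⟩ := exists_evHo_triangle i X
  have h1 := hdim_triangle (T k l d) m hT
  have h2 := rk_le_left ((H (T k l d) m).map (evHo i X))
  have h3 := rk_le_left ((H (T k l d) (m + 1)).map (evHo i X))
  have h4 := h0 m
  have h5 := h0 (m + 1)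
  unfold hdim at *
  omega

variable (k) in
/-- The projections from `W`. -/
def wToT (i : Fin n) (d : ℤ) (t : {j : Fin n // j ≠ i} × Bool) : W k i d ⟶ T k t.1.1 (d - 1) where
  app M := ModuleCat.ofHom (LinearMap.proj t)

open Classical in
variable (k) in
/-- The injections to `W`. -/
def tToW (i : Fin n) (d : ℤ) (t : {j : Fin n // j ≠ i} × Bool) : T k t.1.1 (d - 1) ⟶ W k i d where
  app M := ModuleCat.ofHom (LinearMap.single k (fun t : {j : Fin n // j ≠ i} × Bool =>
    zSub t.1.1 (d - 1) M) t)
  naturality M N f := by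
    ext x
    funext t'
    by_cases h : t' = t
    · subst h
      exact (Pi.single_eq_same (M := fun t : {j : Fin n // j ≠ i} × Bool => zSub t.1.1 (d - 1) N)
        t' _).trans (congrArg ((T k t'.1.1 (d - 1)).map f).hom (Pi.single_eq_same
        (M := fun t : {j : Fin n // j ≠ i} × Bool => zSub t.1.1 (d - 1) M) t' x).symm)
    · exact (Pi.single_eq_of_ne (M := fun t : {j : Fin n // j ≠ i} × Bool => zSub t.1.1 (d - 1) N)
        h _).trans (((congrArg ((T k t'.1.1 (d - 1)).map f).hom (Pi.single_eq_of_ne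
        (M := fun t : {j : Fin n // j ≠ i} × Bool => zSub t.1.1 (d - 1) M) h x)).trans
        (map_zero _)).symm)

lemma tToW_wToT (i : Fin n) (d : ℤ) (t : {j : Fin n // j ≠ i} × Bool) :
    tToW k i d t ≫ wToT k i d t = 𝟙 _ := by
  ext M x
  exact Pi.single_eq_same (M := fun t : {j : Fin n // j ≠ i} × Bool => zSub t.1.1 (d - 1) M) t x

lemma tToW_wToT_of_ne (i : Fin n) (d : ℤ) {t t' : {j : Fin n // j ≠ i} × Bool} (h : t' ≠ t) :
    tToW k i d t ≫ wToT k i d t' = 0 := by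
  ext M x
  exact Pi.single_eq_of_ne (M := fun t : {j : Fin n // j ≠ i} × Bool => zSub t.1.1 (d - 1) M) h x

lemma sum_wToT_tToW (i : Fin n) (d : ℤ) : ∑ t, wToT k i d t ≫ tToW k i d t = 𝟙 _ := by
  ext M w
  rw [NatTrans.app_sum]
  rw [ModuleCat.hom_sum, LinearMap.sum_apply]
  exact Finset.univ_sum_single (M := fun t : {j : Fin n // j ≠ i} × Bool => zSub t.1.1 (d - 1) M) w

lemma HMap_zero {Φ Φ' : GrProj k n ⥤ ModuleCat.{u} k} [Φ.Additive] [Φ'.Additive] (m : ℤ) :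
    HMap (0 : Φ ⟶ Φ') m = 0 := by
  have := HMap_add (0 : Φ ⟶ Φ') 0 m
  rwa [add_zero, left_eq_add] at this

lemma HMap_sum {Φ Φ' : GrProj k n ⥤ ModuleCat.{u} k} [Φ.Additive] [Φ'.Additive] {ι : Type*}
    (s : Finset ι) (τ : ι → (Φ ⟶ Φ')) (m : ℤ) : HMap (∑ t ∈ s, τ t) m = ∑ t ∈ s, HMap (τ t) m := by
  classical
  induction s using Finset.induction_on with
  | empty => exact HMap_zero m
  | insert a s ha ih => rw [Finset.sum_insert ha, Finset.sum_insert ha, HMap_add, ih]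

lemma hdim_W (i : Fin n) (m d : ℤ) (X : Ho k n) :
    hdim (W k i d) m X =
      ∑ t : {j : Fin n // j ≠ i} × Bool, hdim (T k t.1.1 (d - 1)) m X := by
  classical
  let e : (H (W k i d) m).obj X ≃ₗ[k]
      (∀ t : {j : Fin n // j ≠ i} × Bool, (H (T k t.1.1 (d - 1)) m).obj X) :=
    LinearEquiv.ofLinearMap (LinearMap.pi fun t => ((HMap (wToT k i d t) m).app X).hom)
      (∑ t, ((HMap (tToW k i d t) m).app X).hom ∘ₗ LinearMap.proj t)
      (by
        refine LinearMap.pi_ext' fun t => LinearMap.ext fun x => funext fun t' => ?_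
        simp only [LinearMap.comp_apply, LinearMap.sum_apply, LinearMap.pi_apply, map_sum,
          LinearMap.proj_apply, LinearMap.id_apply, LinearMap.single_apply]
        rw [Finset.sum_eq_single t]
        · rw [Pi.single_eq_same]
          have h1 : ((HMap (tToW k i d t) m).app X ≫ (HMap (wToT k i d t') m).app X).hom x =
              (show (H (T k t'.1.1 (d - 1)) m).obj X from
                Pi.single (M := fun t : {j : Fin n // j ≠ i} × Bool =>
                  (H (T k t.1.1 (d - 1)) m).obj X) t x t') := by
            rw [← NatTrans.comp_app, ← HMap_comp]
            by_cases h : t' = t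
            · subst h
              rw [tToW_wToT, HMap_id, Pi.single_eq_same]
              rfl
            · rw [tToW_wToT_of_ne i d h, HMap_zero, Pi.single_eq_of_ne h]
              rfl
          exact h1
        · intro b _ hb
          rw [Pi.single_eq_of_ne hb, map_zero, map_zero]
        · simp)
      (by
        have h := congrArg (fun τ : H (W k i d) m ⟶ H (W k i d) m => (τ.app X).hom)
          ((HMap_sum Finset.univ (fun t => wToT k i d t ≫ tToW k i d t) m).symm.trans
            ((congrArg (HMap · m) (sum_wToT_tToW i d)).trans (HMap_id _ m)))
        refine LinearMap.ext fun x => Eq.trans ?_ (LinearMap.congr_fun h x)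
        simp only [NatTrans.app_sum, ModuleCat.hom_sum, LinearMap.sum_apply, LinearMap.comp_apply,
          HMap_comp]
        rfl)
  exact e.finrank_eq.trans (Module.finrank_pi_fintype k)

/-- The numbers r and r' are the ranks of R → W on cohomology in degrees m and m + 1; only their
upper bounds matter later. -/
lemma hdim_T_R_W (i : Fin n) (m d : ℤ) (X : Ho k n) :
    ∃ r r' : ℕ, r ≤ hdim (R k i d) m X ∧ r ≤ hdim (W k i d) m X ∧
      r' ≤ hdim (R k i d) (m + 1) X ∧ r' ≤ hdim (W k i d) (m + 1) X ∧
      hdim (T k i (d - 2)) (m + 1) X + r + r' = hdim (W k i d) m X + hdim (R k i d) (m + 1) X := by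
  have i1 : (seqR (k := k) i d).X₁.Additive := inferInstanceAs (T k i (d - 2)).Additive
  have i2 : (seqR (k := k) i d).X₂.Additive := inferInstanceAs (R k i d).Additive
  have i3 : (seqR (k := k) i d).X₃.Additive := inferInstanceAs (W k i d).Additive
  have j1 : ∀ M, Module.Finite k ((seqR (k := k) i d).X₁.obj M) :=
    inferInstanceAs (∀ M, Module.Finite k ((T k i (d - 2)).obj M))
  have j2 : ∀ M, Module.Finite k ((seqR (k := k) i d).X₂.obj M) :=
    inferInstanceAs (∀ M, Module.Finite k ((R k i d).obj M))
  have j3 : ∀ M, Module.Finite k ((seqR (k := k) i d).X₃.obj M) :=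
    inferInstanceAs (∀ M, Module.Finite k ((W k i d).obj M))
  exact ⟨_, _, rk_le_left _, rk_le_right _, rk_le_left _, rk_le_right _,
    hdim_shortExact m (seqR i d) (seqR_shortExact i d) X⟩

end GrProj

/-! ### Morphisms from the indecomposable projective modules -/

namespace GrProj

open Zigzag

variable {k : Type u} [Field k] {n : ℕ}

/-- The map `P_j⟨-d⟩ ⟶ M` sending the generator to `v`. -/
def fromP {j : Fin n} {d : ℤ} {M : GrProj k n} (v : eSub j d M) : P k j (-d) ⟶ M :=
  ofHom (M := P k j (-d)) ((LinearMap.toSpanSingleton (Zigzag k n) M.carrier v.1) ∘ₗ (ideal k j).subtype)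
    fun d' a ha => by
      have := M.smul_mem (d' + -d) d (show ideal k j from a).1 v.1 ha v.2.2
      rwa [neg_add_cancel_right] at this

lemma lin_fromP {j : Fin n} {d : ℤ} {M : GrProj k n} (v : eSub j d M) :
    lin (fromP v) (idE k j) = v.1 := v.2.1

lemma P_hom_ext {j : Fin n} {r : ℤ} {M : GrProj k n} {f g : P k j r ⟶ M}
    (h : lin f (idE k j) = lin g (idE k j)) : f = g := by
  refine hom_ext fun a => ?_
  have ha : a = (show ideal k j from a).1 • (show (P k j r).carrier from idE k j) :=
    (smul_idE (show ideal k j from a)).symm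
  rw [ha, map_smul, map_smul, h]

lemma idE_mem (j : Fin n) (d : ℤ) : idE k j ∈ eSub j d (P k j (-d)) :=
  ⟨mem_corner.2 (smul_idE (idE k j)), by
    change e k j ∈ grade k n (d + -d)
    rw [add_neg_cancel]
    exact e_mem_grade k j⟩

lemma fromP_comp {j : Fin n} {d : ℤ} {M N : GrProj k n} (v : eSub j d M) (f : M ⟶ N) :
    fromP v ≫ f = fromP ⟨lin f v.1, lin_mem_eSub f v.1 v.2⟩ :=
  P_hom_ext ((congrArg (lin f) (lin_fromP v)).trans
    (lin_fromP ⟨lin f v.1, lin_mem_eSub f v.1 v.2⟩).symm)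

lemma exists_fromP {j : Fin n} {d : ℤ} {M : GrProj k n} (f : P k j (-d) ⟶ M) :
    ∃ v : eSub j d M, f = fromP v :=
  ⟨⟨lin f (idE k j), lin_mem_eSub f _ (idE_mem j d)⟩,
    P_hom_ext (lin_fromP ⟨lin f (idE k j), lin_mem_eSub f _ (idE_mem j d)⟩).symm⟩

lemma fromP_zero {j : Fin n} {d : ℤ} {M : GrProj k n} : fromP (0 : eSub j d M) = 0 :=
  P_hom_ext (lin_fromP _)

variable (k) in
/-- The complex `P_j⟨-d⟩` concentrated in cohomological degree `m`. -/
def singleP (j : Fin n) (m d : ℤ) : CochainComplex (GrProj k n) ℤ :=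
  (HomologicalComplex.single _ (.up ℤ) m).obj (P k j (-d))

variable (k) in
/-- The class of `singleP` in the homotopy category. -/
def singleHo (j : Fin n) (m d : ℤ) : Ho k n :=
  (HomotopyCategory.quotient _ _).obj (singleP k j m d)

/-- The identification of the term of degree `m`. -/
def singlePIso (j : Fin n) (m d : ℤ) : (singleP k j m d).X m ≅ P k j (-d) :=
  HomologicalComplex.singleObjXSelf (.up ℤ) m (P k j (-d))

/-- P_j⟨-d⟩ represents M ↦ e_j M_d, so a cocycle representing the class is a chain map from the
one-term complex, and the class of e_j is its source. -/
lemma exists_singleHo_hom {j : Fin n} {m d : ℤ} {X : Ho k n} (a : (H (E k j d) m).obj X) :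
    ∃ (f : singleHo k j m d ⟶ X) (g : (H (E k j d) m).obj (singleHo k j m d)),
      ((H (E k j d) m).map f).hom g = a := by
  obtain ⟨K, rfl⟩ := HomotopyCategory.quotient_obj_surjective X
  obtain ⟨v, hv⟩ := toHomology_surjective _ _ ((HIso (E k j d) m K).hom.hom a)
  let v' : eSub j d (K.X m) := v.1
  have hd : fromP v' ≫ K.d m (m + 1) = 0 := by
    rw [fromP_comp, ← fromP_zero]
    exact congrArg fromP v.2
  let φ : singleP k j m d ⟶ K := HomologicalComplex.mkHomFromSingle (fromP v') (by
    rintro _ rfl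
    exact hd)
  have hφ : (singlePIso j m d).inv ≫ φ.f m = fromP v' := by
    rw [HomologicalComplex.mkHomFromSingle_f]
    exact Iso.inv_hom_id_assoc _ _
  let L := ((E k j d).mapHomologicalComplex (.up ℤ)).obj (singleP k j m d)
  let u : LinearMap.ker (L.d m (m + 1)).hom :=
    ⟨((E k j d).map (singlePIso j m d).inv).hom ⟨idE k j, idE_mem j d⟩, by
      have : L.d m (m + 1) = 0 := (E k j d).map_zero _ _
      rw [this]
      rfl⟩
  refine ⟨(HomotopyCategory.quotient _ _).map φ, (HIso (E k j d) m _).inv.hom (toHomology L m u), ?_⟩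
  apply (ConcreteCategory.bijective_of_isIso (HIso (E k j d) m K).hom).1
  have h1 := LinearMap.congr_fun (congrArg ModuleCat.Hom.hom (HIso_naturality (E k j d) m φ))
    ((HIso (E k j d) m _).inv.hom (toHomology L m u))
  refine h1.symm.trans (Eq.trans ?_ hv)
  have h2 : (HIso (E k j d) m (singleP k j m d)).hom.hom
      ((HIso (E k j d) m _).inv.hom (toHomology L m u)) = toHomology L m u :=
    LinearMap.congr_fun (congrArg ModuleCat.Hom.hom (HIso (E k j d) m (singleP k j m d)).inv_hom_id) _
  refine (congrArg (HomologicalComplex.homologyMap (((E k j d).mapHomologicalComplex (.up ℤ)).map φ)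
    m).hom h2).trans ((homologyMap_toHomology _ m u).trans (congrArg _ (Subtype.ext ?_)))
  have h3 : lin ((singlePIso j m d).inv ≫ φ.f m) (idE k j) = v'.1 := by
    rw [hφ]
    exact lin_fromP v'
  exact Subtype.ext h3

/-- The converse half of the same representability: a chain map is a cocycle, and writing that
cocycle as a coboundary gives a null-homotopy. -/
lemma singleHo_hom_eq_zero {j : Fin n} {m d : ℤ} {X : Ho k n} (hX : hdim (E k j d) m X = 0)
    (f : singleHo k j m d ⟶ X) : f = 0 := by
  obtain ⟨K, rfl⟩ := HomotopyCategory.quotient_obj_surjective X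
  obtain ⟨φ : singleP k j m d ⟶ K, rfl⟩ := (HomotopyCategory.quotient _ _).map_surjective f
  obtain ⟨v, hv⟩ := exists_fromP ((singlePIso j m d).inv ≫ φ.f m)
  have hd : lin (K.d m (m + 1)) v.1 = 0 := by
    have h1 : ((singlePIso j m d).inv ≫ φ.f m) ≫ K.d m (m + 1) = 0 := by
      rw [Category.assoc, φ.comm]
      have : (singleP k j m d).d m (m + 1) = 0 := rfl
      rw [this, zero_comp, comp_zero]
    rw [hv, fromP_comp] at h1
    exact (lin_fromP _).symm.trans (congrArg (fun f => lin f (idE k j)) h1)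
  let L := ((E k j d).mapHomologicalComplex (.up ℤ)).obj K
  let v' : LinearMap.ker (L.d m (m + 1)).hom := ⟨v, Subtype.ext hd⟩
  have : Subsingleton (L.homology m) := by
    have i1 : Module.Finite k (L.homology m) := Module.Finite.equiv (HIso (E k j d) m K).toLinearEquiv
    rw [← Module.finrank_zero_iff (R := k), ← finrank_of_iso (HIso (E k j d) m K)]
    exact hX
  obtain ⟨w, hw⟩ := (toHomology_eq_zero_iff L m v').1 (Subsingleton.elim _ _)
  let w' : eSub j d (K.X (m - 1)) := w
  -- The source lives in degree m only, so the homotopy is the map given by a preimage of the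
  -- cocycle in degree m - 1, and zero elsewhere.
  have hφ : φ = Homotopy.nullHomotopicMap' (c := .up ℤ) fun i l hil =>
      if h : i = m then (HomologicalComplex.singleObjXIsoOfEq (.up ℤ) m (P k j (-d)) i h).hom ≫
        fromP w' ≫ (K.XIsoOfEq (show m - 1 = l by have : l + 1 = i := hil; omega)).hom else 0 := by
    apply HomologicalComplex.from_single_hom_ext
    rw [Homotopy.nullHomotopicMap'_f (k₂ := m - 1) (k₁ := m) (k₀ := m + 1) (by simp) (by simp)]
    rw [dif_pos rfl]
    have h1 : fromP w' ≫ K.d (m - 1) m = (singlePIso j m d).inv ≫ φ.f m := by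
      rw [hv, fromP_comp]
      exact congrArg fromP hw
    simp only [HomologicalComplex.XIsoOfEq_rfl, Iso.refl_hom, Category.comp_id, Category.assoc,
      HomologicalComplex.single_obj_d, zero_comp, zero_add]
    rw [h1]
    exact (Iso.hom_inv_id_assoc (singlePIso j m d) (φ.f m)).symm
  have key := HomotopyCategory.eq_of_homotopy _ _ (Homotopy.nullHomotopy' (c := .up ℤ)
    (C := singleP k j m d) (D := K) fun i l hil =>
      if h : i = m then (HomologicalComplex.singleObjXIsoOfEq (.up ℤ) m (P k j (-d)) i h).hom ≫
        fromP w' ≫ (K.XIsoOfEq (show m - 1 = l by have : l + 1 = i := hil; omega)).hom else 0)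
  rw [Functor.map_zero] at key
  rw [hφ]
  exact key

lemma hdim_le_finrank (Φ : GrProj k n ⥤ ModuleCat.{u} k) [Φ.Additive] (m : ℤ)
    (K : CochainComplex (GrProj k n) ℤ) [∀ M, Module.Finite k (Φ.obj M)] :
    hdim Φ m ((HomotopyCategory.quotient _ _).obj K) ≤ Module.finrank k (Φ.obj (K.X m)) := by
  have i1 : Module.Finite k (((Φ.mapHomologicalComplex (.up ℤ)).obj K).X m) :=
    inferInstanceAs (Module.Finite k (Φ.obj (K.X m)))
  rw [hdim, finrank_of_iso (HIso Φ m K)]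
  exact (LinearMap.finrank_le_finrank_of_surjective
    (toHomology_surjective ((Φ.mapHomologicalComplex (.up ℤ)).obj K) m)).trans
    (Submodule.finrank_le _)

lemma hdim_singleHo_le (j j' : Fin n) (m m' d d' : ℤ) :
    hdim (T k j' d') m' (singleHo k j m d) ≤ if j' = j ∧ m' = m ∧ d' = d then 1 else 0 := by
  refine (hdim_le_finrank _ _ _).trans ?_
  by_cases hm : m' = m
  · subst hm
    rw [finrank_of_iso ((T k j' d').mapIso (singlePIso (k := k) j m' d))]
    refine (finrank_zSub_P j' j (-d) d').le.trans ?_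
    have : (j' = j ∧ d' + -d = 0) ↔ (j' = j ∧ m' = m' ∧ d' = d) := by
      constructor <;> (rintro ⟨h, h'⟩; refine ⟨h, ?_⟩; omega)
    simp only [this]
    exact le_rfl
  · have h0 := (T k j' d').map_isZero
      (HomologicalComplex.isZero_single_obj_X (.up ℤ) m (P k j (-d)) m' hm)
    have : Subsingleton ((T k j' d').obj ((singleP k j m d).X m')) :=
      ModuleCat.subsingleton_of_isZero h0
    rw [Module.finrank_zero_of_subsingleton]
    exact Nat.zero_le _

lemma hdim_singleHo_self (j : Fin n) (m d : ℤ) : hdim (T k j d) m (singleHo k j m d) = 1 := by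
  refine le_antisymm ((hdim_singleHo_le j j m m d d).trans (by simp)) ?_
  rw [Nat.one_le_iff_ne_zero]
  intro h0
  let L := ((T k j d).mapHomologicalComplex (.up ℤ)).obj (singleP k j m d)
  have i1 : Module.Finite k (L.homology m) :=
    Module.Finite.equiv (HIso (T k j d) m (singleP k j m d)).toLinearEquiv
  have : Subsingleton (L.homology m) := by
    rw [← Module.finrank_zero_iff (R := k), ← finrank_of_iso (HIso (T k j d) m (singleP k j m d))]
    exact h0
  have h1 : ∀ x : L.X m, x = 0 := fun x => by
    have hd : ∀ a b, L.d a b = 0 := fun _ _ => (T k j d).map_zero _ _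
    obtain ⟨y, hy⟩ := (toHomology_eq_zero_iff L m ⟨x, by rw [hd]; rfl⟩).1 (Subsingleton.elim _ _)
    rw [hd] at hy
    exact hy.symm
  have h2 : Module.finrank k ((T k j d).obj ((singleP k j m d).X m)) = 0 := by
    have : Subsingleton ((T k j d).obj ((singleP k j m d).X m)) :=
      ⟨fun a b => (h1 a).trans (h1 b).symm⟩
    exact Module.finrank_zero_of_subsingleton
  rw [finrank_of_iso ((T k j d).mapIso (singlePIso (k := k) j m d))] at h2
  have h3 := (finrank_zSub_P (k := k) j j (-d) d).symm.trans h2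
  rw [if_pos ⟨rfl, by omega⟩] at h3
  exact one_ne_zero h3

end GrProj

/-! ### Complexes without tops are contractible -/

namespace GrProj

open Zigzag

variable {k : Type u} [Field k] {n : ℕ}

lemma exists_degree_bound (M : GrProj k n) : ∃ s : Finset ℤ, ∀ d ∉ s, M.gr d = ⊥ := by
  have h : {d | M.gr d ≠ ⊥}.Finite :=
    WellFoundedGT.finite_ne_bot_of_iSupIndep M.internal.submodule_iSupIndep
  exact ⟨h.toFinset, fun d hd => by simpa using hd⟩

lemma eq_sum_pr (M : GrProj k n) {s : Finset ℤ} (hs : ∀ d ∉ s, M.gr d = ⊥) (x : M.carrier) :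
    x = ∑ d ∈ s, pr M d x := by
  refine gr_induction M (p := fun x => x = ∑ d ∈ s, pr M d x) ?_ ?_ ?_ x
  · intro e x hx
    by_cases he : e ∈ s
    · rw [Finset.sum_eq_single_of_mem e he fun b _ hb => pr_of_mem_ne M hb.symm hx, pr_of_mem M hx]
    · rw [hs e he] at hx
      rw [(Submodule.mem_bot k).1 hx]
      simp
  · simp
  · intro x y hx hy
    simp only [map_add, Finset.sum_add_distrib, ← hx, ← hy]

/-- Only finitely many homogeneous components of M are non-zero, so the sum of the degree-preserving
pieces of h is finite; linearity is checked on homogeneous elements. -/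
lemma exists_degree_zero_part {M N : GrProj k n} (h : M.carrier →ₗ[Zigzag k n] N.carrier) :
    ∃ f : M ⟶ N, ∀ d, ∀ x ∈ M.gr d, lin f x = pr N d (h x) := by
  obtain ⟨s, hs⟩ := exists_degree_bound M
  let h₀ : M.carrier →ₗ[k] N.carrier := ∑ d ∈ s, pr N d ∘ₗ h.restrictScalars k ∘ₗ pr M d
  have h₀_apply : ∀ d, ∀ x ∈ M.gr d, h₀ x = pr N d (h x) := by
    intro d x hx
    by_cases hd : d ∈ s
    · simp only [h₀, LinearMap.sum_apply, LinearMap.comp_apply, LinearMap.restrictScalars_apply]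
      rw [Finset.sum_eq_single_of_mem d hd, pr_of_mem M hx]
      intro b _ hb
      rw [pr_of_mem_ne M hb.symm hx, map_zero, map_zero]
    · rw [hs d hd] at hx
      rw [(Submodule.mem_bot k).1 hx, map_zero, map_zero, map_zero]
  have hsmul : ∀ (a : Zigzag k n) (x : M.carrier), h₀ (a • x) = a • h₀ x := by
    intro a x
    have ha : a ∈ ⨆ d, grade k n d := by
      rw [iSup_eq_top_of_internal (internal_grade k)]; trivial
    refine Submodule.iSup_induction _ (motive := fun a => h₀ (a • x) = a • h₀ x) ha ?_ ?_ ?_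
    · intro p a ha
      refine gr_induction M (p := fun x => h₀ (a • x) = a • h₀ x) ?_ ?_ ?_ x
      · intro q x hx
        rw [h₀_apply _ _ (M.smul_mem _ _ _ _ ha hx), h₀_apply _ _ hx, map_smul, pr_smul N rfl ha]
      · simp
      · intro x y hx hy; rw [smul_add, map_add, map_add, smul_add, hx, hy]
    · simp
    · intro a b ha hb; rw [add_smul, map_add, ha, hb, add_smul]
  exact ⟨ofHom { toFun := h₀, map_add' := map_add h₀, map_smul' := hsmul } fun d x hx => by
    change h₀ x ∈ _
    rw [h₀_apply d x hx]
    exact pr_mem _ _ _, h₀_apply⟩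

variable (k n) in
/-- The functor forgetting the grading. -/
def forgetGrading : GrProj k n ⥤ ModuleCat.{u} (Zigzag k n) where
  obj M := ModuleCat.of _ M.carrier
  map f := ModuleCat.ofHom (lin f)

instance : (forgetGrading k n).Additive where
  map_add := rfl

/-- The part of degree zero of a map. -/
def degreeZero {M N : GrProj k n} (h : (forgetGrading k n).obj M ⟶ (forgetGrading k n).obj N) :
    M ⟶ N := (exists_degree_zero_part h.hom).choose

lemma lin_degreeZero {M N : GrProj k n} (h : (forgetGrading k n).obj M ⟶ (forgetGrading k n).obj N)
    {d : ℤ} {x : M.carrier} (hx : x ∈ M.gr d) : lin (degreeZero h) x = pr N d (h.hom x) :=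
  (exists_degree_zero_part h.hom).choose_spec d x hx

lemma hom_ext_gr {M N : GrProj k n} {f g : M ⟶ N} (h : ∀ d, ∀ x ∈ M.gr d, lin f x = lin g x) :
    f = g :=
  hom_ext fun x => gr_induction M (p := fun x => lin f x = lin g x) h (by simp)
    (fun x y hx hy => by rw [map_add, map_add, hx, hy]) x

lemma degreeZero_zero {M N : GrProj k n} :
    degreeZero (0 : (forgetGrading k n).obj M ⟶ (forgetGrading k n).obj N) = 0 :=
  hom_ext_gr fun d _ hx => (lin_degreeZero _ hx).trans (map_zero (pr N d))

lemma eq_of_homotopy_relation {M M' M'' : GrProj k n} (d : M ⟶ M') (d' : M'' ⟶ M)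
    (h : (forgetGrading k n).obj M' ⟶ (forgetGrading k n).obj M)
    (h' : (forgetGrading k n).obj M ⟶ (forgetGrading k n).obj M'')
    (H : 𝟙 _ = (forgetGrading k n).map d ≫ h + h' ≫ (forgetGrading k n).map d') :
    𝟙 M = d ≫ degreeZero h + degreeZero h' ≫ d' := by
  refine hom_ext_gr fun q x hx => ?_
  let g : M'.carrier →ₗ[Zigzag k n] M.carrier := h.hom
  let g' : M.carrier →ₗ[Zigzag k n] M''.carrier := h'.hom
  have h1 : lin (degreeZero h) (lin d x) = pr M q (g (lin d x)) := lin_degreeZero h (lin_mem d hx)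
  have h2 : lin d' (lin (degreeZero h') x) = pr M q (lin d' (g' x)) :=
    (congrArg (lin d') (lin_degreeZero h' hx)).trans (lin_pr d' q (g' x))
  have H' : x = g (lin d x) + lin d' (g' x) :=
    LinearMap.congr_fun (congrArg ModuleCat.Hom.hom H) x
  have h3 : pr M q x = pr M q (g (lin d x)) + pr M q (lin d' (g' x)) := by
    rw [← map_add, ← H']
  exact (pr_of_mem M hx).symm.trans (h3.trans (congrArg₂ (· + ·) h1.symm h2.symm))

/-- R is an extension of the tops at the neighbours in degree d - 1 by z_i M_{d-2}. -/
lemma hdim_R_eq_zero {i : Fin n} {m d : ℤ} {X : Ho k n} (h₁ : hdim (T k i (d - 2)) m X = 0)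
    (h₂ : ∀ l, hdim (T k l (d - 1)) m X = 0) : hdim (R k i d) m X = 0 := by
  obtain ⟨r, r', h⟩ := hdim_T_R_W i (m - 1) d X
  have hW : hdim (W k i d) m X = 0 := by
    rw [hdim_W]
    exact Finset.sum_eq_zero fun t _ => h₂ _
  rw [sub_add_cancel] at h
  omega

lemma hdim_E_le (i : Fin n) (m d : ℤ) (X : Ho k n) :
    hdim (E k i d) m X ≤ hdim (R k i d) m X + hdim (T k i d) m X := by
  have h := hdim_R i (m - 1) d X
  have h₁ : loopRank i (m - 1) d X ≤ hdim (T k i d) (m - 1) X := rk_le_right _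
  have h₂ : loopRank i m d X ≤ hdim (T k i d) m X := rk_le_right _
  rw [sub_add_cancel] at h
  omega

/-- The three layers of e_i M_d are tops in degrees d, d - 1 and d - 2. In a fixed cohomological
degree m these are the slices s, s + 1, s + 2 with s = -(m + d), the source of the range in
`hom_eq_zero`. -/
lemma hdim_E_eq_zero {i : Fin n} {m d : ℤ} {X : Ho k n} (h₀ : hdim (T k i d) m X = 0)
    (h₁ : hdim (T k i (d - 2)) m X = 0) (h₂ : ∀ l, hdim (T k l (d - 1)) m X = 0) :
    hdim (E k i d) m X = 0 := by
  have := hdim_E_le i m d X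
  have := hdim_R_eq_zero h₁ h₂
  omega

/-- A cocycle is the sum of its components e_i x_d, and each of these is a cocycle of the complex
given by `E k i d`. -/
lemma exact_of_hdim_E {K : CochainComplex (GrProj k n) ℤ} {m : ℤ}
    (h : ∀ i d, hdim (E k i d) m ((HomotopyCategory.quotient _ _).obj K) = 0)
    (x : (K.X m).carrier) (hx : lin (K.d m (m + 1)) x = 0) :
    ∃ y, lin (K.d (m - 1) m) y = x := by
  have key : ∀ (i : Fin n) (d : ℤ), ∃ y, lin (K.d (m - 1) m) y = (e k i : Zigzag k n) • pr (K.X m) d x := by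
    intro i d
    let L := ((E k i d).mapHomologicalComplex (.up ℤ)).obj K
    have : Subsingleton (L.homology m) := by
      have i1 : Module.Finite k (L.homology m) :=
        Module.Finite.equiv (HIso (E k i d) m K).toLinearEquiv
      rw [← Module.finrank_zero_iff (R := k), ← finrank_of_iso (HIso (E k i d) m K)]
      exact h i d
    let v : eSub i d (K.X m) := ⟨e k i • pr (K.X m) d x,
      mem_corner.2 (by rw [← mul_smul, e_mul_self]), e_smul_mem (pr_mem _ _ _)⟩
    have hv : lin (K.d m (m + 1)) v.1 = 0 := by
      change lin (K.d m (m + 1)) (e k i • pr (K.X m) d x) = 0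
      rw [map_smul, lin_pr, hx, map_zero, smul_zero]
    obtain ⟨w, hw⟩ := (toHomology_eq_zero_iff L m ⟨v, Subtype.ext hv⟩).1 (Subsingleton.elim _ _)
    exact ⟨(show eSub i d (K.X (m - 1)) from w).1, congrArg Subtype.val hw⟩
  choose y hy using key
  obtain ⟨s, hs⟩ := exists_degree_bound (K.X m)
  refine ⟨∑ d ∈ s, ∑ i, y i d, ?_⟩
  simp only [map_sum, hy, ← Finset.sum_smul, sum_e, one_smul]
  exact (eq_sum_pr _ hs x).symm

/-- Without tops all the complexes e_i K_d are exact, so K is exact. Forgetting the grading, a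
bounded exact complex of projectives is contractible; the degree-zero part of a contraction is a
graded contraction. -/
lemma isZero_of_hdim_T {K : CochainComplex (GrProj k n) ℤ} (hK : IsBounded K)
    (h : ∀ i m d, hdim (T k i d) m ((HomotopyCategory.quotient _ _).obj K) = 0) :
    IsZero ((HomotopyCategory.quotient _ _).obj K) := by
  let F := forgetGrading k n
  let L := (F.mapHomologicalComplex (.up ℤ)).obj K
  have hL : L.Acyclic := by
    intro m
    rw [HomologicalComplex.exactAt_iff' L (m - 1) m (m + 1) (by simp) (by simp),
      ShortComplex.moduleCat_exact_iff]
    intro x hx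
    exact exact_of_hdim_E (fun i d => hdim_E_eq_zero (h _ _ _) (h _ _ _) fun _ => h _ _ _) x hx
  obtain ⟨a, b, hab⟩ := hK
  have h1 : CochainComplex.IsStrictlyLE L b := by
    rw [CochainComplex.isStrictlyLE_iff]
    intro i hi
    exact F.map_isZero (hab i (Or.inr hi))
  have h2 : ∀ m, Projective (L.X m) := fun m =>
    inferInstanceAs (Projective (ModuleCat.of (Zigzag k n) (K.X m).carrier))
  -- A bounded above complex of projectives is K-projective, so its identity is null-homotopic once
  -- it is acyclic.
  have := CochainComplex.isKProjective_of_projective L b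
  let η := CochainComplex.IsKProjective.homotopyZero (𝟙 L) hL
  rw [HomotopyCategory.isZero_quotient_obj_iff]
  refine ⟨{ hom := fun i j => degreeZero (η.hom i j)
            zero := fun i j hij => ?_
            comm := fun i => ?_ }⟩
  · rw [η.zero i j hij]
    exact degreeZero_zero
  · have := η.comm i
    rw [dNext_eq _ (show (ComplexShape.up ℤ).Rel i (i + 1) by simp),
      prevD_eq _ (show (ComplexShape.up ℤ).Rel (i - 1) i by simp)] at this ⊢
    rw [HomologicalComplex.zero_f, add_zero] at this ⊢
    exact eq_of_homotopy_relation _ _ _ _ this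

end GrProj

/-! ### The heart is closed under extensions -/

section Heart

open Pretriangulated

section

variable {C : Type*} [Category* C] [Preadditive C] [HasFiniteBiproducts C] [HasBinaryBiproducts C]

/-- A biproduct over a disjoint union. -/
def biproductSumIso {α β : Type} [Finite α] [Finite β] (f : α ⊕ β → C) :
    (⨁ fun a => f (.inl a)) ⊞ (⨁ fun b => f (.inr b)) ≅ ⨁ f where
  hom := biprod.desc (biproduct.desc fun a => biproduct.ι f (.inl a))
    (biproduct.desc fun b => biproduct.ι f (.inr b))
  inv := biproduct.desc fun
    | .inl a => biproduct.ι (fun a => f (.inl a)) a ≫ biprod.inl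
    | .inr b => biproduct.ι (fun b => f (.inr b)) b ≫ biprod.inr
  hom_inv_id := by
    apply biprod.hom_ext' <;> refine biproduct.hom_ext' _ _ fun a => ?_ <;> simp
  inv_hom_id := by
    refine biproduct.hom_ext' _ _ fun t => ?_
    rcases t with a | b <;> simp

lemma exists_biproduct_append {r r' : ℕ} (f : Fin r → C) (g : Fin r' → C) :
    Nonempty ((⨁ f) ⊞ (⨁ g) ≅ ⨁ Fin.append f g) := by
  refine ⟨biproductSumIso (Sum.elim f g) ≪≫ biproduct.whiskerEquiv finSumFinEquiv fun t => eqToIso ?_⟩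
  rcases t with a | b <;> simp

end

variable {k : Type u} [Field k] {n : ℕ}

lemma linear_biprod {A B : GrProj k n} {m : ℤ}
    (hA : ∃ (r : ℕ) (j : Fin r → Fin n), Nonempty (A ≅ ⨁ fun t => GrProj.P k (j t) m))
    (hB : ∃ (r : ℕ) (j : Fin r → Fin n), Nonempty (B ≅ ⨁ fun t => GrProj.P k (j t) m)) :
    ∃ (r : ℕ) (j : Fin r → Fin n), Nonempty (A ⊞ B ≅ ⨁ fun t => GrProj.P k (j t) m) := by
  obtain ⟨r, j, ⟨e⟩⟩ := hA
  obtain ⟨r', j', ⟨e'⟩⟩ := hB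
  obtain ⟨e''⟩ := exists_biproduct_append (fun t => GrProj.P k (j t) m) (fun t => GrProj.P k (j' t) m)
  refine ⟨r + r', Fin.append j j', ⟨biprod.mapIso e e' ≪≫ e'' ≪≫
    biproduct.mapIso fun t => eqToIso ?_⟩⟩
  refine Fin.addCases (fun a => ?_) (fun b => ?_) t <;> simp

lemma heart_of_iso {X : D k n} {L : CochainComplex (GrProj k n) ℤ} (hL : IsLinear L)
    (hb : IsBounded L) (e : X.obj ≅ (HomotopyCategory.quotient _ _).obj L) : heart k n X :=
  ⟨⟨(HomotopyCategory.quotient _ _).obj L, hb⟩, hL, ⟨(bounded _).ι.preimageIso e⟩⟩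

lemma exists_of_heart {X : D k n} (hX : heart k n X) :
    ∃ L : CochainComplex (GrProj k n) ℤ, IsLinear L ∧ IsBounded L ∧
      Nonempty (X.obj ≅ (HomotopyCategory.quotient _ _).obj L) := by
  obtain ⟨Y, hY, ⟨e⟩⟩ := hX
  exact ⟨Y.obj.as, hY, Y.property, ⟨(bounded _).ι.mapIso e⟩⟩

lemma heart_iso {X Y : D k n} (e : X ≅ Y) (hX : heart k n X) : heart k n Y := by
  obtain ⟨Z, hZ, ⟨e'⟩⟩ := hX
  exact ⟨Z, hZ, ⟨e.symm ≪≫ e'⟩⟩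

/-- The connecting map Z[-1] → X lifts to a chain map between the linear complexes. The terms of its
cone are L^m ⊕ K^m, so it is again linear. -/
lemma heart_extension {X Y Z : D k n} {f : X ⟶ Y} {g : Y ⟶ Z} {h : Z ⟶ X⟦(1 : ℤ)⟧}
    (hT : Triangle.mk f g h ∈ distTriang (D k n)) (hX : heart k n X) (hZ : heart k n Z) :
    heart k n Y := by
  obtain ⟨K, hK, hKb, ⟨eK⟩⟩ := exists_of_heart hX
  obtain ⟨L, hL, hLb, ⟨eL⟩⟩ := exists_of_heart hZ
  have hT' := inv_rot_of_distTriang _ ((bounded (GrProj k n)).ι.map_distinguished _ hT)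
  let q := HomotopyCategory.quotient (GrProj k n) (.up ℤ)
  let e₁ : Z.obj⟦(-1 : ℤ)⟧ ≅ q.obj (L⟦(-1 : ℤ)⟧) :=
    (shiftFunctor _ (-1 : ℤ)).mapIso eL ≪≫ (q.commShiftIso (-1 : ℤ)).symm.app L
  obtain ⟨φ, hφ⟩ := q.map_surjective (e₁.inv ≫
    ((bounded (GrProj k n)).ι.mapTriangle.obj (Triangle.mk f g h)).invRotate.mor₁ ≫ eK.hom)
  have e := Triangle.π₃.mapIso (isoTriangleOfIso₁₂ _ _ hT'
    (HomotopyCategory.mappingCone_triangleh_distinguished φ) e₁ eK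
    ((Iso.eq_inv_comp e₁).1 hφ).symm)
  refine heart_of_iso (L := CochainComplex.mappingCone φ) (fun m => ?_)
    (isBounded_mappingCone φ ?_ hKb) e
  · obtain ⟨r, j, ⟨e'⟩⟩ := linear_biprod (A := (L⟦(-1 : ℤ)⟧).X (m + 1)) (B := K.X m) (m := m) (by
      have := hL (m + 1 + -1)
      rw [show m + 1 + -1 = m by omega] at this
      obtain ⟨r, j, ⟨e'⟩⟩ := this
      exact ⟨r, j, ⟨L.XIsoOfEq (show m + 1 + -1 = m by omega) ≪≫ e'⟩⟩) (hK m)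
    exact ⟨r, j, ⟨HomologicalComplex.homotopyCofiber.XIsoBiprod φ m (m + 1) rfl ≪≫ e'⟩⟩
  · obtain ⟨a, b, hab⟩ := hLb
    exact ⟨a + 1, b + 1, fun m hm => hab (m + -1) (by omega)⟩

lemma slice_extension {m : ℤ} {X Y Z : D k n} {f : X ⟶ Y} {g : Y ⟶ Z} {h : Z ⟶ X⟦(1 : ℤ)⟧}
    (hT : Triangle.mk f g h ∈ distTriang (D k n)) (hX : slice k n m X) (hZ : slice k n m Z) :
    slice k n m Y := by
  obtain ⟨g', h', hT'⟩ := exists_shift_distinguished hT (-m)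
  exact heart_extension hT' hX hZ

lemma slice_iso {m : ℤ} {X Y : D k n} (e : X ≅ Y) (hX : slice k n m X) : slice k n m Y :=
  heart_iso ((shiftFunctor (D k n) (-m)).mapIso e) hX

/-! ### Single projectives and multiplicities -/

namespace GrProj

lemma isBounded_singleP (j : Fin n) (m d : ℤ) : IsBounded (singleP k j m d) :=
  ⟨m, m, fun i hi => HomologicalComplex.isZero_single_obj_X (.up ℤ) m (P k j (-d)) i (by omega)⟩

variable (k) in
/-- The object `P_j⟨-d⟩[-m]` of the bounded homotopy category. -/
def singleD (j : Fin n) (m d : ℤ) : D k n := ⟨singleHo k j m d, isBounded_singleP j m d⟩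

/-- Fixes the sign convention for slices: after a shift by m + d the module P_j⟨-d⟩ sits in degree
-d, as in a linear complex. -/
lemma slice_singleD (j : Fin n) (m d : ℤ) : slice k n (-(m + d)) (singleD k j m d) := by
  let q := HomotopyCategory.quotient (GrProj k n) (.up ℤ)
  refine heart_of_iso (L := (singleP k j m d)⟦-(-(m + d))⟧) (fun p => ?_)
    ⟨-d, -d, fun i hi => HomologicalComplex.isZero_single_obj_X (.up ℤ) m (P k j (-d))
      (i + -(-(m + d))) (by omega)⟩
    (((bounded (GrProj k n)).ι.commShiftIso (-(-(m + d)))).app (singleD k j m d) ≪≫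
      (q.commShiftIso (-(-(m + d)))).symm.app (singleP k j m d))
  by_cases hp : p = -d
  · subst hp
    refine ⟨1, fun _ => j, ⟨(singleP k j m d).XIsoOfEq (show -d + -(-(m + d)) = m by omega) ≪≫
      singlePIso j m d ≪≫ (biproductUniqueIso fun _ : Fin 1 => P k j (-d)).symm⟩⟩
  · refine ⟨0, Fin.elim0, ⟨IsZero.iso (HomologicalComplex.isZero_single_obj_X (.up ℤ) m
      (P k j (-d)) (p + -(-(m + d))) (by omega)) ?_⟩⟩
    rw [IsZero.iff_id_eq_zero]
    exact biproduct.hom_ext _ _ fun t => t.elim0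

lemma finrank_T_eq_zero {A : GrProj k n} {m : ℤ} {r : ℕ} {j : Fin r → Fin n}
    (e : A ≅ ⨁ fun t => P k (j t) m) (i : Fin n) {d : ℤ} (h : d + m ≠ 0) :
    Module.finrank k ((T k i d).obj A) = 0 := by
  have h0 : ∀ t, IsZero ((T k i d).obj (P k (j t) m)) := fun t => by
    have : Subsingleton ((T k i d).obj (P k (j t) m)) := by
      rw [← Module.finrank_zero_iff (R := k)]
      exact (finrank_zSub_P i (j t) m d).trans (if_neg fun h' => h h'.2)
    exact ModuleCat.isZero_of_subsingleton _
  have h1 : IsZero ((T k i d).obj (⨁ fun t => P k (j t) m)) := by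
    rw [IsZero.iff_id_eq_zero, ← CategoryTheory.Functor.map_id, ← biproduct.total, Functor.map_sum]
    refine Finset.sum_eq_zero fun t _ => ?_
    have hz : (T k i d).map (biproduct.π (fun t => P k (j t) m) t) = 0 := (h0 t).eq_of_tgt _ _
    rw [Functor.map_comp, hz, zero_comp]
  rw [finrank_of_iso ((T k i d).mapIso e)]
  have : Subsingleton ((T k i d).obj (⨁ fun t => P k (j t) m)) := ModuleCat.subsingleton_of_isZero h1
  exact Module.finrank_zero_of_subsingleton

/-- The multiplicity of `P_j⟨-d⟩` in degree `m` in a minimal complex representing an object. -/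
def mult (j : Fin n) (m d : ℤ) (X : D k n) : ℕ := hdim (T k j d) m X.obj

lemma mult_iso {X Y : D k n} (e : X ≅ Y) (j : Fin n) (m d : ℤ) : mult j m d X = mult j m d Y :=
  hdim_of_iso ((bounded _).ι.mapIso e)

lemma mult_shift (X : D k n) (j : Fin n) {a m m' : ℤ} (h : a + m = m') (d : ℤ) :
    mult j m d (X⟦a⟧) = mult j m' d X :=
  (hdim_of_iso (((bounded _).ι.commShiftIso a).app X)).trans (hdim_shift _ _ _ _ _ h)

/-- In a linear complex the term of degree m involves only P_j⟨m⟩, so its constituents satisfy d =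
-m; a shift moves this condition to the other slices. -/
lemma mult_slice {s : ℤ} {X : D k n} (hX : slice k n s X) (j : Fin n) {m d : ℤ}
    (h : -(m + d) ≠ s) : mult j m d X = 0 := by
  rw [← mult_shift X j (show -s + (m + s) = m by omega)]
  obtain ⟨L, hL, -, ⟨e⟩⟩ := exists_of_heart hX
  refine (hdim_of_iso e).trans (Nat.le_zero.1 ((hdim_le_finrank _ _ _).trans ?_))
  obtain ⟨r, l, ⟨e'⟩⟩ := hL (m + s)
  rw [finrank_T_eq_zero e' j (by omega)]

lemma mult_of_isZero {X : D k n} (hX : IsZero X) (j : Fin n) (m d : ℤ) : mult j m d X = 0 := by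
  have h : IsZero ((H (T k j d) m).obj X.obj) :=
    (H (T k j d) m).map_isZero ((bounded (GrProj k n)).ι.map_isZero hX)
  have : Subsingleton ((H (T k j d) m).obj X.obj) := ModuleCat.subsingleton_of_isZero h
  exact Module.finrank_zero_of_subsingleton

end GrProj

end Heart

/-! ### Devissage -/

section Devissage

open Pretriangulated GrProj

variable {k : Type u} [Field k] {n : ℕ}

lemma map_ι_triangle {X Y Z : D k n} {f : X ⟶ Y} {g : Y ⟶ Z} {h : Z ⟶ X⟦(1 : ℤ)⟧}
    (hT : Triangle.mk f g h ∈ distTriang (D k n)) :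
    ∃ h', Triangle.mk f.hom g.hom h' ∈ distTriang (Ho k n) := ⟨_, hT⟩

lemma mult_triangle {X Y Z : D k n} {f : X ⟶ Y} {g : Y ⟶ Z} {h : Z ⟶ X⟦(1 : ℤ)⟧}
    (hT : Triangle.mk f g h ∈ distTriang (D k n)) (j : Fin n) (m d : ℤ) :
    mult j m d Z + rk ((H (T k j d) m).map f.hom) + rk ((H (T k j d) (m + 1)).map f.hom) =
      mult j m d Y + mult j (m + 1) d X := by
  obtain ⟨h', hT'⟩ := map_ι_triangle hT
  exact hdim_triangle _ _ hT'

lemma mult_le_of_triangle {X Y Z : D k n} {f : X ⟶ Y} {g : Y ⟶ Z} {h : Z ⟶ X⟦(1 : ℤ)⟧}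
    (hT : Triangle.mk f g h ∈ distTriang (D k n)) (j : Fin n) (m d : ℤ) :
    mult j m d Y ≤ mult j m d X + mult j m d Z := by
  have h0 := mult_triangle hT j m d
  have h1 : rk ((H (T k j d) m).map f.hom) ≤ mult j m d X := rk_le_left _
  have h2 : rk ((H (T k j d) (m + 1)).map f.hom) ≤ mult j (m + 1) d X := rk_le_left _
  omega

lemma isZero_of_mult {X : D k n} (h : ∀ j m d, mult j m d X = 0) : IsZero X := by
  have h0 : IsZero X.obj := isZero_of_hdim_T (K := X.obj.as) X.property h
  rw [IsZero.iff_id_eq_zero]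
  exact ObjectProperty.hom_ext _ (h0.eq_of_src _ _)

/-- Only the finitely many terms of the bounded complex, and the finitely many non-zero degrees of
each of them, can contribute. -/
lemma exists_finite_support (X : D k n) :
    ∃ F : Finset (Fin n × ℤ × ℤ), ∀ j m d, (j, m, d) ∉ F → mult j m d X = 0 := by
  obtain ⟨K, ⟨a, b, hab⟩⟩ := X
  choose s hs using fun m => exists_degree_bound (K.as.X m)
  refine ⟨Finset.univ ×ˢ Finset.Icc a b ×ˢ (Finset.Icc a b).biUnion s, fun j m d hF => ?_⟩
  simp only [Finset.mem_product, Finset.mem_univ, true_and, Finset.mem_Icc, Finset.mem_biUnion,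
    not_and_or, not_exists] at hF
  refine Nat.le_zero.1 ((hdim_le_finrank (T k j d) m K.as).trans (le_of_eq ?_))
  have : Subsingleton ((T k j d).obj (K.as.X m)) := by
    by_cases hm : a ≤ m ∧ m ≤ b
    · have hd : d ∉ s m := (hF.resolve_left (by tauto) m).resolve_left (by tauto)
      refine ⟨fun x y => Subtype.ext ?_⟩
      have h0 : ∀ z ∈ zSub j d (K.as.X m), z = 0 := by
        rintro _ ⟨z, hz, rfl⟩
        have := hz.2
        rw [hs m d hd] at this
        rw [(Submodule.mem_bot k).1 this, map_zero]
      exact (h0 x.1 x.2).trans (h0 y.1 y.2).symm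
    · exact ModuleCat.subsingleton_of_isZero ((T k j d).map_isZero (hab m (by omega)))
  exact Module.finrank_zero_of_subsingleton

/-- If `P_j⟨-d⟩[-m]` occurs in `X` in the largest possible slice, and among these in the largest
possible degree, then there is a morphism to `X` realizing this occurrence. -/
lemma exists_singleD_triangle {X : D k n} {j : Fin n} {m d : ℤ} (h : mult j m d X ≠ 0)
    (h₁ : mult j (m + 1) (d - 2) X = 0) (h₂ : ∀ l, mult l (m + 1) (d - 1) X = 0) :
    ∃ (Z : D k n) (f : singleD k j m d ⟶ X) (g : X ⟶ Z) (w : Z ⟶ (singleD k j m d)⟦(1 : ℤ)⟧),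
      Triangle.mk f g w ∈ distTriang (D k n) ∧
      ∀ j' m' d', mult j' m' d' Z + mult j' m' d' (singleD k j m d) = mult j' m' d' X := by
  -- The layers of R in cohomological degree m + 1 are one in the next higher slice and one in the
  -- same slice but in a higher degree; both are excluded by hypothesis.
  have hR : hdim (R k j d) (m + 1) X.obj = 0 := hdim_R_eq_zero h₁ h₂
  have e1 := hdim_R j m d X.obj
  have e2 : loopRank j m d X.obj ≤ hdim (T k j d) m X.obj := rk_le_right _
  have e3 := loopRank_le j (m + 1) d X.obj
  -- With R gone, the rank formula forces multiplication by z_j to be onto H^m of `T`, so some class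
  -- of H^m of `E`, that is some morphism from the single projective, detects the constituent.
  have e4 : loopRank j m d X.obj ≠ 0 := by
    have : hdim (T k j d) m X.obj ≠ 0 := h
    omega
  obtain ⟨a, ha⟩ : ∃ a, ((HMap (eToT k j d) m).app X.obj).hom a ≠ 0 := by
    by_contra! hc
    refine e4 ((congrArg rk (?_ : (HMap (eToT k j d) m).app X.obj = 0)).trans rk_zero)
    ext a
    exact hc a
  obtain ⟨f, b, hb⟩ := exists_singleHo_hom a
  let f' : singleD k j m d ⟶ X := ObjectProperty.homMk f
  obtain ⟨Z, g, w, hT⟩ := distinguished_cocone_triangle f'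
  refine ⟨Z, f', g, w, hT, fun j' m' d' => ?_⟩
  -- The morphism is injective on all z-cohomology: the source has a single one-dimensional group,
  -- and it is not killed because its image under multiplication by z_j is non-zero. So passing to
  -- the cone subtracts multiplicities.
  have key : ∀ m', rk ((H (T k j' d') m').map f'.hom) = mult j' m' d' (singleD k j m d) := by
    intro m'
    have h1 : rk ((H (T k j' d') m').map f'.hom) ≤ mult j' m' d' (singleD k j m d) := rk_le_left _
    have h2 : mult j' m' d' (singleD k j m d) ≤ if j' = j ∧ m' = m ∧ d' = d then 1 else 0 :=
      hdim_singleHo_le j j' m m' d d'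
    by_cases hj : j' = j ∧ m' = m ∧ d' = d
    · obtain ⟨rfl, rfl, rfl⟩ := hj
      rw [if_pos ⟨rfl, rfl, rfl⟩] at h2
      have h3 : rk ((H (T k j' d') m').map f'.hom) ≠ 0 := by
        intro h0
        have h4 : (H (T k j' d') m').map f = 0 := eq_zero_of_rk h0
        refine ha ?_
        have h5 := LinearMap.congr_fun (congrArg ModuleCat.Hom.hom
          ((HMap (eToT k j' d') m').naturality f)) b
        rw [h4, comp_zero] at h5
        rw [← hb]
        exact h5
      omega
    · rw [if_neg hj] at h2
      omega
  have h0 := mult_triangle hT j' m' d'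
  rw [key, key] at h0
  omega

/-- Induction on the total multiplicity, which is finite and drops by one when a constituent is
split off. Taking it from the largest slice gives the bound available in `step`. -/
theorem devissage (Q : D k n → Prop) (zero : ∀ X, IsZero X → Q X)
    (step : ∀ (X Z : D k n) (j : Fin n) (m d : ℤ) (f : singleD k j m d ⟶ X) (g : X ⟶ Z)
      (w : Z ⟶ (singleD k j m d)⟦(1 : ℤ)⟧), Triangle.mk f g w ∈ distTriang (D k n) →
      mult j m d X ≠ 0 → (∀ j' m' d', mult j' m' d' X ≠ 0 → -(m' + d') ≤ -(m + d)) →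
      (∀ j' m' d', mult j' m' d' Z ≤ mult j' m' d' X) → Q Z → Q X) (X : D k n) : Q X := by
  obtain ⟨F, hF⟩ := exists_finite_support X
  suffices ∀ N, ∀ X : D k n, (∀ j m d, (j, m, d) ∉ F → mult j m d X = 0) →
      ∑ p ∈ F, mult p.1 p.2.1 p.2.2 X ≤ N → Q X from this _ X hF le_rfl
  intro N
  induction N with
  | zero =>
    intro X hX hN
    have h0 : ∀ p ∈ F, mult p.1 p.2.1 p.2.2 X = 0 := Finset.sum_eq_zero_iff.1 (Nat.le_zero.1 hN)
    refine zero X (isZero_of_mult fun j m d => ?_)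
    by_cases h : (j, m, d) ∈ F
    · exact h0 (j, m, d) h
    · exact hX j m d h
  | succ N ih =>
    intro X hX hN
    by_cases hS : (F.filter fun p => mult p.1 p.2.1 p.2.2 X ≠ 0).Nonempty
    · obtain ⟨⟨j, m, d⟩, hp, hmax⟩ := Finset.exists_max_image _
        (fun p : Fin n × ℤ × ℤ => toLex (-(p.2.1 + p.2.2), p.2.1)) hS
      have hmax' : ∀ j' m' d', mult j' m' d' X ≠ 0 →
          -(m' + d') < -(m + d) ∨ -(m' + d') = -(m + d) ∧ m' ≤ m := fun j' m' d' h => by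
        have h1 := hmax (j', m', d') (by
          rw [Finset.mem_filter]
          exact ⟨by_contra fun hc => h (hX _ _ _ hc), h⟩)
        exact (Prod.Lex.toLex_le_toLex).1 h1
      have hp' : (j, m, d) ∈ F ∧ mult j m d X ≠ 0 := Finset.mem_filter.1 hp
      obtain ⟨Z, f, g, w, hT, hZ⟩ := exists_singleD_triangle hp'.2
        (by by_contra hc; have := hmax' _ _ _ hc; omega)
        (fun l => by by_contra hc; have := hmax' _ _ _ hc; omega)
      refine step X Z j m d f g w hT hp'.2 (fun j' m' d' h => ?_) (fun j' m' d' => ?_) (ih Z ?_ ?_)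
      · have := hmax' _ _ _ h; omega
      · have := hZ j' m' d'; omega
      · intro j' m' d' h
        have h1 := hZ j' m' d'
        have h2 := hX j' m' d' h
        omega
      · have h1 : ∑ p ∈ F, mult p.1 p.2.1 p.2.2 Z < ∑ p ∈ F, mult p.1 p.2.1 p.2.2 X := by
          refine Finset.sum_lt_sum (fun p _ => ?_) ⟨_, hp'.1, ?_⟩
          · have := hZ p.1 p.2.1 p.2.2; omega
          · have h1 := hZ j m d
            have h2 : mult j m d (singleD k j m d) = 1 := hdim_singleHo_self j m d
            change mult j m d Z < mult j m d X
            omega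
        omega
    · refine zero X (isZero_of_mult fun j m d => ?_)
      by_cases h : (j, m, d) ∈ F
      · by_contra hc
        exact hS ⟨(j, m, d), Finset.mem_filter.2 ⟨h, hc⟩⟩
      · exact hX j m d h

/-- All slices of `X` lie in the interval `[a, b]`. -/
def SupportedIn (a b : ℤ) (X : D k n) : Prop :=
  ∀ j m d, mult j m d X ≠ 0 → a ≤ -(m + d) ∧ -(m + d) ≤ b

lemma SupportedIn.of_triangle {a b : ℤ} {X Y Z : D k n} {f : X ⟶ Y} {g : Y ⟶ Z}
    {h : Z ⟶ X⟦(1 : ℤ)⟧} (hT : Triangle.mk f g h ∈ distTriang (D k n)) (hX : SupportedIn a b X)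
    (hZ : SupportedIn a b Z) : SupportedIn a b Y := fun j m d hY => by
  have := mult_le_of_triangle hT j m d
  by_cases h0 : mult j m d X = 0
  · exact hZ j m d (by omega)
  · exact hX j m d h0

lemma supportedIn_of_isZero (a b : ℤ) {X : D k n} (hX : IsZero X) : SupportedIn a b X :=
  fun j m d h => absurd (mult_of_isZero hX j m d) h

lemma supportedIn_of_slice {m a b : ℤ} {X : D k n} (hX : slice k n m X) (ha : a ≤ m) (hb : m ≤ b) :
    SupportedIn a b X := fun j p d h => by
  have : -(p + d) = m := by
    by_contra hc
    exact h (mult_slice hX j hc)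
  omega

lemma SupportedIn.mono {a b a' b' : ℤ} {X : D k n} (hX : SupportedIn a b X) (ha : a' ≤ a)
    (hb : b ≤ b') : SupportedIn a' b' X := fun j m d h => by
  have := hX j m d h
  omega

lemma SupportedIn.iso {a b : ℤ} {X Y : D k n} (hX : SupportedIn a b X) (e : X ≅ Y) :
    SupportedIn a b Y := fun j m d h => hX j m d (by rwa [mult_iso e])

lemma SupportedIn.shift {a b : ℤ} {X : D k n} (hX : SupportedIn a b X) (c : ℤ) :
    SupportedIn (a + c) (b + c) (X⟦c⟧) := fun j m d h => by
  have := hX j (c + m) d (by rwa [mult_shift X j rfl] at h)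
  omega

lemma InSlices.supportedIn {a b : ℤ} {X : D k n} (h : InSlices k n a b X) : SupportedIn a b X := by
  induction h with
  | zero a b X h => exact supportedIn_of_isZero a b h
  | step a b m ha hb T hT h₁ h₃ ih =>
    exact SupportedIn.of_triangle (f := T.mor₁) (g := T.mor₂) (h := T.mor₃) hT
      (ih.mono (by omega) le_rfl) (supportedIn_of_slice h₃ ha hb)

lemma InSlices.mono {a b a' b' : ℤ} {X : D k n} (h : InSlices k n a b X) (ha : a' ≤ a)
    (hb : b ≤ b') : InSlices k n a' b' X := by
  induction h generalizing a' with
  | zero a b X h => exact .zero _ _ _ h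
  | step a b m hma hmb T hT h₁ h₃ ih =>
    exact .step _ _ m (by omega) (by omega) T hT (ih le_rfl hb) h₃

lemma isZero_of_inSlices {a b : ℤ} (hab : b < a) {X : D k n} (h : InSlices k n a b X) :
    IsZero X := by
  cases h with
  | zero _ _ _ h => exact h
  | step m ha hb => omega

lemma inSlices_of_slice {m a b : ℤ} {X : D k n} (hX : slice k n m X) (ha : a ≤ m) (hb : m ≤ b) :
    InSlices k n a b X :=
  .step a b m ha hb _ (contractible_distinguished₁ X) (.zero _ _ _ (isZero_zero _)) hX

/-- An object of the top slice is added at the start of a filtration. Slices must strictly decrease,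
so if the filtration already has a piece in slice p, the two have to be merged. -/
lemma inSlices_extension {a p : ℤ} (hap : a ≤ p) {X Y Z : D k n} {f : X ⟶ Y} {g : Y ⟶ Z}
    {h : Z ⟶ X⟦(1 : ℤ)⟧} (hT : Triangle.mk f g h ∈ distTriang (D k n)) (hX : slice k n p X)
    (hZ : InSlices k n a p Z) : InSlices k n a p Y := by
  generalize hp : p = p' at hZ
  induction hZ generalizing Y with
  | zero a b Z hZ =>
    subst hp
    refine inSlices_of_slice (slice_iso ?_ hX) hap le_rfl
    have : IsIso f := (Triangle.isZero₃_iff_isIso₁ _ hT).1 hZ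
    exact asIso f
  | step a b m ha hb T hT' h₁ h₃ ih =>
    subst hp
    -- W is the kernel of Y → Z → `T.obj₃`; by the octahedral axiom it is an extension of `T.obj₁`
    -- by X, to which induction applies.
    obtain ⟨W, v, w, hW⟩ := distinguished_cocone_triangle₁ (g ≫ T.mor₂)
    have o := Triangulated.someOctahedron' rfl hT (show Triangle.mk T.mor₁ T.mor₂ T.mor₃ ∈ _ from hT')
      hW
    -- If the lowest piece of Z already lies in slice p, then Z is that piece and Y is an extension
    -- inside one slice.
    rcases hb.eq_or_lt with rfl | hlt
    · have hiso : IsIso T.mor₂ := (Triangle.isZero₁_iff_isIso₂ _ hT').1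
        (isZero_of_inSlices (by omega) h₁)
      exact inSlices_of_slice (slice_extension hT hX (slice_iso (asIso T.mor₂).symm h₃)) hap le_rfl
    · exact .step a _ m ha hb (Triangle.mk v (g ≫ T.mor₂) w) hW (ih hlt o.mem rfl) h₃

/-- Turns filtrations into a numerical condition. One direction is subadditivity of multiplicities
in triangles; the other assembles a filtration from `devissage`. -/
theorem inSlices_iff {a b : ℤ} {X : D k n} : InSlices k n a b X ↔ SupportedIn a b X := by
  refine ⟨InSlices.supportedIn, ?_⟩
  revert X a b
  suffices ∀ X : D k n, ∀ a b, SupportedIn a b X → InSlices k n a b X from fun {a b X} => this X a b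
  refine devissage _ (fun X hX a b _ => .zero a b X hX) ?_
  intro X Z j m d f g w hT h hmax hle ih a b hX
  obtain ⟨ha, hb⟩ := hX j m d h
  refine InSlices.mono (inSlices_extension ha hT (slice_singleD j m d) (ih a _ ?_)) le_rfl hb
  intro j' m' d' h'
  have h0 : mult j' m' d' X ≠ 0 := fun h0 => h' (Nat.le_zero.1 (h0 ▸ hle j' m' d'))
  exact ⟨(hX j' m' d' h0).1, hmax j' m' d' h0⟩

/-- Vanishing of morphisms between objects with slices far apart. -/
theorem hom_eq_zero {a b a' b' : ℤ} {X Y : D k n} (hX : SupportedIn a b X)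
    (hY : SupportedIn a' b' Y) (h : b' < a ∨ b + 2 < a') (f : X ⟶ Y) : f = 0 := by
  revert hX f
  refine devissage (fun X => SupportedIn a b X → ∀ f : X ⟶ Y, f = 0)
    (fun X hX _ f => hX.eq_of_src _ _) ?_ X
  intro X Z j m d v g w hT hm hmax hle ih hX f
  have h0 := hX j m d hm
  -- Morphisms from P_j⟨-d⟩[-m] to Y are built from constituents of Y in the slices s, s + 1, s + 2,
  -- where s = -(m + d) is between a and b; the hypothesis on the gap excludes all three.
  have hE : hdim (E k j d) m Y.obj = 0 := by
    have key : ∀ l d', d - 2 ≤ d' → d' ≤ d → hdim (T k l d') m Y.obj = 0 := by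
      intro l d' h1 h2
      by_contra hc
      have := hY l m d' hc
      omega
    exact hdim_E_eq_zero (key _ _ (by omega) (by omega)) (key _ _ (by omega) (by omega))
      fun l => key _ _ (by omega) (by omega)
  have hv : v ≫ f = 0 := ObjectProperty.hom_ext _ (singleHo_hom_eq_zero hE _)
  obtain ⟨f', rfl⟩ := Triangle.yoneda_exact₂ _ hT f hv
  have hf' : f' = 0 := ih (fun j' m' d' h' =>
    hX j' m' d' fun h0 => h' (Nat.le_zero.1 (h0 ▸ hle j' m' d'))) f'
  exact (congrArg (g ≫ ·) hf').trans comp_zero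

end Devissage

/-! ### The effect of a twist on multiplicities -/

section Multiplicities

open Pretriangulated GrProj

variable {k : Type u} [Field k] {n : ℕ}

/-- A functor with an inverse up to isomorphism of objects is faithful on cohomology. -/
lemma rk_eq_zero_of_map_eq_zero {Φ Φ' : D k n ⥤ D k n} (hΦ : PreservesTriangles Φ)
    (hΦ' : PreservesTriangles Φ') (h₀ : ∀ X Y : D k n, Φ'.map (0 : X ⟶ Y) = 0)
    (e : ∀ X, Nonempty (Φ'.obj (Φ.obj X) ≅ X)) {X Y : D k n} {f : X ⟶ Y} (hf : Φ.map f = 0)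
    (F : GrProj k n ⥤ ModuleCat.{u} k) [F.Additive] [∀ M, Module.Finite k (F.obj M)] (m : ℤ) :
    rk ((H F m).map f.hom) = 0 := by
  obtain ⟨Z, g, h, hT⟩ := distinguished_cocone_triangle f
  obtain ⟨g₁, h₁, hT₁⟩ := hΦ _ _ _ _ _ _ hT
  rw [hf] at hT₁
  obtain ⟨g₂, h₂, hT₂⟩ := hΦ' _ _ _ _ _ _ hT₁
  rw [h₀] at hT₂
  obtain ⟨w, hw⟩ := map_ι_triangle hT
  obtain ⟨w₂, hw₂⟩ := map_ι_triangle hT₂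
  -- Compare the cone of f with the cone of the zero map obtained by applying both functors. Their
  -- three objects are isomorphic in pairs, so the ranks have the same sum, which is zero for the
  -- zero map.
  have e₁ := hdim_triangle F m hw
  have e₂ := hdim_triangle F m hw₂
  have i : ∀ (A : D k n) (m : ℤ), hdim F m (Φ'.obj (Φ.obj A)).obj = hdim F m A.obj := fun A m =>
    hdim_of_iso ((bounded _).ι.mapIso (e A).some)
  have z : ∀ (A B : D k n) (m : ℤ), rk ((H F m).map (0 : A ⟶ B).hom) = 0 := fun A B m =>
    (congrArg rk ((H F m).map_zero A.obj B.obj)).trans rk_zero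
  rw [z, z, i, i, i] at e₂
  omega

lemma mult_twistInv_of_ne {i l : Fin n} (h : l ≠ i) (m d : ℤ) (X : D k n) :
    mult l m d ((twistInv k i).obj X) = mult l m d X :=
  hdim_T_cone_of_ne h m d X.obj

lemma mult_twistInv (i : Fin n) (m d : ℤ) (X : D k n) :
    mult i m d ((twistInv k i).obj X) = hdim (R k i d) (m + 1) X.obj :=
  hdim_T_cone_eq i m d X.obj

/-- The multiplicity in the cohomology of the morphisms from the other projectives. -/
lemma mult_inequalities (i : Fin n) (m d : ℤ) (X : D k n) :
    (∑ t : {j : Fin n // j ≠ i} × Bool, mult t.1.1 m (d - 1) X ≤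
      mult i (m + 1) (d - 2) X + mult i (m - 1) d ((twistInv k i).obj X)) ∧
    (mult i (m + 1) (d - 2) X ≤ ∑ t : {j : Fin n // j ≠ i} × Bool, mult t.1.1 m (d - 1) X +
      mult i m d ((twistInv k i).obj X)) ∧
    mult i m d ((twistInv k i).obj X) ≤ mult i (m + 1) (d - 2) X +
      ∑ t : {j : Fin n // j ≠ i} × Bool, mult t.1.1 (m + 1) (d - 1) X := by
  obtain ⟨r, r', h1, h2, h3, h4, h⟩ := hdim_T_R_W i m d X.obj
  rw [hdim_W] at h h2 h4
  have e1 := mult_twistInv i m d X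
  have e2 := mult_twistInv i (m - 1) d X
  rw [sub_add_cancel] at e2
  rw [e1, e2]
  have e3 : mult i (m + 1) (d - 2) X = hdim (T k i (d - 2)) (m + 1) X.obj := rfl
  have e4 : ∀ m, ∑ t : {j : Fin n // j ≠ i} × Bool, mult t.1.1 m (d - 1) X =
      ∑ t : {j : Fin n // j ≠ i} × Bool, hdim (T k t.1.1 (d - 1)) m X.obj := fun _ => rfl
  rw [e3, e4, e4]
  refine ⟨?_, ?_, ?_⟩ <;> omega

/-- Numerically, Σ_i P_i is P_i⟨2⟩[-1]: no constituents of other kinds occur, so `mult_inequalities`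
leaves room only for a shift up by one slice. -/
lemma supportedIn_twist_singleD (i : Fin n) (m d : ℤ) :
    SupportedIn (-(m + d) + 1) (-(m + d) + 1) ((twist k i).obj (singleD k i m d)) := by
  set S : D k n := singleD k i m d
  set X := (twist k i).obj S
  obtain ⟨e⟩ := twistInv_twist k i S
  have hS : ∀ l m' d', mult l m' d' S ≤ if l = i ∧ m' = m ∧ d' = d then 1 else 0 :=
    fun l m' d' => hdim_singleHo_le i l m m' d d'
  have hX : ∀ l ≠ i, ∀ m' d', mult l m' d' X = 0 := fun l hl m' d' => by
    rw [← mult_twistInv_of_ne hl, mult_iso e]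
    have := hS l m' d'
    rw [if_neg (fun h => hl h.1)] at this
    exact Nat.le_zero.1 this
  intro l m' d' h
  obtain rfl : l = i := by_contra fun hl => h (hX l hl m' d')
  have h1 := (mult_inequalities l (m' - 1) (d' + 2) X).2.1
  rw [Finset.sum_eq_zero fun t _ => hX t.1.1 t.1.2 _ _, sub_add_cancel, add_sub_cancel_right,
    mult_iso e] at h1
  have h2 := hS l (m' - 1) (d' + 2)
  split_ifs at h2 with h3
  · omega
  · omega

lemma supportedIn_twistInv_singleD {i : Fin n} {s : ℤ} {S : D k n}
    (hS : ∀ l m' d', mult l m' d' S ≠ 0 → l = i ∧ -(m' + d') = s) :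
    ∀ l m' d', mult l m' d' ((twistInv k i).obj S) ≠ 0 → l = i ∧ -(m' + d') = s - 1 := by
  have hS' : ∀ l ≠ i, ∀ m' d', mult l m' d' S = 0 := fun l hl m' d' =>
    by_contra fun h => hl (hS l m' d' h).1
  intro l m' d' h
  obtain rfl : l = i := by_contra fun hl => h (by rw [mult_twistInv_of_ne hl, hS' l hl])
  have h1 := (mult_inequalities l m' d' S).2.2
  rw [Finset.sum_eq_zero fun t _ => hS' t.1.1 t.1.2 _ _] at h1
  have := hS l (m' + 1) (d' - 2) (by omega)
  omega

lemma exists_supportedIn (X : D k n) : ∃ c, SupportedIn (-c) c X := by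
  obtain ⟨F, hF⟩ := exists_finite_support X
  refine ⟨∑ p ∈ F, |p.2.1 + p.2.2|, fun j m d h => ?_⟩
  have hp : (j, m, d) ∈ F := by_contra fun hp => h (hF j m d hp)
  have := Finset.single_le_sum (f := fun p : Fin n × ℤ × ℤ => |p.2.1 + p.2.2|)
    (fun _ _ => abs_nonneg _) hp
  have h1 := neg_abs_le (m + d)
  have h2 := le_abs_self (m + d)
  simp only at this
  omega

/-- Σ_i sends P_i⟨-d⟩[-m] to the slice p + 1, above all slices of Σ_i X. So Σ_i kills every morphism
from it to X, and by faithfulness on cohomology H^m of e_i X_d vanishes. Then multiplication by z_i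
has rank zero there and the rank formula for the cone gives the inequality. -/
lemma mult_le_twistInv {i : Fin n} {X : D k n} {p : ℤ}
    (hp : ∀ l m d, mult l m d ((twist k i).obj X) ≠ 0 → -(m + d) ≤ p) {m d : ℤ}
    (h : -(m + d) = p) : mult i m d X ≤ mult i m d ((twistInv k i).obj X) := by
  have h0 := hdim_T_cone i m d X.obj
  have h1 := loopRank_le i (m + 1) d X.obj
  suffices loopRank i m d X.obj = 0 by
    change hdim (T k i d) m X.obj ≤ hdim (T k i d) m ((coneHomotopy (evalTrans k i)).obj X.obj)
    omega
  refine (congrArg rk (?_ : (HMap (eToT k i d) m).app X.obj = 0)).trans rk_zero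
  suffices ∀ a, a = (0 : (H (E k i d) m).obj X.obj) by
    ext a
    rw [this a, map_zero, map_zero]
  intro a
  obtain ⟨f, b, rfl⟩ := exists_singleHo_hom a
  let f' : singleD k i m d ⟶ X := ObjectProperty.homMk f
  obtain ⟨c, hc⟩ := exists_supportedIn ((twist k i).obj X)
  have hf : (twist k i).map f' = 0 :=
    hom_eq_zero (b' := p) (supportedIn_twist_singleD i m d)
      (fun l m d h => ⟨(hc l m d h).1, hp l m d h⟩) (Or.inl (by omega)) _
  have h2 := rk_eq_zero_of_map_eq_zero (preservesTriangles_twist k i)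
    (preservesTriangles_twistInv k i) (twistInv_map_zero k i) (twistInv_twist k i) hf (E k i d) m
  have h3 : (H (E k i d) m).map f = 0 := eq_zero_of_rk h2
  rw [h3]
  rfl

/-- Here morphisms from P_i⟨-d⟩[-m-1], in slice q - 1, must vanish. Applying Σ_i⁻¹ twice brings the
source down to slice q - 3, out of reach of slices ≥ q because morphisms climb at most two slices; a
single application would not suffice. -/
lemma twistInv_le_mult {i : Fin n} {X : D k n} {q : ℤ}
    (hq : ∀ l m d, mult l m d ((twistInv k i).obj ((twistInv k i).obj X)) ≠ 0 → q ≤ -(m + d))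
    {m d : ℤ} (h : -(m + d) = q) : mult i m d ((twistInv k i).obj X) ≤ mult i m d X := by
  have h0 := hdim_T_cone i m d X.obj
  suffices hdim (E k i d) (m + 1) X.obj = 0 by
    change hdim (T k i d) m ((coneHomotopy (evalTrans k i)).obj X.obj) ≤ hdim (T k i d) m X.obj
    omega
  suffices Subsingleton ((H (E k i d) (m + 1)).obj X.obj) from Module.finrank_zero_of_subsingleton
  suffices ∀ a, a = (0 : (H (E k i d) (m + 1)).obj X.obj) from
    ⟨fun a b => (this a).trans (this b).symm⟩
  intro a
  obtain ⟨f, b, rfl⟩ := exists_singleHo_hom a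
  let S := singleD k i (m + 1) d
  let f' : S ⟶ X := ObjectProperty.homMk f
  obtain ⟨c, hc⟩ := exists_supportedIn ((twistInv k i).obj ((twistInv k i).obj X))
  have hS : ∀ l m' d', mult l m' d' S ≠ 0 → l = i ∧ -(m' + d') = q - 1 := fun l m' d' h' => by
    have : mult l m' d' S ≤ if l = i ∧ m' = m + 1 ∧ d' = d then 1 else 0 :=
      hdim_singleHo_le i l (m + 1) m' d d'
    split_ifs at this with h3
    · exact ⟨h3.1, by omega⟩
    · omega
  have hS₂ := supportedIn_twistInv_singleD (supportedIn_twistInv_singleD hS)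
  have hf : (twistInv k i ⋙ twistInv k i).map f' = 0 :=
    hom_eq_zero (a := q - 3) (b := q - 3) (a' := q) (b' := c)
      (fun l m d h => by have := hS₂ l m d h; omega)
      (fun l m d h => ⟨hq l m d h, (hc l m d h).2⟩) (Or.inr (by omega)) _
  have h2 := rk_eq_zero_of_map_eq_zero (Φ' := twist k i ⋙ twist k i)
    ((preservesTriangles_twistInv k i).comp (preservesTriangles_twistInv k i))
    ((preservesTriangles_twist k i).comp (preservesTriangles_twist k i))
    (fun X Y => (congrArg (twist k i).map (twist_map_zero k i X Y)).trans (twist_map_zero k i _ _))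
    (fun A => ⟨(twist k i).mapIso (twist_twistInv k i _).some ≪≫ (twist_twistInv k i A).some⟩)
    hf (E k i d) (m + 1)
  have h3 : (H (E k i d) (m + 1)).map f = 0 := eq_zero_of_rk h2
  rw [h3]
  rfl

end Multiplicities

/-! ### Combinatorial ping-pong -/

/-- Permutations acting on a set together with counting functions that change in the way
multiplicities change under twists. -/
structure TwistSystem (ι : Type) [Fintype ι] [DecidableEq ι] (Ω : Type*) where
  /-- the action of the generators -/
  σ : ι → Equiv.Perm Ω
  /-- the number of constituents of a given kind in a given slice -/
  t : Ω → ι → ℤ → ℕ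
  of_ne : ∀ {i l : ι}, l ≠ i → ∀ x s, t (σ i x) l s = t x l s
  -- The factor 2 is the number of edges between two vertices; it is what makes kind i dominate in
  -- `Top.good`.
  lower : ∀ i x s, 2 * ∑ l with l ≠ i, t x l s ≤ t x i s + t (σ i x) i s
  -- Kind i moves up by one slice, up to errors coming from the other kinds.
  upper : ∀ i x s, t (σ i x) i s ≤ 2 * ∑ l with l ≠ i, t x l s + t x i (s - 1)
  upper' : ∀ i x s, t x i (s - 1) ≤ t (σ i x) i s + 2 * ∑ l with l ≠ i, t x l (s - 1)
  -- These two conditions express vanishing of morphisms. They control repetition of the same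
  -- letter, where the other conditions say nothing, and are exchanged in `dual`.
  top_le : ∀ i x p, (∀ l s, p < s → t (σ i (σ i x)) l s = 0) → t (σ i x) i p ≤ t x i p
  bot_le : ∀ i x q, (∀ l s, s < q → t x l s = 0) → t (σ i x) i q ≤ t (σ i (σ i x)) i q

namespace TwistSystem

lemma perm_apply_inv {Ω : Type*} (f : Equiv.Perm Ω) (x : Ω) : f (f⁻¹ x) = x :=
  Equiv.apply_symm_apply f x

lemma perm_inv_apply {Ω : Type*} (f : Equiv.Perm Ω) (x : Ω) : f⁻¹ (f x) = x :=
  Equiv.symm_apply_apply f x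

lemma isReduced_map_not {ι : Type} {L : List (ι × Bool)} (hL : FreeGroup.IsReduced L) :
    FreeGroup.IsReduced (L.map fun a => (a.1, !a.2)) :=
  (List.isChain_map _).2 (hL.imp fun _ _ h h' => congrArg not (h h'))

variable {ι : Type} [Fintype ι] [DecidableEq ι] {Ω : Type*} (A : TwistSystem ι Ω)

lemma sum_of_ne (i : ι) (x : Ω) (s : ℤ) :
    ∑ l with l ≠ i, A.t (A.σ i x) l s = ∑ l with l ≠ i, A.t x l s :=
  Finset.sum_congr rfl fun _ hl => A.of_ne (Finset.mem_filter.1 hl).2 x s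

lemma sum_inv_of_ne (i : ι) (x : Ω) (s : ℤ) :
    ∑ l with l ≠ i, A.t ((A.σ i)⁻¹ x) l s = ∑ l with l ≠ i, A.t x l s := by
  have := A.sum_of_ne i ((A.σ i)⁻¹ x) s
  rwa [perm_apply_inv, eq_comm] at this

/-- The system with reversed slices and inverted generators. -/
def dual : TwistSystem ι Ω where
  σ i := (A.σ i)⁻¹
  t x l s := A.t x l (-s)
  of_ne {i l} h x s := by
    have := A.of_ne h ((A.σ i)⁻¹ x) (-s)
    rwa [perm_apply_inv, eq_comm] at this
  lower i x s := by
    have := A.lower i ((A.σ i)⁻¹ x) (-s)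
    rw [perm_apply_inv, sum_inv_of_ne] at this
    omega
  upper i x s := by
    have := A.upper' i ((A.σ i)⁻¹ x) (-s + 1)
    rw [perm_apply_inv, sum_inv_of_ne, add_sub_cancel_right] at this
    rw [neg_sub, sub_eq_neg_add]
    omega
  upper' i x s := by
    have := A.upper i ((A.σ i)⁻¹ x) (-s + 1)
    rw [perm_apply_inv, sum_inv_of_ne, add_sub_cancel_right] at this
    rw [neg_sub, sub_eq_neg_add]
    omega
  top_le i x p h := by
    have := A.bot_le i ((A.σ i)⁻¹ ((A.σ i)⁻¹ x)) (-p) fun l s hs => by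
      have := h l (-s) (by omega)
      rwa [neg_neg] at this
    rwa [perm_apply_inv, perm_apply_inv] at this
  bot_le i x q h := by
    have := A.top_le i ((A.σ i)⁻¹ ((A.σ i)⁻¹ x)) (-q) fun l s hs => by
      rw [perm_apply_inv, perm_apply_inv]
      have := h l (-s) (by omega)
      rwa [neg_neg] at this
    rwa [perm_apply_inv] at this

/-- The slice `p` is the largest one which is not empty, and kind `i` dominates there. -/
def Top (x : Ω) (i : ι) (p : ℤ) : Prop :=
  (∀ l s, p < s → A.t x l s = 0) ∧ ∑ l with l ≠ i, A.t x l p < A.t x i p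

/-- The action of a letter. -/
def letter (a : ι × Bool) : Equiv.Perm Ω := cond a.2 (A.σ a.1) (A.σ a.1)⁻¹

/-- The shape of an element after the application of a letter. -/
def Good (x : Ω) (a : ι × Bool) (p : ℤ) : Prop :=
  -- After a positive letter, the added condition forces the next equal letter to raise the largest
  -- slice. After a negative one, it says that undoing the letter neither raises the largest slice
  -- nor increases kind a.1 there, so `top_le` applies again.
  A.Top x a.1 p ∧ cond a.2
    (∑ l with l ≠ a.1, A.t x l p = 0 ∨ A.t ((A.σ a.1)⁻¹ x) a.1 p < A.t x a.1 p)
    (A.t (A.σ a.1 x) a.1 p ≤ A.t x a.1 p ∧ ∀ l s, p < s → A.t (A.σ a.1 x) l s = 0)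

variable {A}

/-- When a positive letter raises the largest slice, the result has only one kind there. -/
lemma good_of_raise {x : Ω} {i : ι} {p : ℤ} (hx : ∀ l s, p < s → A.t x l s = 0)
    (h : A.t (A.σ i x) i (p + 1) ≠ 0) : A.Good (A.σ i x) (i, true) (p + 1) := by
  have h0 : ∀ s, p < s → ∑ l with l ≠ i, A.t x l s = 0 := fun s hs =>
    Finset.sum_eq_zero fun l _ => hx l s hs
  have h1 : ∑ l with l ≠ i, A.t (A.σ i x) l (p + 1) = 0 := by rw [A.sum_of_ne, h0 _ (by omega)]
  refine ⟨⟨fun l s hs => ?_, ?_⟩, Or.inl h1⟩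
  · by_cases hl : l = i
    · subst hl
      have h2 := A.upper l x s
      rw [h0 s (by omega), hx l (s - 1) (by omega)] at h2
      omega
    · rw [A.of_ne hl, hx l s (by omega)]
  · change ∑ l with l ≠ i, A.t (A.σ i x) l (p + 1) < A.t (A.σ i x) i (p + 1)
    omega

/-- A dominant kind j exceeds all others together, so a kind i ≠ j is outnumbered by j alone. -/
lemma Top.le_sum {x : Ω} {i j : ι} {p : ℤ} (h : A.Top x j p) (hij : i ≠ j) :
    A.t x i p < ∑ l with l ≠ i, A.t x l p := by
  have h1 : A.t x i p ≤ ∑ l with l ≠ j, A.t x l p :=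
    Finset.single_le_sum (f := fun l => A.t x l p) (fun _ _ => Nat.zero_le _)
      (Finset.mem_filter.2 ⟨Finset.mem_univ _, hij⟩)
  have h2 : A.t x j p ≤ ∑ l with l ≠ i, A.t x l p :=
    Finset.single_le_sum (f := fun l => A.t x l p) (fun _ _ => Nat.zero_le _)
      (Finset.mem_filter.2 ⟨Finset.mem_univ _, hij.symm⟩)
  have h3 := h.2
  omega

/-- By `upper`, slices above p + 1 cannot become occupied; the slice p + 1 can, and only by kind i.
-/
lemma supported_of_not_raise {x : Ω} {i : ι} {p : ℤ} (hx : ∀ l s, p < s → A.t x l s = 0)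
    (h : A.t (A.σ i x) i (p + 1) = 0) : ∀ l s, p < s → A.t (A.σ i x) l s = 0 := by
  intro l s hs
  by_cases hl : l = i
  · subst hl
    obtain rfl | hs' : s = p + 1 ∨ p < s - 1 := by omega
    · exact h
    · have h2 := A.upper l x s
      rw [Finset.sum_eq_zero fun l _ => hx l s hs, hx l (s - 1) hs'] at h2
      omega
  · rw [A.of_ne hl, hx l s hs]

/-- By `upper'`, inverse generators do not raise the largest slice. -/
lemma supported_inv {x : Ω} {i : ι} {p : ℤ} (hx : ∀ l s, p < s → A.t x l s = 0) :
    ∀ l s, p < s → A.t ((A.σ i)⁻¹ x) l s = 0 := by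
  intro l s hs
  by_cases hl : l = i
  · subst hl
    have h2 := A.upper' l ((A.σ l)⁻¹ x) (s + 1)
    rw [A.sum_inv_of_ne, add_sub_cancel_right, perm_apply_inv,
      Finset.sum_eq_zero fun l _ => hx l s hs, hx l (s + 1) (by omega)] at h2
    omega
  · have := A.of_ne hl ((A.σ i)⁻¹ x) s
    rw [perm_apply_inv] at this
    rw [← this, hx l s hs]

/-- A letter of a different kind preserves dominance. -/
lemma Top.good {x : Ω} {j : ι} {p : ℤ} (h : A.Top x j p) {a : ι × Bool} (ha : a.1 ≠ j) :
    ∃ p' ≥ p, A.Good (A.letter a x) a p' := by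
  obtain ⟨i, b⟩ := a
  change i ≠ j at ha
  have h0 := h.le_sum ha
  cases b
  -- With S the number of constituents of kinds other than i in slice p, `lower` makes the new
  -- number of kind i at least 2 S minus the old one, and the old one is below S by `le_sum`.
  · have h1 := A.lower i ((A.σ i)⁻¹ x) p
    rw [perm_apply_inv, A.sum_inv_of_ne] at h1
    refine ⟨p, le_rfl, ⟨supported_inv h.1, ?_⟩, ?_, ?_⟩
    · change ∑ l with l ≠ i, A.t ((A.σ i)⁻¹ x) l p < A.t ((A.σ i)⁻¹ x) i p
      rw [A.sum_inv_of_ne]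
      omega
    · change A.t (A.σ i ((A.σ i)⁻¹ x)) i p ≤ A.t ((A.σ i)⁻¹ x) i p
      rw [perm_apply_inv]
      omega
    · change ∀ l s, p < s → A.t (A.σ i ((A.σ i)⁻¹ x)) l s = 0
      rw [perm_apply_inv]
      exact h.1
  · by_cases hr : A.t (A.σ i x) i (p + 1) = 0
    · have h1 := A.lower i x p
      refine ⟨p, le_rfl, ⟨supported_of_not_raise h.1 hr, ?_⟩, Or.inr ?_⟩
      · change ∑ l with l ≠ i, A.t (A.σ i x) l p < A.t (A.σ i x) i p
        rw [A.sum_of_ne]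
        omega
      · change A.t ((A.σ i)⁻¹ (A.σ i x)) i p < A.t (A.σ i x) i p
        rw [perm_inv_apply]
        omega
    · exact ⟨p + 1, by omega, good_of_raise h.1 hr⟩

/-- A letter preserves the shape produced by the preceding letter of a reduced word. -/
lemma Good.good {x : Ω} {a c : ι × Bool} {p : ℤ} (h : A.Good x a p) (ha : c.1 = a.1 → c.2 = a.2) :
    ∃ p' ≥ p, A.Good (A.letter c x) c p' := by
  by_cases hc : c.1 = a.1
  swap
  · exact h.1.good hc
  obtain rfl : c = a := Prod.ext hc (ha hc)
  obtain ⟨i, b⟩ := c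
  obtain ⟨⟨hs, ht⟩, hg⟩ := h
  cases b
  · obtain ⟨h1, h2⟩ := hg
    -- Undoing the previous letter keeps the largest slice at most p, so a second inverse letter
    -- cannot decrease kind i in slice p, and i still dominates.
    have h3 := A.top_le i ((A.σ i)⁻¹ x) p (by rwa [perm_apply_inv])
    rw [perm_apply_inv] at h3
    refine ⟨p, le_rfl, ⟨supported_inv hs, ?_⟩, ?_, ?_⟩
    · change ∑ l with l ≠ i, A.t ((A.σ i)⁻¹ x) l p < A.t ((A.σ i)⁻¹ x) i p
      rw [A.sum_inv_of_ne]
      exact ht.trans_le h3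
    · change A.t (A.σ i ((A.σ i)⁻¹ x)) i p ≤ A.t ((A.σ i)⁻¹ x) i p
      rwa [perm_apply_inv]
    · change ∀ l s, p < s → A.t (A.σ i ((A.σ i)⁻¹ x)) l s = 0
      rwa [perm_apply_inv]
  -- If the slice were not raised, then in the pure case `upper'` would leave no constituents of
  -- kind i in slice p; in the other case `top_le` would contradict the strict growth caused by the
  -- previous letter.
  · refine ⟨p + 1, by omega, good_of_raise hs fun hr => ?_⟩
    rcases hg with h1 | h1
    · have h2 := A.upper' i x (p + 1)
      rw [add_sub_cancel_right, hr] at h2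
      change ∑ l with l ≠ i, A.t x l p = 0 at h1
      change ∑ l with l ≠ i, A.t x l p < A.t x i p at ht
      omega
    · have h2 := A.top_le i ((A.σ i)⁻¹ x) p (by
        rw [perm_apply_inv]
        exact supported_of_not_raise hs hr)
      rw [perm_apply_inv] at h2
      change A.t ((A.σ i)⁻¹ x) i p < A.t x i p at h1
      omega

/-- The action of a word. -/
def word (A : TwistSystem ι Ω) (L : List (ι × Bool)) : Equiv.Perm Ω := (L.map A.letter).prod

lemma word_good {x : Ω} {a : ι × Bool} {p : ℤ} (h : A.Good (A.letter a x) a p) :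
    ∀ L : List (ι × Bool), FreeGroup.IsReduced (L ++ [a]) →
      ∃ p' ≥ p, ∃ i, A.t (A.word (L ++ [a]) x) i p' ≠ 0 := by
  suffices ∀ L : List (ι × Bool), FreeGroup.IsReduced (L ++ [a]) →
      ∃ p' ≥ p, ∃ c ∈ (L ++ [a]).head?, A.Good (A.word (L ++ [a]) x) c p' from fun L hL => by
    obtain ⟨p', hp', c, -, hc⟩ := this L hL
    exact ⟨p', hp', c.1, by have := hc.1.2; omega⟩
  intro L
  induction L with
  | nil => exact fun _ => ⟨p, le_rfl, a, by simp, by simpa [word] using h⟩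
  | cons c L ih =>
    intro hL
    rw [List.cons_append] at hL
    obtain ⟨p', hp', b, hb, hg⟩ := ih (List.IsChain.tail hL)
    obtain ⟨p'', hp'', hg'⟩ := hg.good (c := c) (List.isChain_cons.1 hL |>.1 b hb)
    exact ⟨p'', le_trans hp' hp'', c, by simp, by simpa [word] using hg'⟩

/-- A reduced word does not lower the largest slice of an object of a kind different from the last
letter. -/
lemma word_of_ne {x : Ω} {j : ι} {a : ι × Bool} (hx : A.Top x j 0) (ha : a.1 ≠ j)
    {L : List (ι × Bool)} (hL : FreeGroup.IsReduced (L ++ [a])) :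
    ∃ p ≥ 0, ∃ i, A.t (A.word (L ++ [a]) x) i p ≠ 0 := by
  obtain ⟨p, hp, hg⟩ := hx.good ha
  obtain ⟨p', hp', h⟩ := word_good hg L hL
  exact ⟨p', hp.trans hp', h⟩

/-- A reduced word ending with a positive letter raises the largest slice of an object of the
corresponding kind. -/
lemma word_of_positive {x : Ω} {j : ι} (hx : A.Top x j 0)
    (h₀ : ∑ l with l ≠ j, A.t x l 0 = 0) {L : List (ι × Bool)}
    (hL : FreeGroup.IsReduced (L ++ [(j, true)])) :
    ∃ p ≥ 1, ∃ i, A.t (A.word (L ++ [(j, true)]) x) i p ≠ 0 := by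
  have h1 := A.upper' j x (0 + 1)
  rw [add_sub_cancel_right, h₀] at h1
  have h2 := hx.2
  have h3 : A.Good (A.letter (j, true) x) (j, true) (0 + 1) :=
    good_of_raise (i := j) hx.1 (by omega)
  exact word_good h3 L hL

lemma dual_word (L : List (ι × Bool)) :
    A.dual.word (L.map fun a => (a.1, !a.2)) = A.word L := by
  rw [word, word, List.map_map]
  congr 2
  funext a
  obtain ⟨i, b⟩ := a
  cases b
  · rfl
  · exact inv_inv (A.σ i)

/-- A non-trivial reduced word spreads some pair of simple objects over at least two slices. -/
theorem exists_spread (x : ι → Ω) (hx : ∀ j, A.t (x j) j 0 ≠ 0)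
    (hx₀ : ∀ j l s, ¬(l = j ∧ s = 0) → A.t (x j) l s = 0) (hι : Nontrivial ι)
    {L : List (ι × Bool)} (hL : FreeGroup.IsReduced L) (h : L ≠ []) :
    ∃ j j' i i' p q, q < p ∧ A.t (A.word L (x j)) i p ≠ 0 ∧ A.t (A.word L (x j')) i' q ≠ 0 := by
  have hsum : ∀ j s, ∑ l with l ≠ j, A.t (x j) l s = 0 := fun j s =>
    Finset.sum_eq_zero fun l hl => hx₀ j l s fun h => (Finset.mem_filter.1 hl).2 h.1
  have htop : ∀ j, A.Top (x j) j 0 := fun j =>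
    ⟨fun l s hs => hx₀ j l s (by omega), by have := hx j; have := hsum j 0; omega⟩
  have hbot : ∀ j, A.dual.Top (x j) j 0 := fun j =>
    ⟨fun l s hs => hx₀ j l (-s) (by omega), by
      change ∑ l with l ≠ j, A.t (x j) l (-0) < A.t (x j) j (-0)
      rw [neg_zero]
      have := hx j; have := hsum j 0; omega⟩
  obtain ⟨L, ⟨j, b⟩, rfl⟩ : ∃ L' a, L = L' ++ [a] :=
    ⟨L.dropLast, L.getLast h, (List.dropLast_append_getLast h).symm⟩
  obtain ⟨l, hl⟩ := exists_ne j
  have hL' := isReduced_map_not hL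
  have e := dual_word (A := A) (L ++ [(j, b)])
  rw [List.map_append, List.map_singleton] at hL' e
  change FreeGroup.IsReduced (_ ++ [(j, !b)]) at hL'
  change A.dual.word (_ ++ [(j, !b)]) = _ at e
  obtain ⟨p, hp, i, hi⟩ := word_of_ne (htop l) (a := (j, b)) hl.symm hL
  obtain ⟨q, hq, i', hi'⟩ := word_of_ne (hbot l) (a := (j, !b)) hl.symm hL'
  rw [e] at hi'
  cases b
  -- A last letter σ_j⁻¹ is positive for the dual system, so x j is pushed down to a slice ≤ -1,
  -- while x l with l ≠ j keeps one ≥ 0. For σ_j the roles are exchanged.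
  · obtain ⟨q, hq, i', hi'⟩ := word_of_positive (hbot j) (hsum j (-0)) hL'
    change A.dual.t (A.dual.word (_ ++ [(j, !false)]) (x j)) i' q ≠ 0 at hi'
    rw [e] at hi'
    exact ⟨l, j, i, i', p, -q, by omega, hi, hi'⟩
  · obtain ⟨p, hp, i, hi⟩ := word_of_positive (htop j) (hsum j 0) hL
    exact ⟨j, l, i, i', p, -q, by omega, hi, hi'⟩

end TwistSystem

/-! ### Counting the constituents in a slice -/

section Counting

open Pretriangulated GrProj

variable {k : Type u} [Field k] {n : ℕ}

/-- The number of constituents of kind `l` in the slice `s`. -/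
def cnt (X : D k n) (l : Fin n) (s : ℤ) : ℕ := ∑ᶠ m, mult l m (-s - m) X

lemma finite_support_mult (X : D k n) (l : Fin n) (s : ℤ) :
    (Function.support fun m => mult l m (s - m) X).Finite := by
  obtain ⟨F, hF⟩ := exists_finite_support X
  refine (F.image fun p => p.2.1).finite_toSet.subset fun m hm => ?_
  rw [Finset.mem_coe, Finset.mem_image]
  exact ⟨(l, m, s - m), by_contra fun h => hm (hF l m (s - m) h), rfl⟩

lemma cnt_eq_zero_iff {X : D k n} {l : Fin n} {s : ℤ} :
    cnt X l s = 0 ↔ ∀ m d, -(m + d) = s → mult l m d X = 0 := by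
  constructor
  · intro h m d hs
    obtain rfl : d = -s - m := by omega
    rw [cnt, finsum_eq_sum _ (finite_support_mult X l (-s)), Finset.sum_eq_zero_iff] at h
    by_contra hm
    exact hm (h m ((Set.Finite.mem_toFinset _).2 hm))
  · intro h
    refine finsum_eq_zero_of_forall_eq_zero fun m => h _ _ (by omega)

lemma cnt_iso {X Y : D k n} (e : X ≅ Y) (l : Fin n) (s : ℤ) : cnt X l s = cnt Y l s :=
  finsum_congr fun _ => mult_iso e _ _ _

lemma finsum_le_finsum_nat {f g : ℤ → ℕ} (hf : (Function.support f).Finite)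
    (hg : (Function.support g).Finite) (h : ∀ m, f m ≤ g m) : ∑ᶠ m, f m ≤ ∑ᶠ m, g m := by
  rw [finsum_eq_sum_of_support_subset f (s := hf.toFinset ∪ hg.toFinset) (by simp),
    finsum_eq_sum_of_support_subset g (s := hf.toFinset ∪ hg.toFinset) (by simp)]
  exact Finset.sum_le_sum fun m _ => h m

/-- Reindexes the sum along the antidiagonal m + d = -s, so that all terms of one inequality become
functions of the same m. -/
lemma cnt_shifted (X : D k n) (l : Fin n) (a : ℤ) {s c : ℤ} (h : c = -s - a) :
    cnt X l s = ∑ᶠ m, mult l (m + a) (c - m) X ∧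
      (Function.support fun m => mult l (m + a) (c - m) X).Finite := by
  subst h
  have e : ∀ m : ℤ, -s - (Equiv.addRight a) m = -s - a - m := fun m => by
    rw [Equiv.coe_addRight]; ring
  constructor
  · rw [cnt, ← finsum_comp_equiv (Equiv.addRight a)]
    exact finsum_congr fun m => by rw [e]; rfl
  · refine ((finite_support_mult X l (-s)).preimage (Equiv.addRight a).injective.injOn).subset
      fun m hm => ?_
    rw [Set.mem_preimage, Function.mem_support, e]
    exact hm

lemma sum_cnt_shifted (X : D k n) (i : Fin n) (a : ℤ) {s c : ℤ} (h : c = -s - a) :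
    2 * ∑ l with l ≠ i, cnt X l s =
        ∑ᶠ m, ∑ t : {j : Fin n // j ≠ i} × Bool, mult t.1.1 (m + a) (c - m) X ∧
      (Function.support fun m =>
        ∑ t : {j : Fin n // j ≠ i} × Bool, mult t.1.1 (m + a) (c - m) X).Finite := by
  constructor
  · rw [finsum_sum_comm Finset.univ
      (fun (m : ℤ) (t : {j : Fin n // j ≠ i} × Bool) => mult t.1.1 (m + a) (c - m) X)
      fun t _ => (cnt_shifted X t.1.1 a h).2, Fintype.sum_prod_type]
    simp only [← (cnt_shifted X _ a h).1, Finset.sum_const, Finset.card_univ, Fintype.card_bool,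
      smul_eq_mul, ← Finset.mul_sum]
    rw [Finset.sum_subtype (p := fun j => j ≠ i) _ (by simp)]
  · refine (Set.finite_iUnion fun t : {j : Fin n // j ≠ i} × Bool =>
      (cnt_shifted X t.1.1 a h).2).subset fun m hm => ?_
    by_contra hc
    refine hm (Finset.sum_eq_zero fun t _ => by_contra fun ht => hc (Set.mem_iUnion.2 ⟨t, ht⟩))

lemma finsum_add_le {f g h : ℤ → ℕ} (hf : (Function.support f).Finite)
    (hg : (Function.support g).Finite) (hh : (Function.support h).Finite)
    (hle : ∀ m, f m ≤ g m + h m) : ∑ᶠ m, f m ≤ ∑ᶠ m, g m + ∑ᶠ m, h m := by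
  rw [← finsum_add_distrib hg hh]
  exact finsum_le_finsum_nat hf
    ((hg.union hh).subset (Function.support_add g h)) hle

/-- Sum `mult_inequalities` over m with d = -s + 1 - m; the two labels of the edges from i to each l
produce the factor 2. -/
lemma cnt_inequalities (i : Fin n) (s : ℤ) (X : D k n) :
    (2 * ∑ l with l ≠ i, cnt X l s ≤ cnt X i s + cnt ((twistInv k i).obj X) i s) ∧
    (cnt X i s ≤ 2 * ∑ l with l ≠ i, cnt X l s + cnt ((twistInv k i).obj X) i (s - 1)) ∧
    cnt ((twistInv k i).obj X) i (s - 1) ≤ cnt X i s + 2 * ∑ l with l ≠ i, cnt X l (s - 1) := by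
  obtain ⟨e1, f1⟩ := sum_cnt_shifted X i 0 (s := s) (c := -s) (by ring)
  obtain ⟨e2, f2⟩ := sum_cnt_shifted X i 1 (s := s - 1) (c := -s) (by ring)
  obtain ⟨e3, f3⟩ := cnt_shifted X i 1 (s := s) (c := -s - 1) (by ring)
  obtain ⟨e4, f4⟩ := cnt_shifted ((twistInv k i).obj X) i (-1) (s := s) (c := -s + 1) (by ring)
  obtain ⟨e5, f5⟩ := cnt_shifted ((twistInv k i).obj X) i 0 (s := s - 1) (c := -s + 1) (by ring)
  have key := fun m => mult_inequalities i m (-s + 1 - m) X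
  simp only [show ∀ m, -s + 1 - m - 1 = -s - m from fun m => by ring,
    show ∀ m, -s + 1 - m - 2 = -s - 1 - m from fun m => by ring, sub_eq_add_neg _ (1 : ℤ)] at key
  simp only [add_zero, sub_eq_add_neg _ (1 : ℤ)] at e1 e2 e3 e4 e5 f1 f2 f3 f4 f5 ⊢
  rw [e1, e2, e3, e4, e5]
  exact ⟨finsum_add_le f1 f3 f4 fun m => (key m).1, finsum_add_le f3 f1 f5 fun m => (key m).2.1,
    finsum_add_le f5 f3 f2 fun m => (key m).2.2⟩

/-- The number of constituents as a function of the isomorphism class. -/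
def clsCnt (x : IsoClass k n) (l : Fin n) (s : ℤ) : ℕ :=
  Quotient.lift (s := isIsomorphicSetoid (D k n)) (fun X => cnt X l s)
    (fun _ _ ⟨e⟩ => cnt_iso e l s) x

lemma cnt_twist_of_ne {i l : Fin n} (h : l ≠ i) (s : ℤ) (X : D k n) :
    cnt ((twist k i).obj X) l s = cnt X l s := by
  obtain ⟨e⟩ := twistInv_twist k i X
  rw [← cnt_iso e]
  exact finsum_congr fun m => (mult_twistInv_of_ne h _ _ _).symm

lemma cnt_twist_inequalities (i : Fin n) (s : ℤ) (X : D k n) :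
    (2 * ∑ l with l ≠ i, cnt X l s ≤ cnt X i s + cnt ((twist k i).obj X) i s) ∧
    (cnt ((twist k i).obj X) i s ≤ 2 * ∑ l with l ≠ i, cnt X l s + cnt X i (s - 1)) ∧
    cnt X i (s - 1) ≤ cnt ((twist k i).obj X) i s + 2 * ∑ l with l ≠ i, cnt X l (s - 1) := by
  obtain ⟨e⟩ := twistInv_twist k i X
  have h := cnt_inequalities i s ((twist k i).obj X)
  have hs : ∀ s, ∑ l with l ≠ i, cnt ((twist k i).obj X) l s = ∑ l with l ≠ i, cnt X l s :=
    fun s => Finset.sum_congr rfl fun l hl => cnt_twist_of_ne (Finset.mem_filter.1 hl).2 s X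
  rw [cnt_iso e, cnt_iso e, hs, hs] at h
  exact ⟨by omega, h.2⟩

variable (k n) in
/-- The twists acting on the isomorphism classes. -/
def twistSystem : TwistSystem (Fin n) (IsoClass k n) where
  σ := twistPerm k
  t := clsCnt
  of_ne {i l} h x s := by
    induction x using Quotient.ind with
    | _ X => exact cnt_twist_of_ne h s X
  lower i x s := by
    induction x using Quotient.ind with
    | _ X => exact (cnt_twist_inequalities i s X).1
  upper i x s := by
    induction x using Quotient.ind with
    | _ X => exact (cnt_twist_inequalities i s X).2.1
  upper' i x s := by
    induction x using Quotient.ind with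
    | _ X => exact (cnt_twist_inequalities i s X).2.2
  top_le i x p h := by
    induction x using Quotient.ind with
    | _ X =>
      obtain ⟨e⟩ := twistInv_twist k i X
      change cnt ((twist k i).obj X) i p ≤ cnt X i p
      rw [← cnt_iso e]
      refine finsum_le_finsum_nat (finite_support_mult _ _ _) (finite_support_mult _ _ _) fun m =>
        mult_le_twistInv (p := p) (fun l m d hm => ?_) (by ring)
      by_contra! hc
      exact hm (cnt_eq_zero_iff.1 (h l _ hc) m d rfl)
  bot_le i x q h := by
    induction x using Quotient.ind with
    | _ X =>
      obtain ⟨e⟩ := twistInv_twist k i X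
      obtain ⟨e'⟩ := twistInv_twist k i ((twist k i).obj X)
      change cnt ((twist k i).obj X) i q ≤ cnt ((twist k i).obj ((twist k i).obj X)) i q
      rw [← cnt_iso e']
      refine finsum_le_finsum_nat (finite_support_mult _ _ _) (finite_support_mult _ _ _) fun m =>
        twistInv_le_mult (q := q) (fun l m d hm => ?_) (by ring)
      rw [mult_iso ((twistInv k i).mapIso e' ≪≫ e)] at hm
      by_contra! hc
      exact hm (cnt_eq_zero_iff.1 (h l _ hc) m d rfl)

end Counting

/-! ### The intervals -/

section Intervals

open Pretriangulated GrProj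

variable {k : Type u} [Field k] {n : ℕ}

lemma slice_zero_iff {X : D k n} : slice k n 0 X ↔ heart k n X := by
  have e : X⟦(-0 : ℤ)⟧ ≅ X := (shiftFunctorZero' (D k n) (-0 : ℤ) neg_zero).app X
  exact ⟨heart_iso e, heart_iso e.symm⟩

lemma heart_supportedIn {X : D k n} (hX : heart k n X) : SupportedIn 0 0 X :=
  supportedIn_of_slice (slice_zero_iff.2 hX) le_rfl le_rfl

lemma heart_singleD (j : Fin n) : heart k n (singleD k j 0 0) :=
  slice_zero_iff.1 (slice_singleD j 0 0)

lemma mapsHeartInto_iff {β : FreeGroup (Fin n)} {a b : ℤ} :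
    MapsHeartInto k β a b ↔ ∀ X : D k n, heart k n X → SupportedIn a b ((Psi k β).obj X) := by
  simp only [MapsHeartInto, inSlices_iff]

lemma MapsHeartInto.slice {β : FreeGroup (Fin n)} {a b m : ℤ} (h : MapsHeartInto k β a b)
    {X : D k n} (hX : slice k n m X) : SupportedIn (a + m) (b + m) ((Psi k β).obj X) := by
  obtain ⟨e⟩ := Psi_shift k β X (-m)
  have h1 := (((mapsHeartInto_iff.1 h _ hX).iso e).shift m).iso
    ((shiftFunctorCompIsoId (D k n) (-m) m (by omega)).app _)
  exact h1

/-- A filtration of X by slices is carried by Ψ_β to a sequence of triangles, and the bound for each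
piece passes to the extension. -/
lemma MapsHeartInto.supportedIn {β : FreeGroup (Fin n)} {a b a' b' : ℤ}
    (h : MapsHeartInto k β a b) {X : D k n} (hX : SupportedIn a' b' X) :
    SupportedIn (a + a') (b + b') ((Psi k β).obj X) := by
  have hX' := inSlices_iff.2 hX
  clear hX
  induction hX' with
  | zero a' b' X hX =>
    refine supportedIn_of_isZero _ _ ?_
    rw [IsZero.iff_id_eq_zero] at hX ⊢
    rw [← CategoryTheory.Functor.map_id, hX, Psi_map_zero]
  | step a' b' m ha hb T hT h₁ h₃ ih =>
    obtain ⟨g, w, hT'⟩ := preservesTriangles_Psi k β _ _ _ T.mor₁ T.mor₂ T.mor₃ hT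
    exact SupportedIn.of_triangle hT' (ih.mono (by omega) le_rfl)
      ((h.slice h₃).mono (by omega) (by omega))

lemma MapsHeartInto.mul {α β : FreeGroup (Fin n)} {a b a' b' : ℤ} (h : MapsHeartInto k α a b)
    (h' : MapsHeartInto k β a' b') : MapsHeartInto k (α * β) (a + a') (b + b') :=
  mapsHeartInto_iff.2 fun X hX =>
    (h.supportedIn (mapsHeartInto_iff.1 h' X hX)).iso (Psi_mul k α β X).some.symm

lemma rk_Psi_eq_zero {β : FreeGroup (Fin n)} {X Y : D k n} {f : X ⟶ Y} (hf : (Psi k β).map f = 0)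
    (j : Fin n) (m d : ℤ) : rk ((H (T k j d) m).map f.hom) = 0 :=
  rk_eq_zero_of_map_eq_zero (preservesTriangles_Psi k β) (preservesTriangles_Psi k β⁻¹)
    (Psi_map_zero k β⁻¹) (Psi_inv_Psi k β) hf _ _

/-- A constituent of X above the slice -a would be mapped entirely to positive slices, from which
there are no morphisms to the slice 0. So Ψ_β kills the morphism splitting it off, which is
impossible by faithfulness on cohomology. `devissage` serves here only to provide the triangle; its
induction hypothesis plays no role. -/
lemma MapsHeartInto.le_of_supportedIn {β : FreeGroup (Fin n)} {a b : ℤ}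
    (h : MapsHeartInto k β a b) {X : D k n} (hX : SupportedIn 0 0 ((Psi k β).obj X)) :
    ∀ j m d, mult j m d X ≠ 0 → -(m + d) ≤ -a := by
  revert hX
  refine devissage (fun X => SupportedIn 0 0 ((Psi k β).obj X) →
    ∀ j m d, mult j m d X ≠ 0 → -(m + d) ≤ -a) ?_ ?_ X
  · exact fun X hX _ j m d h => absurd (mult_of_isZero hX j m d) h
  · intro X Z j m d f g w hT hm hmax hle _ hX j' m' d' hm'
    refine (hmax j' m' d' hm').trans ?_
    by_contra! hlt
    have hf : (Psi k β).map f = 0 :=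
      hom_eq_zero (h.slice (slice_singleD j m d)) hX (Or.inl (by omega)) _
    -- If the morphism has rank zero, the cone gains the shifted constituent in degree m - 1,
    -- contradicting that multiplicities do not grow.
    have h1 := mult_triangle hT j (m - 1) d
    rw [rk_Psi_eq_zero hf, rk_Psi_eq_zero hf, sub_add_cancel] at h1
    have h2 := hle j (m - 1) d
    have h3 : mult j m d (singleD k j m d) = 1 := hdim_singleHo_self j m d
    omega

/-- Mirror image of the previous argument with the projection of X onto its lowest slice: if that
slice were below -b, its image would have only negative slices, to which the slice 0 has no
morphisms. -/
lemma MapsHeartInto.ge_of_supportedIn {β : FreeGroup (Fin n)} {a b : ℤ}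
    (h : MapsHeartInto k β a b) {X : D k n} (hX : SupportedIn 0 0 ((Psi k β).obj X)) :
    ∀ j m d, mult j m d X ≠ 0 → -b ≤ -(m + d) := by
  obtain ⟨c, hc⟩ := exists_supportedIn X
  intro j m d hm
  obtain ⟨q, ⟨j', m', d', rfl, hq⟩, hmin⟩ := Int.exists_least_of_bdd
    (P := fun s => ∃ j m d, -(m + d) = s ∧ mult j m d X ≠ 0)
    ⟨-c, by rintro _ ⟨j, m, d, rfl, h⟩; exact (hc j m d h).1⟩ ⟨_, j, m, d, rfl, hm⟩
  refine le_trans ?_ (hmin _ ⟨j, m, d, rfl, hm⟩)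
  have hX' : InSlices k n (-(m' + d')) c X := inSlices_iff.2 fun j m d h =>
    ⟨hmin _ ⟨j, m, d, rfl, h⟩, (hc j m d h).2⟩
  generalize hs : -(m' + d') = s at hX'
  -- The last step of the filtration is the lowest piece. Its kernel `T.obj₁` has only higher
  -- slices, so the minimal constituent comes from `T.obj₃`, which then lies in the minimal slice.
  cases hX' with
  | zero _ _ _ h0 => exact absurd (mult_of_isZero h0 j m d) hm
  | step _ _ p hp _ T hT h₁ h₃ =>
    have h₁' := h₁.supportedIn
    have hT' : Triangle.mk T.mor₁ T.mor₂ T.mor₃ ∈ distTriang (D k n) := hT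
    have h4 := mult_le_of_triangle hT' j' m' d'
    have h5 : mult j' m' d' T.obj₁ = 0 := by
      by_contra hc
      have := h₁' j' m' d' hc
      omega
    have h6 : mult j' m' d' T.obj₃ ≠ 0 := by omega
    have h7 : -(m' + d') = p := by_contra fun hc => h6 (mult_slice h₃ j' hc)
    by_contra! hlt
    have hf : (Psi k β).map T.mor₂ = 0 :=
      hom_eq_zero hX (h.slice h₃) (Or.inl (by omega)) _
    have h8 := mult_triangle (rot_of_distTriang _ hT') j' m' d'
    have h10 := rk_Psi_eq_zero hf j'
    have h9 : mult j' m' d' (T.obj₁⟦(1 : ℤ)⟧) = 0 := by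
      rw [mult_shift T.obj₁ j' rfl]
      by_contra hc
      have := h₁' j' _ d' hc
      omega
    change mult j' m' d' (T.obj₁⟦(1 : ℤ)⟧) + rk ((H (GrProj.T k j' d') m').map T.mor₂.hom) +
      rk ((H (GrProj.T k j' d') (m' + 1)).map T.mor₂.hom) =
      mult j' m' d' T.obj₃ + mult j' (m' + 1) d' T.obj₂ at h8
    rw [h10, h10] at h8
    omega

/-- Apply the two preceding bounds to Ψ_β⁻¹ X, whose image under Ψ_β is X up to isomorphism and lies
in the heart. -/
lemma MapsHeartInto.inv {β : FreeGroup (Fin n)} {a b : ℤ} (h : MapsHeartInto k β a b) :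
    MapsHeartInto k β⁻¹ (-b) (-a) :=
  mapsHeartInto_iff.2 fun X hX j m d hm => by
    have h0 := (heart_supportedIn hX).iso (Psi_Psi_inv k β X).some.symm
    exact ⟨h.ge_of_supportedIn h0 j m d hm, h.le_of_supportedIn h0 j m d hm⟩

lemma mapsHeartInto_one : MapsHeartInto k (1 : FreeGroup (Fin n)) 0 0 :=
  mapsHeartInto_iff.2 fun X hX => by
    rw [Psi_one_obj]
    exact heart_supportedIn hX

/-- By `upper` the slices of a twisted object of the heart are 0 or 1; the cruder interval is enough
for finiteness. -/
lemma mapsHeartInto_of (i : Fin n) : MapsHeartInto k (FreeGroup.of i) (-1) 1 :=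
  mapsHeartInto_iff.2 fun X hX l m d hm => by
    have e : Nonempty ((Psi k (FreeGroup.of i)).obj X ≅ (twist k i).obj X) := by
      rw [← cls_eq_iff, ← isoAction_cls, ← twistPerm_cls, isoAction, FreeGroup.lift_apply_of]
    rw [mult_iso e.some] at hm
    have h0 : ∀ l s, s ≠ 0 → cnt X l s = 0 := fun l s hs => cnt_eq_zero_iff.2 fun m d hmd =>
      mult_slice (slice_zero_iff.2 hX) l (by omega)
    have h1 : cnt ((twist k i).obj X) l (-(m + d)) ≠ 0 := fun h =>
      hm (cnt_eq_zero_iff.1 h m d rfl)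
    by_contra! hc
    refine h1 ?_
    by_cases hl : l = i
    · subst hl
      have h2 := (cnt_twist_inequalities l (-(m + d)) X).2.1
      rw [Finset.sum_eq_zero fun l _ => h0 l _ (by omega), h0 l (-(m + d) - 1) (by omega)] at h2
      omega
    · rw [cnt_twist_of_ne hl, h0 l _ (by omega)]

lemma exists_mapsHeartInto (β : FreeGroup (Fin n)) : ∃ a b, MapsHeartInto k β a b := by
  induction β using FreeGroup.induction_on with
  | C1 => exact ⟨0, 0, mapsHeartInto_one⟩
  | of i => exact ⟨-1, 1, mapsHeartInto_of i⟩
  | inv_of i _ => exact ⟨_, _, (mapsHeartInto_of i).inv⟩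
  | mul α β h h' =>
    obtain ⟨a, b, h⟩ := h
    obtain ⟨a', b', h'⟩ := h'
    exact ⟨_, _, h.mul h'⟩

/-- Guards against the empty case: a zero image would lie in D^{[a,b]} for all intervals, and no
smallest one would exist. -/
lemma exists_mult_Psi_ne_zero (hn : 2 ≤ n) (β : FreeGroup (Fin n)) :
    ∃ X : D k n, heart k n X ∧ ∃ j m d, mult j m d ((Psi k β).obj X) ≠ 0 := by
  let j : Fin n := ⟨0, by omega⟩
  refine ⟨singleD k j 0 0, heart_singleD j, ?_⟩
  by_contra! h
  have h0 : IsZero ((Psi k β).obj (singleD k j 0 0)) := isZero_of_mult h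
  have h1 : IsZero ((Psi k β⁻¹).obj ((Psi k β).obj (singleD k j 0 0))) := by
    rw [IsZero.iff_id_eq_zero] at h0 ⊢
    rw [← CategoryTheory.Functor.map_id, h0, Psi_map_zero]
  have h2 : mult j 0 0 (singleD k j 0 0) = 1 := hdim_singleHo_self j 0 0
  rw [← mult_iso (Psi_inv_Psi k β (singleD k j 0 0)).some, mult_of_isZero h1] at h2
  omega

lemma exists_smallestInterval (hn : 2 ≤ n) (β : FreeGroup (Fin n)) :
    ∃ a b, IsSmallestInterval k β a b := by
  obtain ⟨a₀, b₀, h₀⟩ := exists_mapsHeartInto (k := k) β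
  obtain ⟨X, hX, j, m, d, hm⟩ := exists_mult_Psi_ne_zero (k := k) hn β
  have hb : ∀ a b, MapsHeartInto k β a b → a ≤ -(m + d) ∧ -(m + d) ≤ b := fun a b h =>
    mapsHeartInto_iff.1 h X hX j m d hm
  obtain ⟨a, ⟨b₁, ha⟩, hmax⟩ := Int.exists_greatest_of_bdd
    (P := fun a => ∃ b, MapsHeartInto k β a b) ⟨_, fun a ⟨b, h⟩ => (hb a b h).1⟩ ⟨a₀, b₀, h₀⟩
  obtain ⟨b, ⟨a₁, hb'⟩, hmin⟩ := Int.exists_least_of_bdd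
    (P := fun b => ∃ a, MapsHeartInto k β a b) ⟨_, fun b ⟨a, h⟩ => (hb a b h).2⟩ ⟨b₀, a₀, h₀⟩
  -- The two ends are optimised separately; they combine because the support condition is a
  -- conjunction of a lower and an upper bound.
  have hab : MapsHeartInto k β a b := mapsHeartInto_iff.2 fun X hX j m d hm =>
    ⟨(mapsHeartInto_iff.1 ha X hX j m d hm).1, (mapsHeartInto_iff.1 hb' X hX j m d hm).2⟩
  have := hb _ _ hab
  exact ⟨a, b, by omega, hab, fun a' b' _ h => ⟨hmax _ ⟨b', h⟩, hmin _ ⟨a', h⟩⟩⟩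

/-- The action of the system of twists by words is the action of the free group. -/
lemma twistSystem_word (β : FreeGroup (Fin n)) :
    (twistSystem k n).word β.toWord = isoAction k β := by
  conv_rhs => rw [← FreeGroup.mk_toWord (x := β)]
  rfl

/-- `exists_spread` for the projectives P_j, which lie in the heart, shows that two different slices
occur in the image of the heart. -/
lemma mapsHeartInto_lt (hn : 2 ≤ n) {β : FreeGroup (Fin n)} (hβ : β ≠ 1) {a b : ℤ}
    (h : MapsHeartInto k β a b) : a < b := by
  have hP : ∀ (j l : Fin n) m d, mult l m d (singleD k j 0 0) ≤ if l = j ∧ m = 0 ∧ d = 0 then 1 else 0 :=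
    fun j l m d => hdim_singleHo_le j l 0 m 0 d
  obtain ⟨j, j', i, i', p, q, hqp, hp, hq⟩ := (twistSystem k n).exists_spread
    (fun j => cls (singleD k j 0 0)) (fun j hj => by
      have h1 : mult j 0 0 (singleD k j 0 0) = 0 := cnt_eq_zero_iff.1 hj 0 0 (by simp)
      have h2 : mult j 0 0 (singleD k j 0 0) = 1 := hdim_singleHo_self j 0 0
      omega)
    (fun j l s hs => cnt_eq_zero_iff.2 fun m d hmd => by
      have := hP j l m d
      rw [if_neg (fun h => hs ⟨h.1, by omega⟩)] at this
      omega)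
    (Fin.nontrivial_iff_two_le.2 hn) (FreeGroup.isReduced_toWord (x := β))
    (fun h => hβ (FreeGroup.toWord_eq_nil_iff.1 h))
  have key : ∀ j i p, (twistSystem k n).t ((twistSystem k n).word β.toWord
      (cls (singleD k j 0 0))) i p ≠ 0 → a ≤ p ∧ p ≤ b := by
    intro j i p hp
    rw [twistSystem_word, isoAction_cls] at hp
    by_contra hc
    refine hp (cnt_eq_zero_iff.2 fun m d hmd => by_contra fun hm => hc ?_)
    have := mapsHeartInto_iff.1 h _ (heart_singleD j) i m d hm
    omega
  have := key _ _ _ hp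
  have := key _ _ _ hq
  omega

end Intervals

end ExoticMetric

end

theorem mainTheorem8 (k : Type u) [Field k] [CharZero k] (n : ℕ) (hn : 2 ≤ n) :
    ∃ φm φp : FreeGroup (Fin n) → ℤ,
      (∀ β, ExoticMetric.IsSmallestInterval k β (φm β) (φp β)) ∧
      (let d : FreeGroup (Fin n) → FreeGroup (Fin n) → ℤ :=
        fun α β => φp (β⁻¹ * α) - φm (β⁻¹ * α)
       (∀ α β, 0 ≤ d α β) ∧
       (∀ α β, d α β = 0 ↔ α = β) ∧
       (∀ α β, d α β = d β α) ∧
       (∀ α β γ, d α γ ≤ d α β + d β γ) ∧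
       (∀ γ α β, d (γ * α) (γ * β) = d α β)) ∧
      (∀ β : FreeGroup (Fin n),
        (∀ X, ExoticMetric.heart k n X →
          ExoticMetric.heart k n ((ExoticMetric.Psi k β).obj X)) ↔ β = 1) := by
  choose φm φp hφ using fun β => ExoticMetric.exists_smallestInterval (k := k) hn β
  have hmul : ∀ α β, φp (α * β) - φm (α * β) ≤ (φp α - φm α) + (φp β - φm β) := fun α β => by
    have h1 := (hφ α).1
    have h2 := (hφ β).1
    have := (hφ (α * β)).2.2 _ _ (by omega) ((hφ α).2.1.mul (hφ β).2.1)
    omega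
  have hinv : ∀ β, φp β⁻¹ - φm β⁻¹ ≤ φp β - φm β := fun β => by
    have h1 := (hφ β).1
    have := (hφ β⁻¹).2.2 _ _ (by omega) (hφ β).2.1.inv
    omega
  refine ⟨φm, φp, hφ, ⟨fun α β => ?_, fun α β => ?_, fun α β => ?_, fun α β γ => ?_,
    fun γ α β => ?_⟩, fun β => ⟨fun h => ?_, ?_⟩⟩
  · have := (hφ (β⁻¹ * α)).1
    exact sub_nonneg.2 this
  · change φp (β⁻¹ * α) - φm (β⁻¹ * α) = 0 ↔ α = β
    constructor
    · intro h
      by_contra hne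
      have := ExoticMetric.mapsHeartInto_lt hn (fun h => hne (inv_mul_eq_one.1 h).symm)
        (hφ (β⁻¹ * α)).2.1
      omega
    · rintro rfl
      have h1 := (hφ (α⁻¹ * α)).1
      have h2 := (hφ (α⁻¹ * α)).2.2 0 0 le_rfl (by
        rw [inv_mul_cancel]
        exact ExoticMetric.mapsHeartInto_one)
      omega
  · change φp (β⁻¹ * α) - φm (β⁻¹ * α) = φp (α⁻¹ * β) - φm (α⁻¹ * β)
    have h1 := hinv (β⁻¹ * α)
    have h2 := hinv (α⁻¹ * β)
    rw [mul_inv_rev, inv_inv] at h1 h2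
    omega
  · change φp (γ⁻¹ * α) - φm (γ⁻¹ * α) ≤
      φp (β⁻¹ * α) - φm (β⁻¹ * α) + (φp (γ⁻¹ * β) - φm (γ⁻¹ * β))
    -- The triangle inequality is subadditivity for γ⁻¹α = (γ⁻¹β)(β⁻¹α).
    have := hmul (γ⁻¹ * β) (β⁻¹ * α)
    rw [mul_assoc, mul_inv_cancel_left] at this
    omega
  · simp only [mul_inv_rev, mul_assoc, inv_mul_cancel_left]
  · by_contra hne
    exact lt_irrefl _ (ExoticMetric.mapsHeartInto_lt (k := k) (a := 0) (b := 0) hn hne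
      fun X hX => ExoticMetric.inSlices_of_slice (ExoticMetric.slice_zero_iff.2 (h X hX))
        le_rfl le_rfl)
  · rintro rfl X hX
    rwa [ExoticMetric.Psi_one_obj]
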